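/- \textbf{Setting.} Consider a stationary axisymmetric vacuum field near spatial infinity: the norm $\lambda>0$ and the twist potential $\omega$ of the time-like Killing field are functions on the 3-manifold $V$ of Killing trajectories which, in Weyl coordinates, carries the metric $h=R^2d\varphi^2+e^{2\beta}(dR^2+dZ^2)$, and they satisfy the vacuum field equations $R_{ab}=\frac1{2\lambda^2}(D_a\lambda D_b\lambda+D_a\omega D_b\omega)$, $D^aD_a\lambda=\frac1\lambda(D^a\lambda D_a\lambda-D^a\omega D_a\omega)$, $D^aD_a\omega=\frac2\lambda D^a\lambda D_a\omega$. Put $\tilde\rho=\frac{R}{R^2+Z^2}$, $\tilde z=\frac{Z}{R^2+Z^2}$, $(\tilde x,\tilde y)=(\tilde\rho\cos\varphi,\tilde\rho\sin\varphi)$, let $\Lambda$ be the origin of $(\tilde x,\tilde y,\tilde z)$-space, and let $\phi=\frac{1-\lambda-i\omega}{1+\lambda+i\omega}$. It is assumed that $\beta$ and $f=\phi/\sqrt{\tilde\rho^2+\tilde z^2}$ are independent of $\varphi$ and extend to real-analytic functions of $(\tilde x,\tilde y,\tilde z)$ near $\Lambda$, and that $\hat h=\hat\Omega^2h=\tilde\rho^2e^{-2\beta}d\varphi^2+d\tilde\rho^2+d\tilde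 z^2$, where $\hat\Omega=(\tilde\rho^2+\tilde z^2)e^{-\beta}$, is smooth at $\Lambda$. Let $\Omega=e^{\kappa}\hat\Omega$ with $\kappa$ real-analytic near $\Lambda$, axisymmetric, and $\kappa(\Lambda)=0$; write $\kappa'(0)=\partial_{\tilde z}\kappa(\Lambda)$ (the choice of this number is the freedom of translation along the axis). The multipole moments $m_n\in\mathbb C$ are defined by $P_{a_1\dots a_n}(\Lambda)=m_n\,C[z_{a_1}\cdots z_{a_n}]$, $z=d\tilde z$, where $C[\,\cdot\,]$ is the totally symmetric trace-free part, $P=\phi/\sqrt\Omega$, and $$P_{a_1\dots a_n}=C\bigl[\tilde D_{a_1}P_{a_2\dots a_n}-\tfrac{(n-1)(2n-3)}2\tilde R_{a_1a_2}P_{a_3\dots a_n}\bigr]$$ with the covariant derivative and Ricci tensor of $\tilde h=\Omega^2h$. Writing $w=\frac{\tilde z+i\tilde\rho}2$ and $f=\sum_{n,m}a_{n,m}w^n\bar w^m$ near $\Lambda$, the leading order part of $f$ is $f_L(r)=\sum_n a_{n,0}r^n$. \textbf{Theorem.} Let $m_0,m_1,\dots\in\mathbb C$ be such that $y(\rho)=\sum_{n\ge0}\frac{m_n}{n!}\rho^n$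 has positive radius of convergence, and let $c\in\mathbb R$. Put $$\mathfrak g(\rho)=\int_0^\rho\frac1{t^2}\int_0^{t}2s\,|y(s)+2s\,y'(s)|^2\,ds\,dt+c .$$ Then $\mathfrak g$ is real-analytic near $0$; the map $r(\rho)=\rho/(1+\rho\,\mathfrak g(\rho))$ has near $0$ a real-analytic two-sided inverse $\rho=\rho(r)$ with $\rho(0)=0$; and $$f_L(r)=\sqrt{1+\rho(r)\,\mathfrak g(\rho(r))}\;y(\rho(r))$$ is a complex-valued real-analytic function near $r=0$. For every stationary axisymmetric vacuum field as above whose multipole moments, computed with some $\kappa$ as above with $\kappa'(0)=c$, are $m_0,m_1,\dots$, the leading order part of $f$ exists near $r=0$ and equals this $f_L$. In particular, $f_L$ is uniquely determined near the origin by the moments (and by $c$, which is usually set to $0$). -/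

import Mathlib

open scoped Nat Topology ContDiff ComplexConjugate

noncomputable section

namespace AxisymMultipole

/-! ### Tensor calculus in one chart of a three-dimensional manifold -/

/-- Coordinate points `(x̃, ỹ, z̃)`; the coordinates are numbered `0, 1, 2`. -/
abbrev Pt := Fin 3 → ℝ

/-- A Riemannian metric in the chart, by its components `h_ij`. -/
abbrev MetricField := Pt → Matrix (Fin 3) (Fin 3) ℝ

/-- Components of a complex covariant tensor of rank `n` at a point. -/
abbrev Tensor (n : ℕ) := (Fin n → Fin 3) → ℂ

/-- The partial derivative `∂_i F` at `x`. -/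
def pd {E : Type*} [NormedAddCommGroup E] [NormedSpace ℝ E] (i : Fin 3) (F : Pt → E) (x : Pt) : E :=
  fderiv ℝ F x (Pi.single i 1)

/-- The Christoffel symbol `Γ^k_{ij}` of the Levi-Civita connection. -/
def christoffel (h : MetricField) (k i j : Fin 3) (x : Pt) : ℝ :=
  1 / 2 * ∑ l, (h x)⁻¹ k l *
    (pd i (fun y => h y j l) x + pd j (fun y => h y i l) x - pd l (fun y => h y i j) x)

/-- The Ricci tensor `R_ij`, with the sign for which round spheres have positive Ricci tensor. -/
def ricci (h : MetricField) (i j : Fin 3) (x : Pt) : ℝ :=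
  ∑ k, (pd k (christoffel h k i j) x - pd j (christoffel h k i k) x) +
    ∑ k, ∑ l, (christoffel h k k l x * christoffel h l i j x
      - christoffel h k j l x * christoffel h l i k x)

/-- `⟨du, dv⟩ = h^{ij} ∂_i u ∂_j v`. -/
def gradInner (h : MetricField) (u v : Pt → ℝ) (x : Pt) : ℝ :=
  ∑ i, ∑ j, (h x)⁻¹ i j * pd i u x * pd j v x

/-- The Laplacian `D^a D_a u = h^{ij} (∂_i ∂_j u - Γ^k_{ij} ∂_k u)`. -/
def laplacian (h : MetricField) (u : Pt → ℝ) (x : Pt) : ℝ :=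
  ∑ i, ∑ j, (h x)⁻¹ i j * (pd i (pd j u) x - ∑ k, christoffel h k i j x * pd k u x)

/-- The covariant derivative `D_{a_0} T_{a_1 … a_n}`; the derivative index comes first. -/
def covDeriv (h : MetricField) {n : ℕ} (T : Pt → Tensor n) (x : Pt) : Tensor (n + 1) := fun a =>
  pd (a 0) (fun y => T y (Fin.tail a)) x -
    ∑ i : Fin n, ∑ k : Fin 3,
      (christoffel h k (a 0) (Fin.tail a i) x : ℂ) * T x (Function.update (Fin.tail a) i k)

/-- The totally symmetric part. -/
def symPart {n : ℕ} (T : Tensor n) : Tensor n := fun a =>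
  (1 / (n ! : ℂ)) * ∑ σ : Equiv.Perm (Fin n), T (a ∘ σ)

/-- `R_{a_0 a_1} S_{a_2 …}` for a real two-index symbol `R`. -/
def mulTwo (R : Fin 3 → Fin 3 → ℝ) {n : ℕ} (S : Tensor n) : Tensor (n + 2) := fun a =>
  (R (a 0) (a 1) : ℂ) * S (fun i => a i.succ.succ)

/-- `Q = C[T]`: `Q` is the totally symmetric and trace-free part of `T` for the metric `h` at a
point.  In rank at least two this is the unique symmetric trace-free `Q` that differs from the
symmetric part of `T` by a pure trace term `h_{(ab} S_{c…)}`. -/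
def IsSTFPart (h : Matrix (Fin 3) (Fin 3) ℝ) : {n : ℕ} → Tensor n → Tensor n → Prop
  | 0, T, Q => Q = T
  | 1, T, Q => Q = T
  | n + 2, T, Q =>
      (∀ (σ : Equiv.Perm (Fin (n + 2))) (a : Fin (n + 2) → Fin 3), Q (a ∘ σ) = Q a) ∧
      (∀ a : Fin n → Fin 3,
        ∑ k : Fin 3, ∑ l : Fin 3, (h⁻¹ k l : ℂ) * Q (Fin.cons k (Fin.cons l a)) = 0) ∧
      ∃ S : Tensor n, symPart T = Q + symPart (mulTwo (fun i j => h i j) S)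

/-- The tensor `z_{a_1} … z_{a_n}` with `z = dz̃`. -/
def zTensor (n : ℕ) : Tensor n := fun a => ∏ i, if a i = 2 then 1 else 0

/-- The metric `h` (regular at the origin `Λ`) and the scalar potential `p` (prescribed off `Λ`)
have the axisymmetric multipole moments `m`: the tensor fields `P^{(n)}` of the recursion
`P^{(0)} = p`, `P^{(1)} = D P^{(0)}`,
`P^{(n)}_{a_1…a_n} = C[D_{a_1} P_{a_2…a_n} - ((n-1)(2n-3)/2) R_{a_1 a_2} P_{a_3…a_n}]`
satisfy `P^{(n)}(Λ) = m_n C[z_{a_1} … z_{a_n}]`.  The totally symmetric trace-free part always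
exists, so for analytic data these tensor fields exist, are unique and are analytic near `Λ`. -/
def HasMultipoleMoments (h : MetricField) (p : Pt → ℂ) (m : ℕ → ℂ) : Prop :=
  ∃ P : (n : ℕ) → Pt → Tensor n,
    (∀ n, AnalyticAt ℝ (P n) 0) ∧
    (∀ᶠ x in 𝓝[≠] (0 : Pt), P 0 x = fun _ => p x) ∧
    (∀ᶠ x in 𝓝 (0 : Pt), IsSTFPart (h x) (covDeriv h (P 0) x) (P 1 x)) ∧
    (∀ n : ℕ, ∀ᶠ x in 𝓝 (0 : Pt), IsSTFPart (h x)
      (covDeriv h (P (n + 1)) x -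
        (((n : ℂ) + 1) * (2 * n + 1) / 2) • mulTwo (fun i j => ricci h i j x) (P n x))
      (P (n + 2) x)) ∧
    ∀ n : ℕ, ∃ Q : Tensor n, IsSTFPart (h 0) (zTensor n) Q ∧ P n 0 = m n • Q

/-! ### Stationary axisymmetric vacuum fields near spatial infinity

The coordinates are `x̃ = ρ̃ cos φ`, `ỹ = ρ̃ sin φ`, `z̃`, where `ρ̃ = R / (R² + Z²)`,
`z̃ = Z / (R² + Z²)` come from Weyl coordinates `(R, Z)`; spatial infinity `Λ` is the origin. -/

/-- `ρ̃² + z̃²`. -/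
def normSq (x : Pt) : ℝ := x 0 ^ 2 + x 1 ^ 2 + x 2 ^ 2

/-- Independence of the azimuth, near the origin. -/
def IsAxisymmetric {E : Type*} (F : Pt → E) : Prop :=
  ∀ᶠ x in 𝓝 (0 : Pt), ∀ y : Pt,
    y 0 ^ 2 + y 1 ^ 2 = x 0 ^ 2 + x 1 ^ 2 → y 2 = x 2 → F y = F x

/-- Components of `ρ̃² dφ = x̃ dỹ - ỹ dx̃`. -/
def azimuthForm (x : Pt) : Fin 3 → ℝ := ![-x 1, x 0, 0]

/-- The metric `ĥ = ρ̃² e^{-2β} dφ² + dρ̃² + dz̃²` in the coordinates `(x̃, ỹ, z̃)`, that is,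
`dx̃² + dỹ² + dz̃² + (e^{-2β} - 1) ρ̃² dφ²`. -/
def hatMetric (β : Pt → ℝ) : MetricField := fun x =>
  1 + ((Real.exp (-2 * β x) - 1) / (x 0 ^ 2 + x 1 ^ 2)) •
    Matrix.vecMulVec (azimuthForm x) (azimuthForm x)

/-- The conformal factor `Ω̂ = (ρ̃² + z̃²) e^{-β}`. -/
def hatOmega (β : Pt → ℝ) (x : Pt) : ℝ := normSq x * Real.exp (-β x)

/-- The metric `h = R² dφ² + e^{2β} (dR² + dZ²)` on the space of Killing trajectories, off `Λ`,
in the coordinates `(x̃, ỹ, z̃)`: it is `Ω̂⁻² ĥ`. -/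
def orbitMetric (β : Pt → ℝ) : MetricField := fun x => ((hatOmega β x) ^ 2)⁻¹ • hatMetric β x

/-- The potential `φ = (1 - λ - iω) / (1 + λ + iω)`. -/
def ernstPotential (lam om : Pt → ℝ) (x : Pt) : ℂ :=
  (1 - (lam x : ℂ) - Complex.I * om x) / (1 + (lam x : ℂ) + Complex.I * om x)

/-- A stationary axisymmetric vacuum field near spatial infinity: the norm `λ` and the twist
potential `ω` of the time-like Killing field and the function `β` in the Weyl form of the metric.
The potential `f = φ / √(ρ̃² + z̃²)` and `β` are real-analytic functions of `(x̃, ỹ, z̃)` at `Λ`. -/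
structure StationaryAxisymmetricVacuum where
  lam : Pt → ℝ
  om : Pt → ℝ
  β : Pt → ℝ
  f : Pt → ℂ
  β_analytic : AnalyticAt ℝ β 0
  β_axisymmetric : IsAxisymmetric β
  /-- The rescaled metric is smooth at the added point `Λ`. -/
  metric_smooth : ∀ i j, ContDiffAt ℝ ∞ (fun x => hatMetric β x i j) 0
  f_analytic : AnalyticAt ℝ f 0
  f_axisymmetric : IsAxisymmetric f
  /-- `φ = √(ρ̃² + z̃²) f`. -/
  potential_eq : ∀ᶠ x in 𝓝[≠] (0 : Pt), ernstPotential lam om x = (√(normSq x) : ℂ) * f x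
  lam_pos : ∀ᶠ x in 𝓝[≠] (0 : Pt), 0 < lam x
  /-- `R_ab = (D_a λ D_b λ + D_a ω D_b ω) / (2 λ²)`. -/
  ricci_eq : ∀ᶠ x in 𝓝[≠] (0 : Pt), ∀ i j, ricci (orbitMetric β) i j x =
    1 / (2 * lam x ^ 2) * (pd i lam x * pd j lam x + pd i om x * pd j om x)
  /-- `D^a D_a λ = (D^a λ D_a λ - D^a ω D_a ω) / λ`. -/
  lam_eq : ∀ᶠ x in 𝓝[≠] (0 : Pt), laplacian (orbitMetric β) lam x =
    1 / lam x * (gradInner (orbitMetric β) lam lam x - gradInner (orbitMetric β) om om x)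
  /-- `D^a D_a ω = 2 D^a λ D_a ω / λ`. -/
  om_eq : ∀ᶠ x in 𝓝[≠] (0 : Pt), laplacian (orbitMetric β) om x =
    2 / lam x * gradInner (orbitMetric β) lam om x

/-- An admissible choice `Ω = e^κ Ω̂` of the conformal factor with `κ'(0) = c`, the derivative
being the one along the axis. -/
structure IsConformalGauge (κ : Pt → ℝ) (c : ℝ) : Prop where
  analytic : AnalyticAt ℝ κ 0
  axisymmetric : IsAxisymmetric κ
  zero : κ 0 = 0
  deriv_axis : pd 2 κ 0 = c

/-- The rescaled metric `h̃ = Ω² h = e^{2κ} ĥ`, regular at `Λ`. -/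
def tildeMetric (β κ : Pt → ℝ) : MetricField := fun x => Real.exp (2 * κ x) • hatMetric β x

/-- The rescaled potential `φ̃ = φ / √Ω` off `Λ`, with `Ω = e^κ Ω̂`. -/
def tildePotential (S : StationaryAxisymmetricVacuum) (κ : Pt → ℝ) (x : Pt) : ℂ :=
  ernstPotential S.lam S.om x / (√(Real.exp (κ x) * hatOmega S.β x) : ℂ)

/-- `m` is the sequence of multipole moments of `S`, computed with the conformal factor
`Ω = e^κ Ω̂`. -/
def StationaryAxisymmetricVacuum.HasMoments (S : StationaryAxisymmetricVacuum) (κ : Pt → ℝ)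
    (m : ℕ → ℂ) : Prop :=
  HasMultipoleMoments (tildeMetric S.β κ) (tildePotential S κ) m

/-- `fL` is (near the origin) the leading order part of `f`: if `f = ∑ a_{n,m} wⁿ w̄ᵐ` with
`w = (z̃ + i ρ̃) / 2` and `g(ξ, ζ) = ∑ a_{n,m} ξⁿ ζᵐ`, then `fL(r) = g(r, 0)`. -/
def IsLeadingOrderPart (f : Pt → ℂ) (fL : ℝ → ℂ) : Prop :=
  ∃ (a : ℕ → ℕ → ℂ) (r₀ : ℝ), 0 < r₀ ∧
    (∀ w : ℂ, ‖w‖ < r₀ →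
      HasSum (fun p : ℕ × ℕ => a p.1 p.2 * w ^ p.1 * (conj w) ^ p.2)
        (f ![2 * w.im, 0, 2 * w.re])) ∧
    ∀ r : ℝ, |r| < r₀ → HasSum (fun n : ℕ => a n 0 * (r : ℂ) ^ n) (fL r)

/-! ### The functions formed from the moments -/

/-- `y(ρ) = ∑ m_n ρⁿ / n!`. -/
def momentSeries (m : ℕ → ℂ) (ρ : ℝ) : ℂ := ∑' n : ℕ, m n / (n ! : ℂ) * (ρ : ℂ) ^ n

/-- The radius of convergence of `∑ m_n ρⁿ / n!`. -/
def momentRadius (m : ℕ → ℂ) : ENNReal :=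
  (FormalMultilinearSeries.ofScalars ℂ (fun n => m n / (n ! : ℂ))).radius

/-- `𝔤(ρ) = ∫_0^ρ t⁻² ∫_0^t 2 s |y(s) + 2 s y'(s)|² ds dt + c`. -/
def gothicG (m : ℕ → ℂ) (c ρ : ℝ) : ℝ :=
  (∫ t in (0 : ℝ)..ρ, 1 / t ^ 2 *
    ∫ s in (0 : ℝ)..t, 2 * s * ‖momentSeries m s + 2 * (s : ℂ) * deriv (momentSeries m) s‖ ^ 2) + c

/-- `r(ρ) = ρ / (1 + ρ 𝔤(ρ))`. -/
def rOfRho (m : ℕ → ℂ) (c ρ : ℝ) : ℝ := ρ / (1 + ρ * gothicG m c ρ)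

end AxisymMultipole

end

/-! Everything is read off along the complex null vector `η = ∂_z̃ - i ∂_x̃` at points of the plane
`ỹ = 0`. There `η` is `∂/∂w`, so the Taylor series of `f` at `Λ` along `η` is `∑ a_{n,0} rⁿ`: the
leading order part is a one-variable Taylor series (`nullTaylor_eq`, `exists_leadingPart`). Below, a
prime is the derivative along `η`, and `z̃`, `x̃` restrict to `r`, `-i r`.

A null vector makes the moment recursion scalar. Contracting all indices with `η` kills
symmetrization and trace terms (`contract_of_isSTFPart`), `η` is pregeodesic with `Γ(η,η) = 2 κ' η`
(`sum_nullVec_christoffel`), and the contracted Ricci tensor of `h̃` restricts to `R = β'' - β'² +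
2β'/r - κ'' + κ'²` (`sum_nullVec_ricci`). Hence the contractions `p_n` satisfy `p_n = p_{n-1}' -
2(n-1) κ' p_{n-1} - ((n-1)(2n-3)/2) R p_{n-2}`, with `p_n(Λ) = m_n` and `p_0 = e^{(β-κ)/2} f`.
Contracting the field equation for the Ricci tensor of `h` in the same way, where `ρ̃² + z̃²`
restricts to zero, gives `β' = r (f + 2r f')(f̄ + 2r f̄')` (`nullTaylor_beta`). Axisymmetry makes
the series of `f̄` the coefficientwise conjugate of that of `f`, so this equation is `b' = r |F + 2r
F'|²` for functions on the real line.

The values `p_n(Λ)` depend on `κ` only through `κ'(0)` (`gauge_invariance`), so `κ` may be replaced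
by a `K` with `K'(0) = c` for which `R` vanishes. Then the recursion integrates: with `ρ₁' = e^{2K}`
and `y(ρ₁) = e^{(b-K)/2} F`, the `n`-th potential is `y⁽ⁿ⁾(ρ₁) e^{2nK}`, and therefore `m_n =
y⁽ⁿ⁾(0)`; that is, `y` is the moment series (`iteratedDeriv_eq`).

Such a `K` is explicit (`exists_isAdaptedGauge`): `e^{b-K} = 1 - r g` with `r² g' = e^{2b} - 1` and
`g(0) = c`, and `ρ₁ = r / (1 - r g)`. Rewritten in the variable `ρ₁`, the equation for `b` becomes
`∫ 2s |y + 2s y'|² ds = 1 - e^{-2b}` (`source_eq`), and that for `g` becomes `g = 𝔤(ρ₁)`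
(`primitive_eq`). So `r = ρ₁ / (1 + ρ₁ 𝔤(ρ₁))` and `F = √(1 + ρ₁ 𝔤(ρ₁)) y(ρ₁)`, which is the formula
to be proved. -/

noncomputable section

namespace AxisymMultipole

/-! ### Taylor series along a complex direction -/

section DirectionalTaylor

open PowerSeries

variable {E : Type*} [NormedAddCommGroup E] [NormedSpace ℝ E] {v₁ v₂ : E} {F G : E → ℂ} {x : E}

/-- The derivative of `F` along the complex direction `v₁ + i v₂`. -/
def cderiv (v₁ v₂ : E) (F : E → ℂ) (x : E) : ℂ := fderiv ℝ F x v₁ + Complex.I * fderiv ℝ F x v₂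

lemma cderiv_congr (h : F =ᶠ[𝓝 x] G) : cderiv v₁ v₂ F =ᶠ[𝓝 x] cderiv v₁ v₂ G := by
  filter_upwards [h.fderiv (𝕜 := ℝ)] with y hy
  simp [cderiv, hy]

lemma cderiv_add (hF : DifferentiableAt ℝ F x) (hG : DifferentiableAt ℝ G x) :
    cderiv v₁ v₂ (fun y => F y + G y) x = cderiv v₁ v₂ F x + cderiv v₁ v₂ G x := by
  simp only [cderiv, fderiv_fun_add hF hG, add_apply]; ring

lemma cderiv_sub (hF : DifferentiableAt ℝ F x) (hG : DifferentiableAt ℝ G x) :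
    cderiv v₁ v₂ (fun y => F y - G y) x = cderiv v₁ v₂ F x - cderiv v₁ v₂ G x := by
  simp only [cderiv, fderiv_fun_sub hF hG, sub_apply]; ring

lemma cderiv_mul (hF : DifferentiableAt ℝ F x) (hG : DifferentiableAt ℝ G x) :
    cderiv v₁ v₂ (fun y => F y * G y) x = F x * cderiv v₁ v₂ G x + cderiv v₁ v₂ F x * G x := by
  simp only [cderiv, fderiv_fun_mul hF hG, add_apply,
    smul_apply, smul_eq_mul]; ring

@[simp] lemma cderiv_const (c : ℂ) : cderiv v₁ v₂ (fun _ => c) x = 0 := by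
  simp [cderiv]

lemma cderiv_comp {f : ℂ → ℂ} {f' : ℂ} (hf : HasDerivAt f f' (F x)) (hF : DifferentiableAt ℝ F x) :
    cderiv v₁ v₂ (fun y => f (F y)) x = f' * cderiv v₁ v₂ F x := by
  have h : HasFDerivAt (fun y => f (F y)) _ x :=
    (hf.hasFDerivAt.restrictScalars ℝ).comp x hF.hasFDerivAt
  simp only [cderiv, h.fderiv, ContinuousLinearMap.comp_apply]
  simp; ring

lemma cderiv_exp (hF : DifferentiableAt ℝ F x) :
    cderiv v₁ v₂ (fun y => Complex.exp (F y)) x = Complex.exp (F x) * cderiv v₁ v₂ F x :=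
  cderiv_comp (Complex.hasDerivAt_exp _) hF

lemma cderiv_inv (hF : DifferentiableAt ℝ F x) (h0 : F x ≠ 0) :
    cderiv v₁ v₂ (fun y => (F y)⁻¹) x = -(F x ^ 2)⁻¹ * cderiv v₁ v₂ F x :=
  cderiv_comp (hasDerivAt_inv h0) hF

lemma analyticAt_cderiv (hF : AnalyticAt ℝ F x) : AnalyticAt ℝ (cderiv v₁ v₂ F) x := by
  have h (v : E) : AnalyticAt ℝ (fun y => fderiv ℝ F y v) x :=
    ((ContinuousLinearMap.apply ℝ ℂ v).analyticAt _).comp hF.fderiv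
  exact (h v₁).add (analyticAt_const.mul (h v₂))

lemma cderiv_comp_linear {E' : Type*} [NormedAddCommGroup E'] [NormedSpace ℝ E'] (l : E' →L[ℝ] E)
    (u₁ u₂ : E') (y : E') (hF : DifferentiableAt ℝ F (l y)) :
    cderiv u₁ u₂ (fun z => F (l z)) y = cderiv (l u₁) (l u₂) F (l y) := by
  have h : HasFDerivAt (fun z => F (l z)) _ y := hF.hasFDerivAt.comp y l.hasFDerivAt
  simp [cderiv, h.fderiv]

/-- The Taylor series at the origin along the complex direction `v₁ + i v₂`. -/
def taylor (v₁ v₂ : E) (F : E → ℂ) : ℂ⟦X⟧ :=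
  PowerSeries.mk fun n => (cderiv v₁ v₂)^[n] F 0 / (n ! : ℂ)

lemma coeff_taylor (n : ℕ) :
    coeff n (taylor v₁ v₂ F) = (cderiv v₁ v₂)^[n] F 0 / (n ! : ℂ) := by
  simp [taylor]

@[simp] lemma constantCoeff_taylor : constantCoeff (taylor v₁ v₂ F) = F 0 := by
  rw [← coeff_zero_eq_constantCoeff_apply, coeff_taylor]; simp

lemma taylor_congr (h : F =ᶠ[𝓝 0] G) : taylor v₁ v₂ F = taylor v₁ v₂ G := by
  have h (n : ℕ) : (cderiv v₁ v₂)^[n] F =ᶠ[𝓝 0] (cderiv v₁ v₂)^[n] G := by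
    induction n with
    | zero => exact h
    | succ n ih =>
      rw [Function.iterate_succ_apply', Function.iterate_succ_apply']
      exact cderiv_congr ih
  ext n
  rw [coeff_taylor, coeff_taylor, (h n).eq_of_nhds]

lemma taylor_cderiv : taylor v₁ v₂ (cderiv v₁ v₂ F) = d⁄dX ℂ (taylor v₁ v₂ F) := by
  ext n
  rw [coeff_derivative, coeff_taylor, coeff_taylor, Function.iterate_succ_apply]
  have : (n ! : ℂ) ≠ 0 := by exact_mod_cast n.factorial_ne_zero
  have : (n : ℂ) + 1 ≠ 0 := by exact_mod_cast n.succ_ne_zero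
  rw [Nat.factorial_succ]
  push_cast
  field_simp

/-- This recursion drives the algebraic rules below. Coefficient `n + 1` is read from coefficient
`n` of the derivative, so each rule follows by induction on the coefficient, for all analytic
functions at once. -/
lemma coeff_succ_taylor (n : ℕ) : coeff (n + 1) (taylor v₁ v₂ F) =
    coeff n (taylor v₁ v₂ (cderiv v₁ v₂ F)) / (n + 1) := by
  have : (n : ℂ) + 1 ≠ 0 := by exact_mod_cast n.succ_ne_zero
  rw [taylor_cderiv, coeff_derivative]
  field_simp

lemma taylor_const (c : ℂ) : taylor v₁ v₂ (fun _ => c) = C c := by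
  apply derivative.ext
  · rw [← taylor_cderiv]
    ext n
    rw [derivative_C, coeff_taylor]
    have h : (cderiv v₁ v₂ fun _ => c) = fun _ => (0 : ℂ) := by funext; simp
    have h0 : (cderiv v₁ v₂ fun _ => (0 : ℂ)) = fun _ => (0 : ℂ) := by funext; simp
    rw [h, Function.iterate_fixed h0]
    simp
  · simp

lemma taylor_add (hF : AnalyticAt ℝ F 0) (hG : AnalyticAt ℝ G 0) :
    taylor v₁ v₂ (fun x => F x + G x) = taylor v₁ v₂ F + taylor v₁ v₂ G := by
  ext n
  induction n generalizing F G with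
  | zero => simp
  | succ n ih =>
    have h : cderiv v₁ v₂ (fun x => F x + G x) =ᶠ[𝓝 0]
        fun x => cderiv v₁ v₂ F x + cderiv v₁ v₂ G x := by
      filter_upwards [hF.eventually_analyticAt, hG.eventually_analyticAt] with x h1 h2
      exact cderiv_add h1.differentiableAt h2.differentiableAt
    rw [map_add, coeff_succ_taylor, coeff_succ_taylor, coeff_succ_taylor, taylor_congr h,
      ih (analyticAt_cderiv hF) (analyticAt_cderiv hG), map_add]
    ring

lemma taylor_mul (hF : AnalyticAt ℝ F 0) (hG : AnalyticAt ℝ G 0) :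
    taylor v₁ v₂ (fun x => F x * G x) = taylor v₁ v₂ F * taylor v₁ v₂ G := by
  ext n
  induction n generalizing F G with
  | zero => simp
  | succ n ih =>
    have h : cderiv v₁ v₂ (fun x => F x * G x) =ᶠ[𝓝 0]
        fun x => F x * cderiv v₁ v₂ G x + cderiv v₁ v₂ F x * G x := by
      filter_upwards [hF.eventually_analyticAt, hG.eventually_analyticAt] with x h1 h2
      exact cderiv_mul h1.differentiableAt h2.differentiableAt
    have hF' := analyticAt_cderiv (v₁ := v₁) (v₂ := v₂) hF
    have hG' := analyticAt_cderiv (v₁ := v₁) (v₂ := v₂) hG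
    have hn : (n : ℂ) + 1 ≠ 0 := by exact_mod_cast n.succ_ne_zero
    rw [coeff_succ_taylor, taylor_congr h, taylor_add (hF.fun_mul hG') (hF'.fun_mul hG), map_add,
      ih hF hG', ih hF' hG, taylor_cderiv, taylor_cderiv, ← map_add, div_eq_iff hn,
      ← coeff_derivative, Derivation.leibniz]
    simp only [smul_eq_mul]
    congr 1
    ring

lemma taylor_neg (hF : AnalyticAt ℝ F 0) :
    taylor v₁ v₂ (fun x => -F x) = -taylor v₁ v₂ F := by
  have h := taylor_mul (v₁ := v₁) (v₂ := v₂) (analyticAt_const (v := (-1 : ℂ))) hF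
  simpa [taylor_const] using h

lemma taylor_sub (hF : AnalyticAt ℝ F 0) (hG : AnalyticAt ℝ G 0) :
    taylor v₁ v₂ (fun x => F x - G x) = taylor v₁ v₂ F - taylor v₁ v₂ G := by
  simp only [sub_eq_add_neg]
  rw [taylor_add hF hG.fun_neg, taylor_neg hG]

lemma taylor_pow (hF : AnalyticAt ℝ F 0) (n : ℕ) :
    taylor v₁ v₂ (fun x => F x ^ n) = taylor v₁ v₂ F ^ n := by
  induction n with
  | zero => simp [taylor_const]
  | succ n ih => simp only [pow_succ]; rw [taylor_mul (hF.fun_pow n) hF, ih]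

lemma taylor_exp_derivative (hF : AnalyticAt ℝ F 0) :
    d⁄dX ℂ (taylor v₁ v₂ (fun x => Complex.exp (F x))) =
      taylor v₁ v₂ (fun x => Complex.exp (F x)) * d⁄dX ℂ (taylor v₁ v₂ F) := by
  have h : cderiv v₁ v₂ (fun x => Complex.exp (F x)) =ᶠ[𝓝 0]
      fun x => Complex.exp (F x) * cderiv v₁ v₂ F x := by
    filter_upwards [hF.eventually_analyticAt] with x h1
    exact cderiv_exp h1.differentiableAt
  have he : AnalyticAt ℝ (fun x => Complex.exp (F x)) 0 :=
    (analyticAt_cexp.restrictScalars (𝕜 := ℝ)).comp hF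
  rw [← taylor_cderiv, taylor_congr h, taylor_mul he (analyticAt_cderiv hF), taylor_cderiv]

end DirectionalTaylor


/-! ### Partial derivatives -/

section PartialDerivatives

variable {x : Pt} {i : Fin 3}

lemma pd_congr {E : Type*} [NormedAddCommGroup E] [NormedSpace ℝ E] {F G : Pt → E}
    (h : F =ᶠ[𝓝 x] G) : pd i F =ᶠ[𝓝 x] pd i G := by
  filter_upwards [h.fderiv (𝕜 := ℝ)] with y hy
  simp [pd, hy]

lemma pd_ofReal {u : Pt → ℝ} (hu : DifferentiableAt ℝ u x) :
    pd i (fun y => (u y : ℂ)) x = pd i u x := by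
  have h : HasFDerivAt (fun y => (u y : ℂ)) _ x :=
    (Complex.ofRealCLM.hasFDerivAt (x := u x)).comp x hu.hasFDerivAt
  simp [pd, h.fderiv]

lemma pd_add {E : Type*} [NormedAddCommGroup E] [NormedSpace ℝ E] {F G : Pt → E}
    (hF : DifferentiableAt ℝ F x) (hG : DifferentiableAt ℝ G x) :
    pd i (fun y => F y + G y) x = pd i F x + pd i G x := by
  simp [pd, fderiv_fun_add hF hG]

lemma pd_sub {E : Type*} [NormedAddCommGroup E] [NormedSpace ℝ E] {F G : Pt → E}
    (hF : DifferentiableAt ℝ F x) (hG : DifferentiableAt ℝ G x) :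
    pd i (fun y => F y - G y) x = pd i F x - pd i G x := by
  simp [pd, fderiv_fun_sub hF hG]

lemma pd_mul {𝔸 : Type*} [NormedCommRing 𝔸] [NormedAlgebra ℝ 𝔸] {F G : Pt → 𝔸}
    (hF : DifferentiableAt ℝ F x) (hG : DifferentiableAt ℝ G x) :
    pd i (fun y => F y * G y) x = F x * pd i G x + pd i F x * G x := by
  simp [pd, fderiv_fun_mul hF hG]; ring

@[simp] lemma pd_const {E : Type*} [NormedAddCommGroup E] [NormedSpace ℝ E] (c : E) :
    pd i (fun _ => c) x = 0 := by
  simp [pd]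

lemma pd_sum {E : Type*} [NormedAddCommGroup E] [NormedSpace ℝ E] {ι : Type*} {s : Finset ι}
    {F : ι → Pt → E} (hF : ∀ k ∈ s, DifferentiableAt ℝ (F k) x) :
    pd i (fun y => ∑ k ∈ s, F k y) x = ∑ k ∈ s, pd i (F k) x := by
  simp [pd, fderiv_fun_sum hF]

@[simp] lemma pd_coord (j : Fin 3) : pd i (fun y => y j) x = if j = i then 1 else 0 := by
  have h : HasFDerivAt (fun y : Pt => y j) (ContinuousLinearMap.proj j : Pt →L[ℝ] ℝ) x :=
    (ContinuousLinearMap.proj j : Pt →L[ℝ] ℝ).hasFDerivAt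
  simp [pd, h.fderiv, Pi.single_apply]

lemma pd_exp {u : Pt → ℝ} (hu : DifferentiableAt ℝ u x) :
    pd i (fun y => Real.exp (u y)) x = Real.exp (u x) * pd i u x := by
  simp [pd, fderiv_exp hu]

lemma analyticAt_pd {E : Type*} [NormedAddCommGroup E] [NormedSpace ℝ E] [CompleteSpace E]
    {F : Pt → E} (hF : AnalyticAt ℝ F x) : AnalyticAt ℝ (pd i F) x :=
  ((ContinuousLinearMap.apply ℝ E (Pi.single i 1 : Pt)).analyticAt _).comp hF.fderiv

end PartialDerivatives

/-! ### Curvature of an axisymmetric metric along a null direction -/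

section Curvature

lemma fin_three_cases (i : Fin 3) : i = 0 ∨ i = 1 ∨ i = 2 := by
  fin_cases i <;> simp

/-- The metric `e^{2σ} (δ + B a ⊗ a)` with `a = ρ̃² dφ`. -/
def conformalMetric (σ B : Pt → ℝ) : MetricField := fun x =>
  Real.exp (2 * σ x) • (1 + B x • Matrix.vecMulVec (azimuthForm x) (azimuthForm x))

lemma conformalMetric_apply (σ B : Pt → ℝ) (x : Pt) (i j : Fin 3) : conformalMetric σ B x i j =
    Real.exp (2 * σ x) *
      ((1 : Matrix (Fin 3) (Fin 3) ℝ) i j + B x * (azimuthForm x i * azimuthForm x j)) := by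
  simp [conformalMetric, Matrix.vecMulVec_apply]

/-- `D = 1 + B ρ̃²`. -/
def azimuthFactor (B : Pt → ℝ) (x : Pt) : ℝ := 1 + B x * (x 0 ^ 2 + x 1 ^ 2)

/-- The components of the inverse of `δ + B a ⊗ a`. -/
def coMetric (B : Pt → ℝ) (x : Pt) (i j : Fin 3) : ℝ :=
  (1 : Matrix (Fin 3) (Fin 3) ℝ) i j -
    B x / azimuthFactor B x * (azimuthForm x i * azimuthForm x j)

/-- Inverse of a rank-one perturbation of the identity; `azimuthFactor` is `1 + B |a|²` because
`|a|² = ρ̃²`. -/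
lemma conformalMetric_inv {σ B : Pt → ℝ} {x : Pt} (hD : azimuthFactor B x ≠ 0) (i j : Fin 3) :
    (conformalMetric σ B x)⁻¹ i j = (Real.exp (2 * σ x))⁻¹ * coMetric B x i j := by
  have h : conformalMetric σ B x *
      Matrix.of (fun i j => (Real.exp (2 * σ x))⁻¹ * coMetric B x i j) = 1 := by
    have he := Real.exp_ne_zero (2 * σ x)
    ext i j
    simp only [Matrix.mul_apply, conformalMetric_apply, Matrix.of_apply, Fin.sum_univ_three,
      coMetric]
    have : 1 + B x * (x 0 ^ 2 + x 1 ^ 2) ≠ 0 := hD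
    simp only [azimuthFactor]
    obtain rfl | rfl | rfl := fin_three_cases i <;> obtain rfl | rfl | rfl := fin_three_cases j <;>
      simp [azimuthForm] <;> field_simp <;> ring
  rw [Matrix.inv_eq_right_inv h, Matrix.of_apply]

/-- The partial derivative `∂_l a_i` of the azimuth form. -/
def azimuthDeriv (l i : Fin 3) : ℝ := !![0, 1, 0; -1, 0, 0; 0, 0, 0] l i

lemma differentiableAt_azimuthForm (i : Fin 3) (x : Pt) :
    DifferentiableAt ℝ (fun y => azimuthForm y i) x := by
  fin_cases i <;> simp [azimuthForm] <;> fun_prop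

lemma analyticAt_coord (i : Fin 3) (x : Pt) : AnalyticAt ℝ (fun y : Pt => y i) x :=
  (ContinuousLinearMap.proj i : Pt →L[ℝ] ℝ).analyticAt x

lemma analyticAt_azimuthForm (i : Fin 3) (x : Pt) :
    AnalyticAt ℝ (fun y => azimuthForm y i) x := by
  fin_cases i
  · exact (analyticAt_coord 1 x).neg
  · exact analyticAt_coord 0 x
  · exact analyticAt_const

lemma pd_azimuthForm (l i : Fin 3) (x : Pt) :
    pd l (fun y => azimuthForm y i) x = azimuthDeriv l i := by
  have h : pd l (fun y : Pt => -y 1) x = if (1 : Fin 3) = l then -1 else 0 := by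
    have := pd_mul (x := x) (i := l) (differentiableAt_const (-1 : ℝ))
      (analyticAt_coord 1 x).differentiableAt
    simpa using this
  obtain rfl | rfl | rfl := fin_three_cases l <;> obtain rfl | rfl | rfl := fin_three_cases i <;>
    simp [azimuthForm, azimuthDeriv, h]

variable {σ B β : Pt → ℝ} {x p : Pt}

lemma pd_conformalMetric (hσ : DifferentiableAt ℝ σ x) (hB : DifferentiableAt ℝ B x)
    (l i j : Fin 3) : pd l (fun y => conformalMetric σ B y i j) x = Real.exp (2 * σ x) *
      (2 * pd l σ x * ((1 : Matrix (Fin 3) (Fin 3) ℝ) i j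
          + B x * (azimuthForm x i * azimuthForm x j))
        + pd l B x * (azimuthForm x i * azimuthForm x j)
        + B x * (azimuthDeriv l i * azimuthForm x j + azimuthForm x i * azimuthDeriv l j)) := by
  have ha := differentiableAt_azimuthForm i x
  have ha' := differentiableAt_azimuthForm j x
  have haa : DifferentiableAt ℝ (fun y => azimuthForm y i * azimuthForm y j) x := ha.fun_mul ha'
  have hBaa := hB.fun_mul haa
  have h2 : DifferentiableAt ℝ (fun y => 2 * σ y) x := hσ.const_mul 2
  have he : DifferentiableAt ℝ (fun y => Real.exp (2 * σ y)) x := h2.exp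
  simp only [conformalMetric_apply]
  rw [pd_mul he ((differentiableAt_const _).fun_add hBaa), pd_exp h2,
    pd_add (differentiableAt_const _) hBaa, pd_mul hB haa, pd_mul ha ha', pd_azimuthForm,
    pd_azimuthForm, pd_mul (differentiableAt_const _) hσ]
  simp only [pd_const]
  ring

/-- The terms in `∂σ` are those of a conformal change. The term `2 B (…)` has this short form
because `∂_l a_i` is antisymmetric, so that `∂_i a_j + ∂_j a_i` drops out and the differences `∂_i
a_l - ∂_l a_i` double. -/
lemma christoffel_conformalMetric (hσ : DifferentiableAt ℝ σ x) (hB : DifferentiableAt ℝ B x)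
    (hD : azimuthFactor B x ≠ 0) (k i j : Fin 3) :
    christoffel (conformalMetric σ B) k i j x =
      (1 : Matrix (Fin 3) (Fin 3) ℝ) k i * pd j σ x + (1 : Matrix (Fin 3) (Fin 3) ℝ) k j * pd i σ x
      - ((1 : Matrix (Fin 3) (Fin 3) ℝ) i j + B x * (azimuthForm x i * azimuthForm x j)) *
          ∑ l, coMetric B x k l * pd l σ x
      + 1 / 2 * ∑ l, coMetric B x k l * (pd i B x * (azimuthForm x j * azimuthForm x l)
          + pd j B x * (azimuthForm x i * azimuthForm x l)
          - pd l B x * (azimuthForm x i * azimuthForm x j)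
          + 2 * B x * (azimuthForm x j * azimuthDeriv i l + azimuthForm x i * azimuthDeriv j l)) := by
  have he := Real.exp_ne_zero (2 * σ x)
  have hD' : 1 + B x * (x 0 ^ 2 + x 1 ^ 2) ≠ 0 := hD
  simp only [christoffel, pd_conformalMetric hσ hB, conformalMetric_inv hD, Fin.sum_univ_three,
    coMetric]
  generalize Real.exp (2 * σ x) = e at *
  simp only [azimuthFactor]
  obtain rfl | rfl | rfl := fin_three_cases k <;> obtain rfl | rfl | rfl := fin_three_cases i <;>
    obtain rfl | rfl | rfl := fin_three_cases j <;>
    simp [azimuthForm, azimuthDeriv] <;> field_simp <;> ring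

end Curvature


/-! ### Christoffel symbols and Ricci tensor contracted twice with the null vector -/

section NullRicci

variable {σ B β : Pt → ℝ} {x p : Pt}

lemma analyticAt_azimuthFactor (hB : AnalyticAt ℝ B p) : AnalyticAt ℝ (azimuthFactor B) p :=
  analyticAt_const.add (hB.mul (((analyticAt_coord 0 p).pow 2).add ((analyticAt_coord 1 p).pow 2)))

lemma analyticAt_coMetric (hB : AnalyticAt ℝ B p) (hD : azimuthFactor B p ≠ 0) (i j : Fin 3) :
    AnalyticAt ℝ (fun x => coMetric B x i j) p :=
  analyticAt_const.sub ((hB.div (analyticAt_azimuthFactor hB) hD).mul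
    ((analyticAt_azimuthForm i p).mul (analyticAt_azimuthForm j p)))

lemma eventually_azimuthFactor_ne_zero (hB : AnalyticAt ℝ B p) (hD : azimuthFactor B p ≠ 0) :
    ∀ᶠ x in 𝓝 p, azimuthFactor B x ≠ 0 :=
  (analyticAt_azimuthFactor hB).continuousAt.eventually_ne hD

lemma eventually_christoffel_conformalMetric (hσ : AnalyticAt ℝ σ p) (hB : AnalyticAt ℝ B p)
    (hD : azimuthFactor B p ≠ 0) : ∀ᶠ x in 𝓝 p, ∀ k i j : Fin 3,
    christoffel (conformalMetric σ B) k i j x =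
      (1 : Matrix (Fin 3) (Fin 3) ℝ) k i * pd j σ x + (1 : Matrix (Fin 3) (Fin 3) ℝ) k j * pd i σ x
      - ((1 : Matrix (Fin 3) (Fin 3) ℝ) i j + B x * (azimuthForm x i * azimuthForm x j)) *
          ∑ l, coMetric B x k l * pd l σ x
      + 1 / 2 * ∑ l, coMetric B x k l * (pd i B x * (azimuthForm x j * azimuthForm x l)
          + pd j B x * (azimuthForm x i * azimuthForm x l)
          - pd l B x * (azimuthForm x i * azimuthForm x j)
          + 2 * B x * (azimuthForm x j * azimuthDeriv i l + azimuthForm x i * azimuthDeriv j l)) := by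
  filter_upwards [hσ.eventually_analyticAt, hB.eventually_analyticAt,
    eventually_azimuthFactor_ne_zero hB hD] with x h1 h2 h3 k i j
  exact christoffel_conformalMetric h1.differentiableAt h2.differentiableAt h3 k i j

lemma analyticAt_christoffel_conformalMetric (hσ : AnalyticAt ℝ σ p) (hB : AnalyticAt ℝ B p)
    (hD : azimuthFactor B p ≠ 0) (k i j : Fin 3) :
    AnalyticAt ℝ (christoffel (conformalMetric σ B) k i j) p := by
  have hg := analyticAt_coMetric hB hD
  have ha := fun i => analyticAt_azimuthForm i p
  have hσ' := fun i => analyticAt_pd (i := i) hσ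
  have hB' := fun i => analyticAt_pd (i := i) hB
  refine AnalyticAt.congr ?_ ((eventually_christoffel_conformalMetric hσ hB hD).mono
    fun x h => (h k i j).symm)
  simp only [Fin.sum_univ_three]
  fun_prop

/-- Since `η = (-i, 0, 1)`, this and `christoffel_null_im` give the real part and minus the
imaginary part of `Γ^k_{ij} η^i η^j`. The remainder vanishes on the plane `ỹ = 0` but is kept with
its factor `x 1`: the Ricci tensor differentiates across the plane, and there the derivative of `x 1
* W` is `W`. -/
lemma christoffel_null_re (hσ : AnalyticAt ℝ σ p) (hB : AnalyticAt ℝ B p)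
    (hD : azimuthFactor B p ≠ 0) : ∀ᶠ x in 𝓝 p, ∀ k : Fin 3,
    christoffel (conformalMetric σ B) k 2 2 x - christoffel (conformalMetric σ B) k 0 0 x =
      2 * ((1 : Matrix (Fin 3) (Fin 3) ℝ) k 2 * pd 2 σ x
        - (1 : Matrix (Fin 3) (Fin 3) ℝ) k 0 * pd 0 σ x)
      + x 1 * (x 1 * B x * ∑ l, coMetric B x k l * pd l σ x
        + 1 / 2 * ∑ l, coMetric B x k l * (2 * pd 0 B x * azimuthForm x l + x 1 * pd l B x
          + 4 * B x * (1 : Matrix (Fin 3) (Fin 3) ℝ) l 1)) := by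
  filter_upwards [eventually_christoffel_conformalMetric hσ hB hD] with x h k
  rw [h, h]
  simp only [Fin.sum_univ_three]
  obtain rfl | rfl | rfl := fin_three_cases k <;>
    simp [azimuthForm, azimuthDeriv] <;> ring

lemma christoffel_null_im (hσ : AnalyticAt ℝ σ p) (hB : AnalyticAt ℝ B p)
    (hD : azimuthFactor B p ≠ 0) : ∀ᶠ x in 𝓝 p, ∀ k : Fin 3,
    christoffel (conformalMetric σ B) k 0 2 x + christoffel (conformalMetric σ B) k 2 0 x =
      2 * ((1 : Matrix (Fin 3) (Fin 3) ℝ) k 2 * pd 0 σ x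
        + (1 : Matrix (Fin 3) (Fin 3) ℝ) k 0 * pd 2 σ x)
      + x 1 * (-∑ l, coMetric B x k l * (pd 2 B x * azimuthForm x l)) := by
  filter_upwards [eventually_christoffel_conformalMetric hσ hB hD] with x h k
  rw [h, h]
  simp only [Fin.sum_univ_three]
  obtain rfl | rfl | rfl := fin_three_cases k <;>
    simp [azimuthForm, azimuthDeriv] <;> ring

lemma pd_azimuthFactor (hB : DifferentiableAt ℝ B x) (i : Fin 3) : pd i (azimuthFactor B) x =
    pd i B x * (x 0 ^ 2 + x 1 ^ 2) +
      B x * (2 * x 0 * (if 0 = i then 1 else 0) + 2 * x 1 * (if 1 = i then 1 else 0)) := by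
  have h0 := (analyticAt_coord 0 x).differentiableAt
  have h1 := (analyticAt_coord 1 x).differentiableAt
  have h00 := h0.fun_mul h0
  have h11 := h1.fun_mul h1
  have e : azimuthFactor B = fun y => 1 + B y * (y 0 * y 0 + y 1 * y 1) := by
    funext y; simp only [azimuthFactor]; ring
  rw [e, pd_add (differentiableAt_const _) (hB.fun_mul (h00.fun_add h11)),
    pd_mul hB (h00.fun_add h11), pd_add h00 h11, pd_mul h0 h0, pd_mul h1 h1]
  simp only [pd_const, pd_coord]
  ring

lemma pd_azimuthFactor_eq (hB : DifferentiableAt ℝ B x) (hβ : DifferentiableAt ℝ β x)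
    (hD : ∀ᶠ y in 𝓝 x, azimuthFactor B y = Real.exp (-2 * β y)) (i : Fin 3) :
    pd i B x * (x 0 ^ 2 + x 1 ^ 2) +
      B x * (2 * x 0 * (if 0 = i then 1 else 0) + 2 * x 1 * (if 1 = i then 1 else 0)) =
      -2 * pd i β x * azimuthFactor B x := by
  rw [← pd_azimuthFactor hB, (pd_congr (i := i) hD).eq_of_nhds, hD.self_of_nhds,
    pd_exp (hβ.const_mul _), pd_mul (differentiableAt_const _) hβ, pd_const]
  ring

/-- `Γ^k_{ik}` is the logarithmic derivative of the volume density, which is `e^{3σ} √(1 + B ρ̃²) =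
e^{3σ - β}`. Second derivatives of the metric function enter the null Ricci component only through
this trace and the conformal exponent, so stating it with `β` avoids second derivatives of `B`. -/
lemma christoffel_trace (hσ : AnalyticAt ℝ σ p) (hB : AnalyticAt ℝ B p) (hβ : AnalyticAt ℝ β p)
    (hD : ∀ᶠ x in 𝓝 p, azimuthFactor B x = Real.exp (-2 * β x)) : ∀ᶠ x in 𝓝 p, ∀ i : Fin 3,
    ∑ k, christoffel (conformalMetric σ B) k i k x = 3 * pd i σ x - pd i β x := by
  have hD0 : azimuthFactor B p ≠ 0 := by rw [hD.self_of_nhds]; positivity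
  filter_upwards [eventually_christoffel_conformalMetric hσ hB hD0, hB.eventually_analyticAt,
    hβ.eventually_analyticAt, hD.eventually_nhds,
    eventually_azimuthFactor_ne_zero hB hD0] with x h h1 h2 h3 h4 i
  have h5 := pd_azimuthFactor_eq h1.differentiableAt h2.differentiableAt h3 i
  have h6 : pd i β x = -(pd i B x * (x 0 ^ 2 + x 1 ^ 2) +
      B x * (2 * x 0 * (if 0 = i then 1 else 0) + 2 * x 1 * (if 1 = i then 1 else 0))) /
      (2 * azimuthFactor B x) := by
    rw [h5]; field_simp
  rw [h6]
  simp only [h, Fin.sum_univ_three, coMetric]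
  have h7 : 1 + B x * (x 0 ^ 2 + x 1 ^ 2) ≠ 0 := h4
  simp only [azimuthFactor]
  obtain rfl | rfl | rfl := fin_three_cases i <;>
    simp [azimuthForm, azimuthDeriv] <;> field_simp <;> ring

lemma pd_christoffel_null_re (hσ : AnalyticAt ℝ σ p) (hB : AnalyticAt ℝ B p)
    (hD : azimuthFactor B p ≠ 0) (hp : p 1 = 0) (k : Fin 3) :
    pd k (christoffel (conformalMetric σ B) k 2 2) p -
      pd k (christoffel (conformalMetric σ B) k 0 0) p =
      2 * ((1 : Matrix (Fin 3) (Fin 3) ℝ) k 2 * pd k (pd 2 σ) p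
        - (1 : Matrix (Fin 3) (Fin 3) ℝ) k 0 * pd k (pd 0 σ) p)
      + if 1 = k then (pd 0 B p * p 0 + 2 * B p) / azimuthFactor B p else 0 := by
  have hg := analyticAt_coMetric hB hD
  have ha := fun i => analyticAt_azimuthForm i p
  have hσ' := fun i => analyticAt_pd (i := i) hσ
  have hB' := fun i => analyticAt_pd (i := i) hB
  have hΓ := fun i j => (analyticAt_christoffel_conformalMetric hσ hB hD k i j).differentiableAt
  have h1 := (analyticAt_coord 1 p)
  have hd : DifferentiableAt ℝ (fun x => 2 * ((1 : Matrix (Fin 3) (Fin 3) ℝ) k 2 * pd 2 σ x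
        - (1 : Matrix (Fin 3) (Fin 3) ℝ) k 0 * pd 0 σ x)) p := by
    apply AnalyticAt.differentiableAt; fun_prop
  have hW : DifferentiableAt ℝ (fun x => (x 1 * B x * ∑ l, coMetric B x k l * pd l σ x
        + 1 / 2 * ∑ l, coMetric B x k l * (2 * pd 0 B x * azimuthForm x l + x 1 * pd l B x
          + 4 * B x * (1 : Matrix (Fin 3) (Fin 3) ℝ) l 1))) p := by
    have hl (l : Fin 3) : AnalyticAt ℝ (fun x => 2 * pd 0 B x * azimuthForm x l + x 1 * pd l B x
        + 4 * B x * (1 : Matrix (Fin 3) (Fin 3) ℝ) l 1) p :=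
      (AnalyticAt.add (by fun_prop) (h1.mul (hB' l))).add (by fun_prop)
    apply AnalyticAt.differentiableAt
    refine ((h1.mul hB).mul ?_).add ?_ <;> simp only [Fin.sum_univ_three] <;> fun_prop
  rw [← pd_sub (hΓ _ _) (hΓ _ _),
    (pd_congr (i := k) ((christoffel_null_re hσ hB hD).mono fun x h => h k)).eq_of_nhds,
    pd_add hd (h1.differentiableAt.fun_mul hW), pd_mul h1.differentiableAt hW,
    pd_mul (differentiableAt_const _) (by apply AnalyticAt.differentiableAt; fun_prop),
    pd_sub (by apply AnalyticAt.differentiableAt; fun_prop)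
      (by apply AnalyticAt.differentiableAt; fun_prop),
    pd_mul (differentiableAt_const _) (hσ' _).differentiableAt,
    pd_mul (differentiableAt_const _) (hσ' _).differentiableAt]
  simp only [pd_const, pd_coord, hp, Fin.sum_univ_three, coMetric]
  have h7 : 1 + B p * (p 0 ^ 2 + p 1 ^ 2) ≠ 0 := hD
  simp only [azimuthFactor]
  obtain rfl | rfl | rfl := fin_three_cases k <;> simp [azimuthForm, hp] at h7 ⊢
  field_simp
  ring

lemma pd_christoffel_null_im (hσ : AnalyticAt ℝ σ p) (hB : AnalyticAt ℝ B p)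
    (hD : azimuthFactor B p ≠ 0) (hp : p 1 = 0) (k : Fin 3) :
    pd k (christoffel (conformalMetric σ B) k 0 2) p +
      pd k (christoffel (conformalMetric σ B) k 2 0) p =
      2 * ((1 : Matrix (Fin 3) (Fin 3) ℝ) k 2 * pd k (pd 0 σ) p
        + (1 : Matrix (Fin 3) (Fin 3) ℝ) k 0 * pd k (pd 2 σ) p)
      + if 1 = k then -(pd 2 B p * p 0) / azimuthFactor B p else 0 := by
  have hg := analyticAt_coMetric hB hD
  have ha := fun i => analyticAt_azimuthForm i p
  have hσ' := fun i => analyticAt_pd (i := i) hσ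
  have hB' := fun i => analyticAt_pd (i := i) hB
  have hΓ := fun i j => (analyticAt_christoffel_conformalMetric hσ hB hD k i j).differentiableAt
  have h1 := (analyticAt_coord 1 p)
  have hd : DifferentiableAt ℝ (fun x => 2 * ((1 : Matrix (Fin 3) (Fin 3) ℝ) k 2 * pd 0 σ x
        + (1 : Matrix (Fin 3) (Fin 3) ℝ) k 0 * pd 2 σ x)) p := by
    apply AnalyticAt.differentiableAt; fun_prop
  have hW : DifferentiableAt ℝ
      (fun x => (-∑ l, coMetric B x k l * (pd 2 B x * azimuthForm x l))) p := by
    apply AnalyticAt.differentiableAt; simp only [Fin.sum_univ_three]; fun_prop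
  rw [← pd_add (hΓ _ _) (hΓ _ _),
    (pd_congr (i := k) ((christoffel_null_im hσ hB hD).mono fun x h => h k)).eq_of_nhds,
    pd_add hd (h1.differentiableAt.fun_mul hW), pd_mul h1.differentiableAt hW,
    pd_mul (differentiableAt_const _) (by apply AnalyticAt.differentiableAt; fun_prop),
    pd_add (by apply AnalyticAt.differentiableAt; fun_prop)
      (by apply AnalyticAt.differentiableAt; fun_prop),
    pd_mul (differentiableAt_const _) (hσ' _).differentiableAt,
    pd_mul (differentiableAt_const _) (hσ' _).differentiableAt]
  simp only [pd_const, pd_coord, hp, Fin.sum_univ_three, coMetric]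
  have h7 : 1 + B p * (p 0 ^ 2 + p 1 ^ 2) ≠ 0 := hD
  simp only [azimuthFactor]
  obtain rfl | rfl | rfl := fin_three_cases k <;> simp [azimuthForm, hp] at h7 ⊢
  field_simp
  ring

lemma pd_christoffel_trace (hσ : AnalyticAt ℝ σ p) (hB : AnalyticAt ℝ B p) (hβ : AnalyticAt ℝ β p)
    (hD : ∀ᶠ x in 𝓝 p, azimuthFactor B x = Real.exp (-2 * β x)) (i j : Fin 3) :
    ∑ k, pd j (christoffel (conformalMetric σ B) k i k) p =
      3 * pd j (pd i σ) p - pd j (pd i β) p := by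
  have hD0 : azimuthFactor B p ≠ 0 := by rw [hD.self_of_nhds]; positivity
  have hσ' := (analyticAt_pd (i := i) hσ).differentiableAt
  have hβ' := (analyticAt_pd (i := i) hβ).differentiableAt
  rw [← pd_sum fun k _ => (analyticAt_christoffel_conformalMetric hσ hB hD0 k i k).differentiableAt,
    (pd_congr (i := j) ((christoffel_trace hσ hB hβ hD).mono fun x h => h i)).eq_of_nhds,
    pd_sub (hσ'.const_mul 3) hβ', pd_mul (differentiableAt_const _) hσ', pd_const]
  ring

lemma ricci_null_re (hσ : AnalyticAt ℝ σ p) (hB : AnalyticAt ℝ B p) (hβ : AnalyticAt ℝ β p)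
    (hD : ∀ᶠ x in 𝓝 p, azimuthFactor B x = Real.exp (-2 * β x)) (hp : p 1 = 0) (hp0 : p 0 ≠ 0) :
    ricci (conformalMetric σ B) 2 2 p - ricci (conformalMetric σ B) 0 0 p =
      (pd 2 (pd 2 β) p - pd 0 (pd 0 β) p) - (pd 2 β p ^ 2 - pd 0 β p ^ 2) - 2 * pd 0 β p / p 0
      - (pd 2 (pd 2 σ) p - pd 0 (pd 0 σ) p) + (pd 2 σ p ^ 2 - pd 0 σ p ^ 2) := by
  have hD0 : azimuthFactor B p ≠ 0 := by rw [hD.self_of_nhds]; positivity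
  have hT := pd_christoffel_trace hσ hB hβ hD
  have hV := fun k => sub_eq_iff_eq_add.1 (pd_christoffel_null_re hσ hB hD0 hp k)
  have hΓ := (eventually_christoffel_conformalMetric hσ hB hD0).self_of_nhds
  have hβ' := pd_azimuthFactor_eq hB.differentiableAt hβ.differentiableAt hD
  have hβ0 := hβ' 0
  have hβ2 := hβ' 2
  have h7 : 1 + B p * p 0 ^ 2 ≠ 0 := by simpa [azimuthFactor, hp] using hD0
  simp [azimuthFactor, hp] at hβ0 hβ2
  -- The differentiated relation `1 + B ρ̃² = e^{-2β}` eliminates `∂B` in favour of `∂β`; it is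
  -- solvable for `∂B` off the axis only.
  have e0 : pd 0 B p = (-(2 * pd 0 β p * (1 + B p * p 0 ^ 2)) - B p * (2 * p 0)) / p 0 ^ 2 := by
    rw [← hβ0]; field_simp; ring
  have e2 : pd 2 B p = (-(2 * pd 2 β p * (1 + B p * p 0 ^ 2))) / p 0 ^ 2 := by
    rw [← hβ2]; field_simp
  simp only [ricci, Finset.sum_sub_distrib, hT, hV, hΓ]
  simp only [Fin.sum_univ_three, coMetric]
  simp [azimuthForm, azimuthDeriv, azimuthFactor, hp, e0, e2]
  field_simp
  ring

lemma ricci_null_im (hσ : AnalyticAt ℝ σ p) (hB : AnalyticAt ℝ B p) (hβ : AnalyticAt ℝ β p)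
    (hD : ∀ᶠ x in 𝓝 p, azimuthFactor B x = Real.exp (-2 * β x)) (hp : p 1 = 0) (hp0 : p 0 ≠ 0) :
    ricci (conformalMetric σ B) 0 2 p + ricci (conformalMetric σ B) 2 0 p =
      (pd 2 (pd 0 β) p + pd 0 (pd 2 β) p) - 2 * pd 0 β p * pd 2 β p + 2 * pd 2 β p / p 0
      - (pd 2 (pd 0 σ) p + pd 0 (pd 2 σ) p) + 2 * pd 0 σ p * pd 2 σ p := by
  have hD0 : azimuthFactor B p ≠ 0 := by rw [hD.self_of_nhds]; positivity
  have hT := pd_christoffel_trace hσ hB hβ hD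
  have hV := fun k => eq_sub_of_add_eq (pd_christoffel_null_im hσ hB hD0 hp k)
  have hΓ := (eventually_christoffel_conformalMetric hσ hB hD0).self_of_nhds
  have hβ' := pd_azimuthFactor_eq hB.differentiableAt hβ.differentiableAt hD
  have hβ0 := hβ' 0
  have hβ2 := hβ' 2
  have h7 : 1 + B p * p 0 ^ 2 ≠ 0 := by simpa [azimuthFactor, hp] using hD0
  simp [azimuthFactor, hp] at hβ0 hβ2
  have e0 : pd 0 B p = (-(2 * pd 0 β p * (1 + B p * p 0 ^ 2)) - B p * (2 * p 0)) / p 0 ^ 2 := by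
    rw [← hβ0]; field_simp; ring
  have e2 : pd 2 B p = (-(2 * pd 2 β p * (1 + B p * p 0 ^ 2))) / p 0 ^ 2 := by
    rw [← hβ2]; field_simp
  simp only [ricci, Finset.sum_sub_distrib, hT, hV, hΓ]
  simp only [Fin.sum_univ_three, coMetric]
  simp [azimuthForm, azimuthDeriv, azimuthFactor, hp, e0, e2]
  field_simp
  ring

end NullRicci


/-! ### Contraction of tensors with a null vector -/

section Contraction

/-- The components of the null vector `∂_z̃ - i ∂_x̃`. -/
def nullVec : Fin 3 → ℂ := ![-Complex.I, 0, 1]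

/-- The derivative along the null vector `∂_z̃ - i ∂_x̃`. -/
abbrev nullDeriv : (Pt → ℂ) → Pt → ℂ := cderiv (Pi.single 2 1 : Pt) (-Pi.single 0 1)

lemma nullDeriv_eq (F : Pt → ℂ) (x : Pt) : nullDeriv F x = pd 2 F x - Complex.I * pd 0 F x := by
  simp [nullDeriv, cderiv, pd, sub_eq_add_neg]

lemma nullDeriv_ofReal {u : Pt → ℝ} {x : Pt} (hu : DifferentiableAt ℝ u x) :
    nullDeriv (fun y => (u y : ℂ)) x = pd 2 u x - Complex.I * pd 0 u x := by
  rw [nullDeriv_eq, pd_ofReal hu, pd_ofReal hu]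

lemma sum_nullVec_mul_pd (F : Pt → ℂ) (x : Pt) : ∑ i, nullVec i * pd i F x = nullDeriv F x := by
  rw [nullDeriv_eq, Fin.sum_univ_three]
  simp [nullVec]; ring

/-- The contraction `η^{a_1} ⋯ η^{a_n} T_{a_1 ⋯ a_n}`. -/
def contract (η : Fin 3 → ℂ) {n : ℕ} (T : Tensor n) : ℂ := ∑ a : Fin n → Fin 3, (∏ i, η (a i)) * T a

variable {η : Fin 3 → ℂ} {n : ℕ}

lemma contract_add (T S : Tensor n) : contract η (T + S) = contract η T + contract η S := by
  simp [contract, mul_add, Finset.sum_add_distrib]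

lemma contract_sub (T S : Tensor n) : contract η (T - S) = contract η T - contract η S := by
  simp [contract, mul_sub, Finset.sum_sub_distrib]

lemma contract_smul (c : ℂ) (T : Tensor n) : contract η (c • T) = c * contract η T := by
  simp only [contract, Pi.smul_apply, smul_eq_mul, Finset.mul_sum]
  exact Finset.sum_congr rfl fun _ _ => by ring

lemma sum_tensor_cons (f : (Fin (n + 1) → Fin 3) → ℂ) :
    ∑ a, f a = ∑ j, ∑ b : Fin n → Fin 3, f (Fin.cons j b) := by
  rw [← Fintype.sum_prod_type', ← (Fin.consEquiv fun _ : Fin (n + 1) => Fin 3).sum_comp]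
  rfl

lemma sum_tensor_insertNth (i : Fin (n + 1)) (f : (Fin (n + 1) → Fin 3) → ℂ) :
    ∑ a, f a = ∑ j, ∑ b : Fin n → Fin 3, f (i.insertNth j b) := by
  rw [← Fintype.sum_prod_type', ← (Fin.insertNthEquiv (fun _ : Fin (n + 1) => Fin 3) i).sum_comp]
  rfl

/-- The weight `∏ η^{a_i}` is invariant under permuting the indices, so all `n!` summands contract
to the same number. -/
lemma contract_symPart (T : Tensor n) : contract η (symPart T) = contract η T := by
  have h (σ : Equiv.Perm (Fin n)) :
      ∑ a : Fin n → Fin 3, (∏ i, η (a i)) * T (a ∘ σ) = contract η T := by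
    rw [contract, ← (Equiv.arrowCongr σ (Equiv.refl (Fin 3))).sum_comp]
    refine Finset.sum_congr rfl fun a _ => ?_
    congr 1
    · exact σ.symm.prod_comp fun i => η (a i)
    · congr 1; ext i; simp [Equiv.arrowCongr]
  have hn : (n ! : ℂ) ≠ 0 := by exact_mod_cast n.factorial_ne_zero
  calc contract η (symPart T)
      = ∑ a : Fin n → Fin 3, ∑ σ : Equiv.Perm (Fin n),
          (1 / (n ! : ℂ)) * ((∏ i, η (a i)) * T (a ∘ σ)) := by
        refine Finset.sum_congr rfl fun a _ => ?_
        simp only [symPart, Finset.mul_sum]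
        exact Finset.sum_congr rfl fun _ _ => by ring
    _ = contract η T := by
        rw [Finset.sum_comm]
        simp only [← Finset.mul_sum, h]
        simp [Fintype.card_perm, hn]

lemma contract_mulTwo (R : Fin 3 → Fin 3 → ℝ) (S : Tensor n) :
    contract η (mulTwo R S) = (∑ i, ∑ j, η i * η j * R i j) * contract η S := by
  rw [contract, sum_tensor_cons]
  simp only [sum_tensor_cons, mulTwo, contract, Fin.prod_univ_succ, Fin.cons_zero, Fin.cons_succ,
    Fin.cons_one]
  rw [Finset.sum_mul]
  refine Finset.sum_congr rfl fun i _ => ?_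
  rw [Finset.sum_mul]
  refine Finset.sum_congr rfl fun j _ => ?_
  rw [Finset.mul_sum]
  exact Finset.sum_congr rfl fun _ _ => by ring

/-- The trace term contracts to a multiple of `h(η, η) = 0`, so on powers of a null vector the
operator `C` acts as the identity. This is what turns the tensor recursion into a scalar one. -/
lemma contract_of_isSTFPart {h : Matrix (Fin 3) (Fin 3) ℝ} {T Q : Tensor n}
    (hη : ∑ i, ∑ j, η i * η j * (h i j : ℂ) = 0) (hQ : IsSTFPart h T Q) :
    contract η Q = contract η T := by
  match n, T, Q, hQ with
  | 0, T, Q, hQ => rw [show Q = T from hQ]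
  | 1, T, Q, hQ => rw [show Q = T from hQ]
  | n + 2, T, Q, hQ =>
    obtain ⟨-, -, S, hS⟩ := hQ
    rw [← contract_symPart T, hS, contract_add, contract_symPart, contract_mulTwo, hη]
    ring

/-- The normalization `dz̃(η) = 1`: with it the contraction of `P^{(n)}(Λ)` is `m_n` itself. -/
lemma contract_zTensor : contract nullVec (zTensor n) = 1 := by
  induction n with
  | zero => simp [contract, zTensor]
  | succ n ih =>
    rw [contract, sum_tensor_cons]
    have (j : Fin 3) (b : Fin n → Fin 3) :
        (∏ i, nullVec ((Fin.cons j b : Fin (n + 1) → Fin 3) i)) * zTensor (n + 1) (Fin.cons j b) =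
          (nullVec j * if j = 2 then 1 else 0) * ((∏ i, nullVec (b i)) * zTensor n b) := by
      simp only [zTensor, Fin.prod_univ_succ, Fin.cons_zero, Fin.cons_succ]; ring
    simp only [this, ← Finset.mul_sum]
    change ∑ j, (nullVec j * if j = 2 then 1 else 0) * contract nullVec (zTensor n) = 1
    simp only [ih]
    simp [nullVec]

/-- The hypothesis on `christoffel` says that `η` is pregeodesic at `x`. Each of the `n` index slots
then contributes `μ` times the full contraction, and `η` has constant components, so the derivative
passes through the contraction. -/
lemma contract_covDeriv {h : MetricField} {T : Pt → Tensor n} {x : Pt} {μ : ℂ}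
    (hT : ∀ a, DifferentiableAt ℝ (fun y => T y a) x)
    (hΓ : ∀ k, ∑ i, ∑ j, nullVec i * nullVec j * (christoffel h k i j x : ℂ) = μ * nullVec k) :
    contract nullVec (covDeriv h T x) =
      nullDeriv (fun y => contract nullVec (T y)) x - n * μ * contract nullVec (T x) := by
  have h1 : nullDeriv (fun y => contract nullVec (T y)) x =
      ∑ j, ∑ b : Fin n → Fin 3, nullVec j * (∏ i, nullVec (b i)) * pd j (fun y => T y b) x := by
    rw [← sum_nullVec_mul_pd]
    refine Finset.sum_congr rfl fun j _ => ?_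
    unfold contract
    rw [pd_sum fun b _ => (hT b).const_mul _, Finset.mul_sum]
    refine Finset.sum_congr rfl fun b _ => ?_
    rw [pd_mul (differentiableAt_const _) (hT b), pd_const]
    ring
  -- The correction in slot `i`: splitting off that index isolates `Γ^k_{jj'} η^j η^{j'}`, and what
  -- remains after reordering the sums is the contraction of `T` with `η^k` back in the slot.
  have h2 (i : Fin n) : ∑ j, ∑ b : Fin n → Fin 3, nullVec j * (∏ i, nullVec (b i)) *
      ∑ k, (christoffel h k j (b i) x : ℂ) * T x (Function.update b i k) =
        μ * contract nullVec (T x) := by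
    match n, T, i with
    | m + 1, T, i =>
      rw [contract, sum_tensor_insertNth i]
      simp only [sum_tensor_insertNth i, Fin.prod_univ_succAbove _ i, Fin.insertNth_apply_same,
        Fin.insertNth_apply_succAbove, Fin.update_insertNth, Finset.mul_sum]
      have h3 (k : Fin 3) (b : Fin m → Fin 3) : μ * (nullVec k * (∏ l, nullVec (b l)) *
          T x (i.insertNth k b)) = ∑ j, ∑ j', nullVec j * (nullVec j' * ∏ l, nullVec (b l)) *
            ((christoffel h k j j' x : ℂ) * T x (i.insertNth k b)) := by
        rw [← mul_assoc, ← mul_assoc, ← hΓ]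
        simp only [Finset.sum_mul]
        exact Finset.sum_congr rfl fun _ _ => Finset.sum_congr rfl fun _ _ => by ring
      simp only [h3]
      calc _ = ∑ j, ∑ j', ∑ k, ∑ b : Fin m → Fin 3, nullVec j * (nullVec j' * ∏ l, nullVec (b l)) *
            ((christoffel h k j j' x : ℂ) * T x (i.insertNth k b)) :=
          Finset.sum_congr rfl fun _ _ => Finset.sum_congr rfl fun _ _ => Finset.sum_comm
        _ = ∑ j, ∑ k, ∑ j', ∑ b : Fin m → Fin 3, nullVec j * (nullVec j' * ∏ l, nullVec (b l)) *
            ((christoffel h k j j' x : ℂ) * T x (i.insertNth k b)) :=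
          Finset.sum_congr rfl fun _ _ => Finset.sum_comm
        _ = ∑ k, ∑ j, ∑ j', ∑ b : Fin m → Fin 3, nullVec j * (nullVec j' * ∏ l, nullVec (b l)) *
            ((christoffel h k j j' x : ℂ) * T x (i.insertNth k b)) := Finset.sum_comm
        _ = ∑ k, ∑ j, ∑ b : Fin m → Fin 3, ∑ j', nullVec j * (nullVec j' * ∏ l, nullVec (b l)) *
            ((christoffel h k j j' x : ℂ) * T x (i.insertNth k b)) :=
          Finset.sum_congr rfl fun _ _ => Finset.sum_congr rfl fun _ _ => Finset.sum_comm
        _ = _ := Finset.sum_congr rfl fun _ _ => Finset.sum_comm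
  rw [h1, contract, sum_tensor_cons]
  simp only [covDeriv, Fin.prod_univ_succ, Fin.cons_zero, Fin.cons_succ, Fin.tail_cons, mul_sub,
    Finset.sum_sub_distrib]
  congr 1
  calc ∑ j, ∑ b : Fin n → Fin 3, nullVec j * (∏ i, nullVec (b i)) *
        ∑ i, ∑ k, (christoffel h k j (b i) x : ℂ) * T x (Function.update b i k)
      = ∑ j, ∑ i, ∑ b : Fin n → Fin 3, nullVec j * (∏ i, nullVec (b i)) *
        ∑ k, (christoffel h k j (b i) x : ℂ) * T x (Function.update b i k) := by
        refine Finset.sum_congr rfl fun j _ => ?_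
        rw [Finset.sum_comm]
        exact Finset.sum_congr rfl fun b _ => Finset.mul_sum _ _ _
    _ = _ := by
        rw [Finset.sum_comm]
        simp only [h2]
        simp; ring

variable {σ B β : Pt → ℝ} {p : Pt}

/-- On the plane `ỹ = 0` the form `a` annihilates `η` and only the conformal terms survive: flat
null lines stay pregeodesic under a conformal change. -/
lemma sum_nullVec_christoffel (hσ : AnalyticAt ℝ σ p) (hB : AnalyticAt ℝ B p)
    (hD : azimuthFactor B p ≠ 0) (hp : p 1 = 0) (k : Fin 3) :
    ∑ i, ∑ j, nullVec i * nullVec j * (christoffel (conformalMetric σ B) k i j p : ℂ) =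
      2 * nullDeriv (fun x => (σ x : ℂ)) p * nullVec k := by
  have h1 := (christoffel_null_re hσ hB hD).self_of_nhds k
  have h2 := (christoffel_null_im hσ hB hD).self_of_nhds k
  rw [hp] at h1 h2
  simp only [zero_mul, add_zero] at h1 h2
  rw [nullDeriv_ofReal hσ.differentiableAt]
  have e1 := congrArg (fun t : ℝ => (t : ℂ)) h1
  have e2 := congrArg (fun t : ℝ => (t : ℂ)) h2
  push_cast at e1 e2
  have hI : Complex.I ^ 2 = -1 := Complex.I_sq
  obtain rfl | rfl | rfl := fin_three_cases k <;>
    simp [Fin.sum_univ_three, nullVec] at e1 e2 ⊢ <;>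
    first
      | linear_combination e1 - Complex.I * e2
      | linear_combination e1 - Complex.I * e2 - 2 * ((pd 0 σ p : ℝ) : ℂ) * hI

lemma sum_nullVec_conformalMetric (σ B : Pt → ℝ) (hp : p 1 = 0) :
    ∑ i, ∑ j, nullVec i * nullVec j * (conformalMetric σ B p i j : ℂ) = 0 := by
  simp [Fin.sum_univ_three, nullVec, conformalMetric_apply, azimuthForm, hp]

/-- The terms in `β` are the null Ricci component of `δ + B a ⊗ a`, those in `σ` the conformal
change in dimension three. The Laplacian and gradient terms of that change are multiples of the
metric and vanish on `η`. -/
lemma sum_nullVec_ricci (hσ : AnalyticAt ℝ σ p) (hB : AnalyticAt ℝ B p) (hβ : AnalyticAt ℝ β p)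
    (hD : ∀ᶠ x in 𝓝 p, azimuthFactor B x = Real.exp (-2 * β x)) (hp : p 1 = 0) (hp0 : p 0 ≠ 0) :
    ∑ i, ∑ j, nullVec i * nullVec j * (ricci (conformalMetric σ B) i j p : ℂ) =
      nullDeriv (nullDeriv fun x => (β x : ℂ)) p - nullDeriv (fun x => (β x : ℂ)) p ^ 2
      - 2 * Complex.I * nullDeriv (fun x => (β x : ℂ)) p / p 0
      - nullDeriv (nullDeriv fun x => (σ x : ℂ)) p + nullDeriv (fun x => (σ x : ℂ)) p ^ 2 := by
  have h2 {u : Pt → ℝ} (hu : AnalyticAt ℝ u p) : nullDeriv (nullDeriv fun x => (u x : ℂ)) p =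
      ((pd 2 (pd 2 u) p - pd 0 (pd 0 u) p : ℝ) : ℂ)
        - Complex.I * ((pd 2 (pd 0 u) p + pd 0 (pd 2 u) p : ℝ) : ℂ) := by
    have e : nullDeriv (fun x => (u x : ℂ)) =ᶠ[𝓝 p]
        fun x => ((pd 2 u x : ℝ) : ℂ) - Complex.I * ((pd 0 u x : ℝ) : ℂ) := by
      filter_upwards [hu.eventually_analyticAt] with x hx
      exact nullDeriv_ofReal hx.differentiableAt
    have d (i : Fin 3) : DifferentiableAt ℝ (fun x => ((pd i u x : ℝ) : ℂ)) p :=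
      Complex.ofRealCLM.differentiableAt.comp p (analyticAt_pd hu).differentiableAt
    have d' (i : Fin 3) := (analyticAt_pd (i := i) hu).differentiableAt
    rw [show nullDeriv (nullDeriv fun x => (u x : ℂ)) p = _ from (cderiv_congr e).eq_of_nhds,
      ← nullDeriv, nullDeriv_eq, pd_sub (d 2) ((d 0).const_mul _),
      pd_sub (d 2) ((d 0).const_mul _), pd_mul (differentiableAt_const _) (d 0),
      pd_mul (differentiableAt_const _) (d 0), pd_const, pd_const, pd_ofReal (d' 2),
      pd_ofReal (d' 2), pd_ofReal (d' 0), pd_ofReal (d' 0)]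
    push_cast
    linear_combination ((pd 0 (pd 0 u) p : ℝ) : ℂ) * Complex.I_sq
  have e1 := congrArg (fun t : ℝ => (t : ℂ)) (ricci_null_re hσ hB hβ hD hp hp0)
  have e2 := congrArg (fun t : ℝ => (t : ℂ)) (ricci_null_im hσ hB hβ hD hp hp0)
  push_cast at e1 e2
  rw [h2 hσ, h2 hβ, nullDeriv_ofReal hσ.differentiableAt, nullDeriv_ofReal hβ.differentiableAt]
  have hp0' : (p 0 : ℂ) ≠ 0 := by exact_mod_cast hp0
  push_cast
  simp [Fin.sum_univ_three, nullVec]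
  linear_combination e1 - Complex.I * e2 + (2 * ((pd 0 β p : ℝ) : ℂ) / p 0 - (pd 0 β p : ℝ) ^ 2
    + (pd 0 σ p : ℝ) ^ 2) * (-Complex.I_sq)

end Contraction


/-! ### The field equation along the null direction -/

section FieldEquation

/-- The coefficient `B` for which `ĥ = δ + B a ⊗ a`. -/
def azimuthCoeff (β : Pt → ℝ) (x : Pt) : ℝ := (Real.exp (-2 * β x) - 1) / (x 0 ^ 2 + x 1 ^ 2)

lemma tildeMetric_eq (β κ : Pt → ℝ) : tildeMetric β κ = conformalMetric κ (azimuthCoeff β) := rfl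

variable {β : Pt → ℝ} {p : Pt}

lemma cylNormSq_pos (h0 : p 0 ≠ 0) : 0 < p 0 ^ 2 + p 1 ^ 2 := by positivity

lemma normSq_pos (h0 : p 0 ≠ 0) : 0 < normSq p := by unfold normSq; positivity

lemma analyticAt_azimuthCoeff (hβ : AnalyticAt ℝ β p) (h0 : p 0 ≠ 0) :
    AnalyticAt ℝ (azimuthCoeff β) p :=
  ((analyticAt_const.mul hβ).rexp.sub analyticAt_const).div
    (((analyticAt_coord 0 p).pow 2).add ((analyticAt_coord 1 p).pow 2)) (cylNormSq_pos h0).ne'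

lemma eventually_azimuthFactor_azimuthCoeff (β : Pt → ℝ) (h0 : p 0 ≠ 0) :
    ∀ᶠ x in 𝓝 p, azimuthFactor (azimuthCoeff β) x = Real.exp (-2 * β x) := by
  filter_upwards [(analyticAt_coord 0 p).continuousAt.eventually_ne h0] with x hx
  have := (cylNormSq_pos hx).ne'
  simp only [azimuthFactor, azimuthCoeff]
  field_simp
  ring

lemma analyticAt_normSq (p : Pt) : AnalyticAt ℝ normSq p :=
  (((analyticAt_coord 0 p).pow 2).add ((analyticAt_coord 1 p).pow 2)).add
    ((analyticAt_coord 2 p).pow 2)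

lemma orbitMetric_eventuallyEq (β : Pt → ℝ) (h0 : p 0 ≠ 0) : orbitMetric β =ᶠ[𝓝 p]
    conformalMetric (fun x => β x - Real.log (normSq x)) (azimuthCoeff β) := by
  filter_upwards [(analyticAt_coord 0 p).continuousAt.eventually_ne h0] with x hx
  have hN := normSq_pos hx
  have : (hatOmega β x ^ 2)⁻¹ = Real.exp (2 * (β x - Real.log (normSq x))) := by
    rw [hatOmega, mul_sub, Real.exp_sub, two_mul (Real.log _), Real.exp_add, Real.exp_log hN,
      two_mul, Real.exp_add, Real.exp_neg]
    have := Real.exp_ne_zero (β x)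
    field_simp
  rw [orbitMetric, this]
  rfl

lemma christoffel_congr {h h' : MetricField} {p : Pt} (e : h =ᶠ[𝓝 p] h') (k i j : Fin 3) :
    christoffel h k i j =ᶠ[𝓝 p] christoffel h' k i j := by
  have e' (a b c : Fin 3) : pd a (fun y => h y b c) =ᶠ[𝓝 p] pd a (fun y => h' y b c) :=
    pd_congr (e.mono fun x hx => by simp only [hx])
  have e'' := Filter.eventually_all.2 fun a => Filter.eventually_all.2 fun b =>
    Filter.eventually_all.2 fun c => e' a b c
  filter_upwards [e, e''] with x hx hx'
  simp only [christoffel, hx, hx']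

lemma ricci_congr {h h' : MetricField} {p : Pt} (e : h =ᶠ[𝓝 p] h') (i j : Fin 3) :
    ricci h i j p = ricci h' i j p := by
  have e' (k i j : Fin 3) := (christoffel_congr e k i j).eq_of_nhds
  have e'' (l k i j : Fin 3) := (pd_congr (i := l) (christoffel_congr e k i j)).eq_of_nhds
  simp only [ricci, e', e'']

lemma nullDeriv_coord (i : Fin 3) (p : Pt) : nullDeriv (fun x => (x i : ℂ)) p = nullVec i := by
  rw [nullDeriv_ofReal (analyticAt_coord i p).differentiableAt]
  obtain rfl | rfl | rfl := fin_three_cases i <;> simp [nullVec]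

lemma analyticAt_ofReal {E : Type*} [NormedAddCommGroup E] [NormedSpace ℝ E] {u : E → ℝ} {x : E}
    (hu : AnalyticAt ℝ u x) : AnalyticAt ℝ (fun y => (u y : ℂ)) x :=
  (Complex.ofRealCLM.analyticAt _).comp hu

lemma analyticAt_conj {E : Type*} [NormedAddCommGroup E] [NormedSpace ℝ E] {u : E → ℂ} {x : E}
    (hu : AnalyticAt ℝ u x) : AnalyticAt ℝ (fun y => conj (u y)) x :=
  (Complex.conjCLE.toContinuousLinearMap.analyticAt _).comp hu

lemma analyticAt_coordC (i : Fin 3) (x : Pt) : AnalyticAt ℝ (fun y : Pt => (y i : ℂ)) x :=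
  analyticAt_ofReal (analyticAt_coord i x)

lemma nullDeriv_normSq (p : Pt) :
    nullDeriv (fun x => (normSq x : ℂ)) p = 2 * (p 2 - Complex.I * p 0) := by
  have h (i : Fin 3) := (analyticAt_coordC i p).differentiableAt
  have e : (fun x : Pt => (normSq x : ℂ)) =
      fun x => (x 0 : ℂ) * x 0 + (x 1 : ℂ) * x 1 + (x 2 : ℂ) * x 2 := by
    funext x; simp only [normSq]; push_cast; ring
  have h' (i : Fin 3) : nullDeriv (fun x => (x i : ℂ) * x i) p = 2 * p i * nullVec i := by
    rw [show nullDeriv (fun x => (x i : ℂ) * x i) p = _ from cderiv_mul (h i) (h i)]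
    rw [← nullDeriv, nullDeriv_coord]; ring
  rw [e, show nullDeriv _ p = _ from cderiv_add (((h 0).fun_mul (h 0)).fun_add
    ((h 1).fun_mul (h 1))) ((h 2).fun_mul (h 2)), cderiv_add ((h 0).fun_mul (h 0))
    ((h 1).fun_mul (h 1)), ← nullDeriv, h', h', h']
  simp [nullVec]; ring

lemma nullDeriv_log_normSq (h0 : p 0 ≠ 0) :
    nullDeriv (fun x => (Real.log (normSq x) : ℂ)) p =
      2 * (p 2 - Complex.I * p 0) * (normSq p : ℂ)⁻¹ := by
  have hN := (normSq_pos h0).ne'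
  have hd := (analyticAt_normSq p).differentiableAt
  have hpd (i : Fin 3) : pd i (fun x => Real.log (normSq x)) p = (normSq p)⁻¹ * pd i normSq p := by
    simp [pd, fderiv.log hd hN]
  have h2 := nullDeriv_normSq p
  rw [nullDeriv_ofReal hd] at h2
  rw [nullDeriv_ofReal (hd.log hN), hpd, hpd, ← h2]
  push_cast; ring

/-- `η` annihilates `z̃ - i x̃`, which is half the derivative of `normSq` along `η`. So the second
derivative of `normSq` is zero and only the square of the logarithmic derivative remains. -/
lemma nullDeriv_nullDeriv_log_normSq (h0 : p 0 ≠ 0) :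
    nullDeriv (nullDeriv (fun x => (Real.log (normSq x) : ℂ))) p =
      -(2 * (p 2 - Complex.I * p 0) * (normSq p : ℂ)⁻¹) ^ 2 := by
  have e : nullDeriv (fun x => (Real.log (normSq x) : ℂ)) =ᶠ[𝓝 p]
      fun x => (2 * ((x 2 : ℂ) - Complex.I * x 0)) * (normSq x : ℂ)⁻¹ := by
    filter_upwards [(analyticAt_coord 0 p).continuousAt.eventually_ne h0] with x hx
    exact nullDeriv_log_normSq hx
  have h (i : Fin 3) := (analyticAt_coordC i p).differentiableAt
  have hN : (normSq p : ℂ) ≠ 0 := by exact_mod_cast (normSq_pos h0).ne'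
  have hd := (analyticAt_ofReal (analyticAt_normSq p)).differentiableAt
  have h3 : nullDeriv (fun x => 2 * ((x 2 : ℂ) - Complex.I * x 0)) p = 0 := by
    rw [show nullDeriv _ p = _ from cderiv_mul (differentiableAt_const _)
      ((h 2).fun_sub ((h 0).const_mul _)), cderiv_sub (h 2) ((h 0).const_mul _),
      cderiv_mul (differentiableAt_const _) (h 0), ← nullDeriv, nullDeriv_coord, nullDeriv_coord]
    simp [nullVec]
  rw [show nullDeriv (nullDeriv _) p = _ from (cderiv_congr e).eq_of_nhds,
    cderiv_mul (((h 2).fun_sub ((h 0).const_mul _)).const_mul _) (hd.fun_inv hN),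
    cderiv_inv hd hN, ← nullDeriv, h3, nullDeriv_normSq]
  field_simp
  ring

/-- For `h` the conformal exponent is `β - log (ρ̃² + z̃²)`, so the terms `β'' - β'²` cancel and
those quadratic in the logarithm cancel by the preceding lemma. The field equation thereby becomes
first order in `β`. -/
lemma sum_nullVec_ricci_orbitMetric (hβ : AnalyticAt ℝ β p) (hp : p 1 = 0) (h0 : p 0 ≠ 0) :
    (∑ i, ∑ j, nullVec i * nullVec j * (ricci (orbitMetric β) i j p : ℂ)) *
        (p 0 * (p 2 + Complex.I * p 0)) =
      -2 * Complex.I * (p 2 - Complex.I * p 0) * nullDeriv (fun x => (β x : ℂ)) p := by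
  have hN := (normSq_pos h0).ne'
  have hlog : AnalyticAt ℝ (fun x => Real.log (normSq x)) p :=
    (analyticAt_log (normSq_pos h0)).comp (analyticAt_normSq p)
  have hσ : AnalyticAt ℝ (fun x => β x - Real.log (normSq x)) p := hβ.sub hlog
  have hβ' := (analyticAt_ofReal hβ)
  have hlog' := (analyticAt_ofReal hlog)
  have e : ∀ᶠ x in 𝓝 p, nullDeriv (fun x => ((β x - Real.log (normSq x) : ℝ) : ℂ)) x =
      nullDeriv (fun x => (β x : ℂ)) x - nullDeriv (fun x => (Real.log (normSq x) : ℂ)) x := by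
    filter_upwards [hβ'.eventually_analyticAt, hlog'.eventually_analyticAt] with x h1 h2
    simp only [Complex.ofReal_sub]
    exact cderiv_sub h1.differentiableAt h2.differentiableAt
  have e2 : nullDeriv (nullDeriv fun x => ((β x - Real.log (normSq x) : ℝ) : ℂ)) p =
      nullDeriv (nullDeriv fun x => (β x : ℂ)) p -
        nullDeriv (nullDeriv fun x => (Real.log (normSq x) : ℂ)) p :=
    (cderiv_congr e).eq_of_nhds.trans (cderiv_sub (analyticAt_cderiv hβ').differentiableAt
      (analyticAt_cderiv hlog').differentiableAt)
  simp only [ricci_congr (orbitMetric_eventuallyEq β h0)]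
  rw [sum_nullVec_ricci hσ (analyticAt_azimuthCoeff hβ h0) hβ
    (eventually_azimuthFactor_azimuthCoeff β h0) hp h0, e.self_of_nhds, e2,
    nullDeriv_log_normSq h0, nullDeriv_nullDeriv_log_normSq h0]
  have hN' : (normSq p : ℂ) = (p 2 + Complex.I * p 0) * (p 2 - Complex.I * p 0) := by
    simp only [normSq, hp]; push_cast; linear_combination (p 0 : ℂ) ^ 2 * Complex.I_sq
  have hp0 : (p 0 : ℂ) ≠ 0 := by exact_mod_cast h0
  have hN0 : (normSq p : ℂ) ≠ 0 := by exact_mod_cast hN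
  rw [hN'] at hN0 ⊢
  have h3 := left_ne_zero_of_mul hN0
  have h4 := right_ne_zero_of_mul hN0
  field_simp
  linear_combination -4 * (p 0 : ℂ) * nullDeriv (fun x => (β x : ℂ)) p *
    (p 2 + Complex.I * p 0) * Complex.I_sq

end FieldEquation


/-! ### The vacuum equation in terms of the potential -/

section FieldEquation

/-- The Ernst equation for `β` along the null direction, in terms of `f = φ / √(ρ̃² + z̃²)`. -/
lemma nullDeriv_beta_eq {lam om β : Pt → ℝ} {f : Pt → ℂ} {p : Pt} (hβ : AnalyticAt ℝ β p)
    (hf : AnalyticAt ℝ f p) (hp : p 1 = 0) (h0 : p 0 ≠ 0)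
    (hpot : ∀ᶠ x in 𝓝 p, ernstPotential lam om x = (√(normSq x) : ℂ) * f x)
    (hlam : ∀ᶠ x in 𝓝 p, 0 < lam x)
    (hR : ∀ i j, ricci (orbitMetric β) i j p =
      1 / (2 * lam p ^ 2) * (pd i lam p * pd j lam p + pd i om p * pd j om p)) :
    (1 - normSq p * (f p * conj (f p))) ^ 2 * nullDeriv (fun x => (β x : ℂ)) p =
      Complex.I * p 0 * (f p + (p 2 + Complex.I * p 0) * nullDeriv f p) *
        (conj (f p) + (p 2 + Complex.I * p 0) * nullDeriv (fun x => conj (f x)) p) := by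
  have hN := normSq_pos h0
  set s : Pt → ℝ := fun x => √(normSq x) with hs
  have hs' : ∀ x, √(normSq x) = s x := fun _ => rfl
  have hsa : AnalyticAt ℝ s p := by
    have e : (fun x => Real.exp (Real.log (normSq x) / 2)) =ᶠ[𝓝 p] s := by
      filter_upwards [(analyticAt_coord 0 p).continuousAt.eventually_ne h0] with x hx
      change _ = √(normSq x)
      rw [Real.sqrt_eq_rpow, Real.rpow_def_of_pos (normSq_pos hx)]
      congr 1; ring
    have hl : AnalyticAt ℝ (fun x => Real.log (normSq x)) p :=
      (analyticAt_log hN).comp (analyticAt_normSq p)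
    have : AnalyticAt ℝ (fun x => Real.exp (Real.log (normSq x) / 2)) p := by fun_prop
    exact this.congr e
  have hss : s p * s p = normSq p := Real.mul_self_sqrt hN.le
  have hsp : 0 < s p := Real.sqrt_pos.2 hN
  set ph : Pt → ℂ := fun x => (s x : ℂ) * f x with hph
  have hpha : AnalyticAt ℝ ph p := (analyticAt_ofReal hsa).mul hf
  set u : Pt → ℂ := fun x => 1 + ph x with hu
  have hua : AnalyticAt ℝ u p := analyticAt_const.add hpha
  -- The Ernst function `λ + iω` is a Möbius function of `φ = u - 1`. With `v = ū` this factorizes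
  -- the source: `λ'² + ω'² = (λ + iω)' (λ - iω)' = 4 u' v' / (u v)²`.
  have huv : ∀ᶠ x in 𝓝 p, u x ≠ 0 ∧ (lam x : ℂ) + Complex.I * om x = -1 + 2 * (u x)⁻¹ := by
    filter_upwards [hpot, hlam] with x h1 h2
    have h3 : (1 + (lam x : ℂ) + Complex.I * om x) ≠ 0 := by
      intro h
      have := congrArg Complex.re h
      simp at this
      linarith
    have h4 : u x = 2 / (1 + (lam x : ℂ) + Complex.I * om x) := by
      rw [hu, hph]; simp only
      rw [← hs' x, ← h1, ernstPotential]
      field_simp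
      ring
    constructor
    · rw [h4]; exact div_ne_zero two_ne_zero h3
    · rw [h4]; field_simp; ring
  have hu0 := huv.self_of_nhds.1
  set v : Pt → ℂ := fun x => conj (u x) with hv
  have hva : AnalyticAt ℝ v p := analyticAt_conj hua
  have hv0 : v p ≠ 0 := by simpa [hv] using hu0
  have hlamv : (fun x => (lam x : ℂ)) =ᶠ[𝓝 p] fun x => -1 + ((u x)⁻¹ + (v x)⁻¹) := by
    filter_upwards [huv] with x hx
    have h1 := hx.2
    have h2 := congrArg conj hx.2
    simp only [map_add, map_mul, Complex.conj_ofReal, Complex.conj_I, map_neg, map_one, map_inv₀,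
      Complex.conj_ofNat] at h2
    change _ = -1 + 2 * (v x)⁻¹ at h2
    linear_combination (h1 + h2) / 2
  have homv : (fun x => (om x : ℂ)) =ᶠ[𝓝 p] fun x => -Complex.I * ((u x)⁻¹ - (v x)⁻¹) := by
    filter_upwards [huv] with x hx
    have h1 := hx.2
    have h2 := congrArg conj hx.2
    simp only [map_add, map_mul, Complex.conj_ofReal, Complex.conj_I, map_neg, map_one, map_inv₀,
      Complex.conj_ofNat] at h2
    change _ = -1 + 2 * (v x)⁻¹ at h2
    linear_combination -Complex.I * (h1 - h2) / 2 + om x * Complex.I_sq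
  have hui := hua.fun_inv hu0
  have hvi := hva.fun_inv hv0
  -- Regularity of `λ` and `ω` is not among the data; it is recovered from that of `φ`.
  have hlama : AnalyticAt ℝ lam p := by
    have : AnalyticAt ℝ (fun x => (lam x : ℂ)) p :=
      (analyticAt_const.add (hui.add hvi)).congr hlamv.symm
    exact ((Complex.reCLM.analyticAt _).comp this).congr (.of_forall fun x => by simp)
  have homa : AnalyticAt ℝ om p := by
    have : AnalyticAt ℝ (fun x => (om x : ℂ)) p :=
      (analyticAt_const.mul (hui.sub hvi)).congr homv.symm
    exact ((Complex.reCLM.analyticAt _).comp this).congr (.of_forall fun x => by simp)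
  have dui := hui.differentiableAt
  have dvi := hvi.differentiableAt
  have Lui : nullDeriv (fun x => (u x)⁻¹) p = -(u p ^ 2)⁻¹ * nullDeriv u p :=
    cderiv_inv hua.differentiableAt hu0
  have Lvi : nullDeriv (fun x => (v x)⁻¹) p = -(v p ^ 2)⁻¹ * nullDeriv v p :=
    cderiv_inv hva.differentiableAt hv0
  have Llam : nullDeriv (fun x => (lam x : ℂ)) p =
      nullDeriv (fun x => (u x)⁻¹) p + nullDeriv (fun x => (v x)⁻¹) p := by
    refine (cderiv_congr hlamv).eq_of_nhds.trans ?_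
    rw [cderiv_add (differentiableAt_const _) (dui.fun_add dvi), cderiv_const, zero_add]
    exact cderiv_add dui dvi
  have Lom : nullDeriv (fun x => (om x : ℂ)) p =
      -Complex.I * (nullDeriv (fun x => (u x)⁻¹) p - nullDeriv (fun x => (v x)⁻¹) p) := by
    refine (cderiv_congr homv).eq_of_nhds.trans ?_
    rw [cderiv_mul (differentiableAt_const _) (dui.fun_sub dvi), cderiv_const, zero_mul, add_zero,
      cderiv_sub dui dvi]
  have Ls : s p * nullDeriv (fun x => (s x : ℂ)) p = p 2 - Complex.I * p 0 := by
    have hd := (analyticAt_ofReal hsa).differentiableAt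
    have e : (fun x => (normSq x : ℂ)) =ᶠ[𝓝 p] fun x => (s x : ℂ) * s x := by
      filter_upwards [(analyticAt_coord 0 p).continuousAt.eventually_ne h0] with x hx
      rw [← Complex.ofReal_mul, Real.mul_self_sqrt (normSq_pos hx).le]
    have h1 : nullDeriv (fun x => (normSq x : ℂ)) p = s p * nullDeriv (fun x => (s x : ℂ)) p +
        nullDeriv (fun x => (s x : ℂ)) p * s p :=
      (cderiv_congr e).eq_of_nhds.trans (cderiv_mul hd hd)
    rw [nullDeriv_normSq] at h1
    linear_combination -h1 / 2
  have hNw : (s p : ℂ) * s p = (p 2 + Complex.I * p 0) * (p 2 - Complex.I * p 0) := by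
    rw [← Complex.ofReal_mul, hss]
    simp only [normSq, hp]; push_cast; linear_combination (p 0 : ℂ) ^ 2 * Complex.I_sq
  have Lu : s p * nullDeriv u p =
      (p 2 - Complex.I * p 0) * (f p + (p 2 + Complex.I * p 0) * nullDeriv f p) := by
    have h1 : nullDeriv u p = s p * nullDeriv f p + nullDeriv (fun x => (s x : ℂ)) p * f p := by
      refine (cderiv_add (differentiableAt_const _) hpha.differentiableAt).trans ?_
      rw [cderiv_const, zero_add]
      exact cderiv_mul (analyticAt_ofReal hsa).differentiableAt hf.differentiableAt
    rw [h1]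
    linear_combination f p * Ls + nullDeriv f p * hNw
  have hfc := analyticAt_conj hf
  have Lv : s p * nullDeriv v p = (p 2 - Complex.I * p 0) * (conj (f p) +
      (p 2 + Complex.I * p 0) * nullDeriv (fun x => conj (f x)) p) := by
    have e : v = fun x => 1 + (s x : ℂ) * conj (f x) := by
      funext x; simp [hv, hu, hph]
    have h1 : nullDeriv v p = s p * nullDeriv (fun x => conj (f x)) p +
        nullDeriv (fun x => (s x : ℂ)) p * conj (f p) := by
      rw [e]
      refine (cderiv_add (differentiableAt_const _)
        ((analyticAt_ofReal hsa).mul hfc).differentiableAt).trans ?_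
      rw [cderiv_const, zero_add]
      exact cderiv_mul (analyticAt_ofReal hsa).differentiableAt hfc.differentiableAt
    rw [h1]
    linear_combination conj (f p) * Ls + nullDeriv (fun x => conj (f x)) p * hNw
  have hlam0 : (lam p : ℂ) ≠ 0 := by exact_mod_cast hlam.self_of_nhds.ne'
  have hsum : ∑ i, ∑ j, nullVec i * nullVec j * (ricci (orbitMetric β) i j p : ℂ) =
      (nullDeriv (fun x => (lam x : ℂ)) p ^ 2 + nullDeriv (fun x => (om x : ℂ)) p ^ 2) /
        (2 * lam p ^ 2) := by
    rw [nullDeriv_ofReal hlama.differentiableAt, nullDeriv_ofReal homa.differentiableAt]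
    simp only [hR, Fin.sum_univ_three]
    push_cast
    simp [nullVec]
    field_simp
    linear_combination -(((pd 0 lam p : ℝ) : ℂ) ^ 2 + ((pd 0 om p : ℝ) : ℂ) ^ 2) * Complex.I_sq
  have hmain := sum_nullVec_ricci_orbitMetric hβ hp h0
  have hlamp : (lam p : ℂ) = -1 + ((u p)⁻¹ + (v p)⁻¹) := hlamv.self_of_nhds
  -- The identity `λ |1 + φ|² = 1 - |φ|²`, which removes `λ` from the equation.
  have hlamuv : (lam p : ℂ) * (u p * v p) = 1 - normSq p * (f p * conj (f p)) := by
    rw [hlamp, ← hss]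
    field_simp
    simp only [hv, hu, hph, map_add, map_mul, map_one, Complex.conj_ofReal]
    push_cast
    ring
  have hw0 : ((p 2 : ℂ) + Complex.I * p 0) * (p 2 - Complex.I * p 0) ≠ 0 := by
    rw [← hNw]; exact mul_ne_zero (by exact_mod_cast hsp.ne') (by exact_mod_cast hsp.ne')
  have h3 := left_ne_zero_of_mul hw0
  have h4 := right_ne_zero_of_mul hw0
  have hsum2 : nullDeriv (fun x => (lam x : ℂ)) p ^ 2 + nullDeriv (fun x => (om x : ℂ)) p ^ 2 =
      4 * nullDeriv u p * nullDeriv v p / (u p * v p) ^ 2 := by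
    rw [Llam, Lom, Lui, Lvi]
    field_simp
    linear_combination (nullDeriv u p * (v p) ^ 2 - nullDeriv v p * (u p) ^ 2) ^ 2 * Complex.I_sq
  have hsC : (s p : ℂ) ≠ 0 := by exact_mod_cast hsp.ne'
  rw [hsum, hsum2] at hmain
  have hfin : 2 * (nullDeriv u p * nullDeriv v p) * (p 0 * (p 2 + Complex.I * p 0)) =
      -2 * Complex.I * (p 2 - Complex.I * p 0) * nullDeriv (fun x => (β x : ℂ)) p *
        ((lam p : ℂ) * (u p * v p)) ^ 2 := by
    rw [← hmain]
    field_simp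
    ring
  rw [hlamuv] at hfin
  have hLL : nullDeriv u p * nullDeriv v p * (p 2 + Complex.I * p 0) = (p 2 - Complex.I * p 0) *
      (f p + (p 2 + Complex.I * p 0) * nullDeriv f p) *
        (conj (f p) + (p 2 + Complex.I * p 0) * nullDeriv (fun x => conj (f x)) p) := by
    apply mul_right_cancel₀ h4
    calc _ = (s p * nullDeriv u p) * (s p * nullDeriv v p) := by rw [mul_assoc _ _ (_ - _), ← hNw]; ring
      _ = _ := by rw [Lu, Lv]; ring
  apply mul_left_cancel₀ h4
  linear_combination -(Complex.I / 2) * hfin + Complex.I * p 0 * hLL +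
    (p 2 - Complex.I * p 0) * nullDeriv (fun x => (β x : ℂ)) p *
      (1 - normSq p * (f p * conj (f p))) ^ 2 * (Complex.I_sq)

end FieldEquation


/-! ### Expansions in `w` and `w̄` -/

section DoubleSeries

lemma hasSum_of_forall_eq {ι : Type*} {f g : ι → ℂ} {a : ℂ} (hf : HasSum f a)
    (h : ∀ i, f i = g i) : HasSum g a := by
  rwa [← funext h]

/-- `g(w) = ∑ a_{n,m} wⁿ w̄ᵐ` for `|w| < r`. -/
def HasDoubleSeries (a : ℕ → ℕ → ℂ) (r : ℝ) (g : ℂ → ℂ) : Prop :=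
  ∀ w : ℂ, ‖w‖ < r → HasSum (fun p : ℕ × ℕ => a p.1 p.2 * w ^ p.1 * (conj w) ^ p.2) (g w)

/-- The Wirtinger derivative `∂/∂w`. -/
abbrev wDeriv : (ℂ → ℂ) → ℂ → ℂ := cderiv (1 / 2 : ℂ) (-(Complex.I / 2))

/-- The coefficients of the expansion of a multilinear form in `w` and `w̄`. -/
def conjCoeff {N : ℕ} (p : ContinuousMultilinearMap ℝ (fun _ : Fin N => ℂ) ℂ) (s : Fin N → Fin 2) :
    ℂ :=
  ∑ t : Fin N → Fin 2,
    (∏ i, (!![1 / 2, 1 / 2; -(Complex.I / 2), Complex.I / 2] : Matrix (Fin 2) (Fin 2) ℂ)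
      (t i) (s i)) * p fun i => ![1, Complex.I] (t i)

/-- The argument `w = re w + i im w` is expanded over the real basis `1, i`, and its coordinates are
then written as combinations of `w` and `w̄`; words in the letters `w`, `w̄` result. -/
lemma sum_conjCoeff {N : ℕ} (p : ContinuousMultilinearMap ℝ (fun _ : Fin N => ℂ) ℂ) (w : ℂ) :
    ∑ s : Fin N → Fin 2, conjCoeff p s * ∏ i, ![w, conj w] (s i) = p fun _ => w := by
  have hw : (fun _ : Fin N => w) = fun _ => ∑ k : Fin 2, ![w.re, w.im] k • ![1, Complex.I] k := by
    funext i
    simp [Fin.sum_univ_two]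
  have hk (k : Fin 2) : ((![w.re, w.im] k : ℝ) : ℂ) = ∑ l : Fin 2,
      (!![1 / 2, 1 / 2; -(Complex.I / 2), Complex.I / 2] : Matrix (Fin 2) (Fin 2) ℂ) k l *
        ![w, conj w] l := by
    fin_cases k
    · simp [Fin.sum_univ_two, Complex.re_eq_add_conj]; ring
    · simp [Fin.sum_univ_two, Complex.im_eq_sub_conj]
      field_simp
      linear_combination (w - conj w) * Complex.I_sq
  rw [hw, ← ContinuousMultilinearMap.coe_coe, MultilinearMap.map_sum]
  simp only [MultilinearMap.map_smul_univ, conjCoeff, Finset.sum_mul]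
  rw [Finset.sum_comm]
  refine Finset.sum_congr rfl fun t _ => ?_
  rw [Complex.real_smul]
  push_cast
  simp only [hk]
  rw [Finset.prod_univ_sum, Fintype.piFinset_univ, Finset.sum_mul]
  refine Finset.sum_congr rfl fun s _ => ?_
  rw [Finset.prod_mul_distrib]
  simp only [ContinuousMultilinearMap.coe_coe]
  ring

/-- All entries of the change of basis have modulus `1/2`, so the `2^N` summands each carry a factor
`2^{-N}`. -/
lemma norm_conjCoeff_le {N : ℕ} (p : ContinuousMultilinearMap ℝ (fun _ : Fin N => ℂ) ℂ)
    (s : Fin N → Fin 2) : ‖conjCoeff p s‖ ≤ ‖p‖ := by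
  have h1 (k l : Fin 2) :
      ‖(!![1 / 2, 1 / 2; -(Complex.I / 2), Complex.I / 2] : Matrix (Fin 2) (Fin 2) ℂ) k l‖ =
        1 / 2 := by
    fin_cases k <;> fin_cases l <;> simp
  have h2 (k : Fin 2) : ‖![(1 : ℂ), Complex.I] k‖ = 1 := by fin_cases k <;> simp
  calc ‖conjCoeff p s‖ ≤ ∑ t : Fin N → Fin 2, (1 / 2 : ℝ) ^ N * ‖p‖ := by
        refine (norm_sum_le _ _).trans (Finset.sum_le_sum fun t _ => ?_)
        rw [norm_mul, norm_prod]
        simp only [h1]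
        have := p.le_opNorm fun i => ![(1 : ℂ), Complex.I] (t i)
        simp only [h2] at this
        simp only [Finset.prod_const, Finset.card_univ, Fintype.card_fin]
        gcongr
        simpa using this
    _ = ‖p‖ := by
        simp only [Finset.sum_const, Finset.card_univ, Fintype.card_fun, Fintype.card_fin,
          nsmul_eq_mul]
        rw [← mul_assoc]; push_cast; rw [← mul_pow]; norm_num

lemma exists_hasDoubleSeries {g : ℂ → ℂ} (hg : AnalyticAt ℝ g 0) :
    ∃ (a : ℕ → ℕ → ℂ) (r : ℝ), 0 < r ∧ HasDoubleSeries a r g := by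
  obtain ⟨p, R, hp⟩ := hg
  obtain ⟨r, hr0, hrR⟩ := ENNReal.lt_iff_exists_nnreal_btwn.1 hp.r_pos
  have hr0 : 0 < r := by exact_mod_cast hr0
  have hsum := p.summable_norm_mul_pow (hrR.trans_le hp.r_le)
  -- A word contributes to the monomial given by the numbers of its letters `w` and `w̄`; the double
  -- coefficients are the sums over the fibres of `cnt`.
  let cnt (x : Σ N : ℕ, Fin N → Fin 2) : ℕ × ℕ :=
    (Finset.card {i | x.2 i = 0}, Finset.card {i | x.2 i = 1})
  let E (x : Σ N : ℕ, Fin N → Fin 2) : ℂ := conjCoeff (p x.1) x.2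
  -- There are `2^N` words of length `N`, each bounded by `‖p N‖ |w|^N`; halving the radius pays for
  -- their number.
  refine ⟨fun n m => ∑' x : cnt ⁻¹' {(n, m)}, E x, r / 2, by positivity, fun w hw => ?_⟩
  have hprod (x : Σ N : ℕ, Fin N → Fin 2) :
      ∏ i, ![w, conj w] (x.2 i) = w ^ (cnt x).1 * conj w ^ (cnt x).2 := by
    have h := Finset.prod_fiberwise' (Finset.univ : Finset (Fin x.1)) x.2 ![w, conj w]
    rw [← h]
    simp [Fin.prod_univ_two, cnt]
  have hnorm (x : Σ N : ℕ, Fin N → Fin 2) : ‖E x * ∏ i, ![w, conj w] (x.2 i)‖ ≤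
      ‖p x.1‖ * ((r : ℝ) / 2) ^ x.1 := by
    rw [norm_mul, norm_prod]
    have h2 (k : Fin 2) : ‖![w, conj w] k‖ = ‖w‖ := by fin_cases k <;> simp
    simp only [h2, Finset.prod_const, Finset.card_univ, Fintype.card_fin]
    have := norm_conjCoeff_le (p x.1) x.2
    gcongr
  have hS : Summable fun x : Σ N : ℕ, Fin N → Fin 2 => ‖p x.1‖ * ((r : ℝ) / 2) ^ x.1 := by
    rw [summable_sigma_of_nonneg fun x => by positivity]
    refine ⟨fun N => Summable.of_finite, ?_⟩
    refine hsum.congr fun N => ?_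
    rw [tsum_fintype]
    change _ = ∑ _s : Fin N → Fin 2, ‖p N‖ * ((r : ℝ) / 2) ^ N
    rw [Finset.sum_const, Finset.card_univ, Fintype.card_fun, Fintype.card_fin, Fintype.card_fin,
      nsmul_eq_mul]
    push_cast
    rw [div_pow]
    field_simp
  have hS' : Summable fun x : Σ N : ℕ, Fin N → Fin 2 => E x * ∏ i, ![w, conj w] (x.2 i) :=
    Summable.of_norm_bounded hS hnorm
  have hwR : w ∈ Metric.eball (0 : ℂ) R := by
    rw [Metric.mem_eball, edist_zero_right]
    refine lt_trans ?_ hrR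
    rw [← ofReal_norm, ← ENNReal.ofReal_coe_nnreal]
    exact (ENNReal.ofReal_lt_ofReal_iff (by exact_mod_cast hr0)).2 (by linarith [r.coe_nonneg])
  have hg := hp.hasSum hwR
  rw [zero_add] at hg
  have hT : HasSum (fun x : Σ N : ℕ, Fin N → Fin 2 => E x * ∏ i, ![w, conj w] (x.2 i)) (g w) := by
    refine HasSum.sigma_of_hasSum hg (fun N => ?_) hS'
    rw [← sum_conjCoeff]
    exact hasSum_fintype _
  have hF := hT.tsum_fiberwise cnt
  refine hasSum_of_forall_eq hF fun b => ?_
  symm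
  rw [mul_assoc, ← tsum_mul_right]
  refine tsum_congr fun x => ?_
  rw [hprod, show cnt x = b from x.2]

/-- The derivative of the monomial `wⁿ w̄ᵐ`. -/
def monomialDeriv (n m : ℕ) (w : ℂ) : ℂ →L[ℝ] ℂ :=
  ((n : ℂ) * w ^ (n - 1) * conj w ^ m) • ContinuousLinearMap.id ℝ ℂ +
    (w ^ n * ((m : ℂ) * conj w ^ (m - 1))) • Complex.conjCLE.toContinuousLinearMap

lemma hasFDerivAt_monomial (n m : ℕ) (w : ℂ) :
    HasFDerivAt (fun z : ℂ => z ^ n * conj z ^ m) (monomialDeriv n m w) w := by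
  have h1 : HasFDerivAt (fun z : ℂ => z ^ n) _ w :=
    ((hasDerivAt_pow n w).hasFDerivAt).restrictScalars ℝ
  have h2 : HasFDerivAt (fun z : ℂ => conj z ^ m) _ w :=
    (((hasDerivAt_pow m (conj w)).hasFDerivAt).restrictScalars ℝ).comp w
      Complex.conjCLE.toContinuousLinearMap.hasFDerivAt
  refine (h1.mul h2).congr_fderiv ?_
  ext
  simp [monomialDeriv]
  ring

lemma norm_monomialDeriv_le {n m : ℕ} {w : ℂ} {ρ : ℝ} (hρ : 0 < ρ) (hw : ‖w‖ ≤ ρ) :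
    ‖monomialDeriv n m w‖ ≤ (n + m : ℕ) * ρ ^ (n + m) / ρ := by
  have h (k : ℕ) : (k : ℝ) * ‖w‖ ^ (k - 1) ≤ k * ρ ^ k / ρ := by
    cases k with
    | zero => simp
    | succ k =>
      rw [pow_succ, mul_div_assoc, mul_div_cancel_right₀ _ hρ.ne', Nat.add_sub_cancel]
      gcongr
  have h' (k : ℕ) : ‖w‖ ^ k ≤ ρ ^ k := by gcongr
  have hid : ‖ContinuousLinearMap.id ℝ ℂ‖ ≤ 1 := ContinuousLinearMap.norm_id_le
  have hconj : ‖Complex.conjCLE.toContinuousLinearMap‖ ≤ 1 := Complex.conjCLE_norm.le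
  calc ‖monomialDeriv n m w‖
      ≤ (n * ‖w‖ ^ (n - 1) * ‖w‖ ^ m) * 1 + (‖w‖ ^ n * (m * ‖w‖ ^ (m - 1))) * 1 := by
        refine (norm_add_le _ _).trans (add_le_add ?_ ?_)
        · rw [norm_smul]
          refine mul_le_mul (le_of_eq ?_) hid (norm_nonneg _) (by positivity)
          simp
        · rw [norm_smul]
          refine mul_le_mul (le_of_eq ?_) hconj (norm_nonneg _) (by positivity)
          simp
    _ ≤ (n * ρ ^ n / ρ * ρ ^ m) * 1 + (ρ ^ n * (m * ρ ^ m / ρ)) * 1 := by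
        gcongr
        · exact h n
        · exact h m
    _ = _ := by push_cast; rw [pow_add]; ring

lemma cderiv_monomialDeriv (n m : ℕ) (w : ℂ) :
    monomialDeriv n m w (1 / 2) + Complex.I * monomialDeriv n m w (-(Complex.I / 2)) =
      n * w ^ (n - 1) * conj w ^ m := by
  have h2 : conj (2 : ℂ) = 2 := Complex.conj_ofNat 2
  simp [monomialDeriv, h2]
  linear_combination (w ^ n * (m * conj w ^ (m - 1)) - n * w ^ (n - 1) * conj w ^ m) / 2 *
    Complex.I_sq

lemma HasDoubleSeries.summable_norm {a : ℕ → ℕ → ℂ} {r ρ : ℝ} {g : ℂ → ℂ}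
    (h : HasDoubleSeries a r g) (hρ : 0 ≤ ρ) (hρr : ρ < r) :
    Summable fun p : ℕ × ℕ => ‖a p.1 p.2‖ * ρ ^ (p.1 + p.2) := by
  have := (h ρ (by rwa [Complex.norm_real, Real.norm_of_nonneg hρ])).summable.norm
  refine this.congr fun p => ?_
  simp [abs_of_nonneg hρ, pow_add, mul_assoc]

lemma hasDoubleSeries_wDeriv {a : ℕ → ℕ → ℂ} {r : ℝ} {g : ℂ → ℂ} (h : HasDoubleSeries a r g) :
    HasDoubleSeries (fun n m => (n + 1) * a (n + 1) m) r (wDeriv g) := by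
  intro w hw
  -- Termwise differentiation takes place on the ball of radius `ρ`; the larger `ρ'` absorbs the
  -- factor `n + m` produced by the derivative.
  obtain ⟨ρ, hwρ, hρr⟩ := exists_between hw
  obtain ⟨ρ', hρρ', hρ'r⟩ := exists_between hρr
  have hρ : 0 < ρ := (norm_nonneg w).trans_lt hwρ
  have hρ' : 0 < ρ' := hρ.trans hρρ'
  have hbdd : ∃ C, ∀ k : ℕ, (k : ℝ) * ρ ^ k ≤ C * ρ' ^ k := by
    have ht := tendsto_self_mul_const_pow_of_abs_lt_one (r := ρ / ρ')
      (by rw [abs_of_pos (by positivity), div_lt_one hρ']; exact hρρ')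
    obtain ⟨C, hC⟩ := ht.bddAbove_range
    refine ⟨C, fun k => ?_⟩
    have := hC ⟨k, rfl⟩
    simp only [div_pow] at this
    rw [← mul_div_assoc, div_le_iff₀ (by positivity)] at this
    exact this
  obtain ⟨C, hC⟩ := hbdd
  have hu : Summable fun p : ℕ × ℕ => ‖a p.1 p.2‖ * ((p.1 + p.2 : ℕ) * ρ ^ (p.1 + p.2) / ρ) := by
    refine Summable.of_nonneg_of_le (fun p => by positivity) (fun p => ?_)
      ((h.summable_norm hρ'.le hρ'r).mul_left (C / ρ))
    have := hC (p.1 + p.2)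
    calc ‖a p.1 p.2‖ * ((p.1 + p.2 : ℕ) * ρ ^ (p.1 + p.2) / ρ)
        ≤ ‖a p.1 p.2‖ * (C * ρ' ^ (p.1 + p.2) / ρ) := by gcongr
      _ = _ := by ring
  have hmem : w ∈ Metric.ball (0 : ℂ) ρ := by simpa using hwρ
  have hb (p : ℕ × ℕ) (x : ℂ) (hx : x ∈ Metric.ball (0 : ℂ) ρ) :
      ‖a p.1 p.2 • monomialDeriv p.1 p.2 x‖ ≤
        ‖a p.1 p.2‖ * ((p.1 + p.2 : ℕ) * ρ ^ (p.1 + p.2) / ρ) := by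
    rw [norm_smul]
    gcongr
    exact norm_monomialDeriv_le hρ (by simpa using (mem_ball_zero_iff.1 hx).le)
  have hD := hasFDerivAt_tsum_of_isPreconnected (𝕜 := ℝ) hu Metric.isOpen_ball
    (convex_ball (0 : ℂ) ρ).isPreconnected
    (f := fun p z => a p.1 p.2 * (z ^ p.1 * conj z ^ p.2))
    (fun p x _ => (hasFDerivAt_monomial p.1 p.2 x).const_mul (a p.1 p.2)) hb
    hmem (by simpa only [mul_assoc] using (h w hw).summable) hmem
  have hgD : HasFDerivAt g (∑' p : ℕ × ℕ, a p.1 p.2 • monomialDeriv p.1 p.2 w) w := by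
    refine hD.congr_of_eventuallyEq ?_
    filter_upwards [Metric.isOpen_ball.mem_nhds hmem] with z hz
    rw [← (h z ((mem_ball_zero_iff.1 hz).trans hρr)).tsum_eq]
    exact tsum_congr fun p => mul_assoc _ _ _
  have hS : HasSum (fun p : ℕ × ℕ => a p.1 p.2 • monomialDeriv p.1 p.2 w)
      (∑' p : ℕ × ℕ, a p.1 p.2 • monomialDeriv p.1 p.2 w) :=
    (Summable.of_norm_bounded hu fun p => hb p w hmem).hasSum
  have hev (v : ℂ) := hS.mapL (ContinuousLinearMap.apply ℝ ℂ v)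
  have h3 := (hev (1 / 2)).add ((hev (-(Complex.I / 2))).mul_left Complex.I)
  have h4 : HasSum (fun p : ℕ × ℕ => a p.1 p.2 * (p.1 * w ^ (p.1 - 1) * conj w ^ p.2))
      (wDeriv g w) := by
    rw [show wDeriv g w = _ by rw [wDeriv, cderiv, hgD.fderiv]]
    refine hasSum_of_forall_eq h3 fun p => ?_
    rw [← cderiv_monomialDeriv]
    simp
    ring
  have hinj : Function.Injective fun p : ℕ × ℕ => (p.1 + 1, p.2) := by
    rintro ⟨a, b⟩ ⟨c, d⟩ h; simpa using h
  rw [← hinj.hasSum_iff] at h4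
  · refine hasSum_of_forall_eq h4 fun p => ?_
    simp
    ring
  · rintro ⟨n, m⟩ hn
    cases n with
    | zero => simp
    | succ n => exact absurd ⟨(n, m), rfl⟩ hn

lemma HasDoubleSeries.iterate_wDeriv_zero {a : ℕ → ℕ → ℂ} {r : ℝ} {g : ℂ → ℂ}
    (h : HasDoubleSeries a r g) (hr : 0 < r) (k : ℕ) :
    (wDeriv)^[k] g 0 = (k ! : ℂ) * a k 0 := by
  induction k generalizing a g with
  | zero =>
    have h0 := h 0 (by simpa using hr)
    have h1 := hasSum_single (f := fun p : ℕ × ℕ => a p.1 p.2 * (0 : ℂ) ^ p.1 * conj (0 : ℂ) ^ p.2)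
      (0, 0) (by
        rintro ⟨n, m⟩ hnm
        rcases Nat.eq_zero_or_pos n with rfl | hn
        · rcases Nat.eq_zero_or_pos m with rfl | hm
          · exact absurd rfl hnm
          · simp [hm.ne']
        · simp [hn.ne'])
    simpa using h0.unique h1
  | succ k ih =>
    rw [Function.iterate_succ_apply, ih (hasDoubleSeries_wDeriv h), Nat.factorial_succ]
    push_cast
    ring

/-- At the origin `(∂/∂w)^k` sees only the monomial `w^k`. Consequently the `a_{k,0}` are determined
by `g`, whichever expansion is used. -/
lemma HasDoubleSeries.coeff_taylor {a : ℕ → ℕ → ℂ} {r : ℝ} {g : ℂ → ℂ}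
    (h : HasDoubleSeries a r g) (hr : 0 < r) (k : ℕ) :
    PowerSeries.coeff k (taylor (1 / 2 : ℂ) (-(Complex.I / 2)) g) = a k 0 := by
  have : (k ! : ℂ) ≠ 0 := by exact_mod_cast k.factorial_ne_zero
  rw [AxisymMultipole.coeff_taylor, h.iterate_wDeriv_zero hr]
  field_simp

lemma HasDoubleSeries.summable_left {a : ℕ → ℕ → ℂ} {r : ℝ} {g : ℂ → ℂ}
    (h : HasDoubleSeries a r g) {w : ℂ} (hw : ‖w‖ < r) :
    Summable fun n => a n 0 * w ^ n := by
  have hi : Function.Injective fun n : ℕ => (n, 0) := fun a b h => by simpa using h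
  exact ((h w hw).summable.comp_injective hi).congr fun n => by simp

end DoubleSeries


/-! ### Independence of the conformal gauge -/

section GaugeInvariance

open PowerSeries Finset

/-- The coefficients of the transformation of the multipole recursion under a change of the
conformal gauge. -/
def gaugeCoeff : ℕ → ℕ → ℂ
  | _, 0 => 1
  | 0, _ + 1 => 0
  | n + 1, i + 1 => gaugeCoeff n (i + 1) - (2 * n + 1 / 2 - i) * gaugeCoeff n i

@[simp] lemma gaugeCoeff_zero (n : ℕ) : gaugeCoeff n 0 = 1 := by cases n <;> rfl

lemma gaugeCoeff_succ_succ (n i : ℕ) : gaugeCoeff (n + 1) (i + 1) =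
    gaugeCoeff n (i + 1) - (2 * n + 1 / 2 - i) * gaugeCoeff n i := by rw [gaugeCoeff]

lemma gaugeCoeff_eq_zero {n i : ℕ} (h : n < i) : gaugeCoeff n i = 0 := by
  induction n generalizing i with
  | zero => obtain ⟨i, rfl⟩ := Nat.exists_eq_succ_of_ne_zero h.ne'; rw [gaugeCoeff]
  | succ n ih =>
    obtain ⟨i, rfl⟩ := Nat.exists_eq_succ_of_ne_zero (Nat.ne_zero_of_lt h)
    rw [Nat.succ_eq_add_one, gaugeCoeff_succ_succ, ih (by omega), ih (by omega)]
    ring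

/-- For `i ≤ n` the coefficients are `(-1/4)^i (2n)! / ((2n - 2i)! i!)`. The identity says that the
derivative of the `(n+1)`-st transformed field in the variable `s` is a multiple of the `n`-th, with
exactly the factor of the curvature term in the recursion. -/
lemma succ_mul_gaugeCoeff (n i : ℕ) : ((i : ℂ) + 1) * gaugeCoeff (n + 1) (i + 1) =
    -((n + 1) * (2 * n + 1) / 2) * gaugeCoeff n i := by
  induction n generalizing i with
  | zero =>
    rw [gaugeCoeff_succ_succ, gaugeCoeff_eq_zero (Nat.succ_pos i)]
    cases i with
    | zero => simp
    | succ i => rw [gaugeCoeff_eq_zero (Nat.succ_pos i)]; ring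
  | succ n ih =>
    rw [gaugeCoeff_succ_succ, mul_sub, ih]
    cases i with
    | zero => simp; ring
    | succ i =>
      have h1 := gaugeCoeff_succ_succ n i
      have h2 := ih i
      push_cast
      have h3 : gaugeCoeff n (i + 1) = gaugeCoeff (n + 1) (i + 1) +
        (2 * n + 1 / 2 - i) * gaugeCoeff n i := by rw [h1]; ring
      rw [h3]
      linear_combination -(2 * n + 1 / 2 - i) * h2

variable (s : ℂ⟦X⟧) (Y : ℕ → ℂ⟦X⟧)

/-- The `n`-th transformed field. -/
def gaugeSum (n : ℕ) : ℂ⟦X⟧ := ∑ p ∈ antidiagonal n, C (gaugeCoeff n p.1) * s ^ p.1 * Y p.2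

lemma gaugeSum_deriv_aux (n : ℕ) :
    ∑ p ∈ antidiagonal (n + 1), C ((p.1 : ℂ) * gaugeCoeff (n + 1) p.1) * s ^ (p.1 - 1) * Y p.2 =
      -C (((n : ℂ) + 1) * (2 * n + 1) / 2) * gaugeSum s Y n := by
  rw [Nat.sum_antidiagonal_succ, gaugeSum, mul_sum]
  simp only [Nat.cast_zero, zero_mul, map_zero, zero_add, Nat.add_sub_cancel]
  refine sum_congr rfl fun p _ => ?_
  push_cast
  rw [succ_mul_gaugeCoeff, ← map_neg, ← mul_assoc, ← mul_assoc, ← map_mul]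

lemma gaugeSum_shift (n : ℕ) : gaugeSum s Y (n + 1) =
    ∑ p ∈ antidiagonal n, C (gaugeCoeff n p.1) * s ^ p.1 * Y (p.2 + 1)
      - C (2 * (n : ℂ) + 1 / 2) * s * gaugeSum s Y n +
      s * (s * ∑ p ∈ antidiagonal n, C ((p.1 : ℂ) * gaugeCoeff n p.1) * s ^ (p.1 - 1) * Y p.2) := by
  have h1 : ∑ p ∈ antidiagonal n, C (gaugeCoeff n p.1) * s ^ p.1 * Y (p.2 + 1) =
      Y (n + 1) + ∑ p ∈ antidiagonal n, C (gaugeCoeff n (p.1 + 1)) * s ^ (p.1 + 1) * Y p.2 := by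
    have h2 := Nat.sum_antidiagonal_succ (n := n)
      (f := fun p => C (gaugeCoeff n p.1) * s ^ p.1 * Y p.2)
    rw [Nat.sum_antidiagonal_succ', gaugeCoeff_eq_zero (Nat.lt_succ_self n)] at h2
    simpa using h2
  have h3 : s * ∑ p ∈ antidiagonal n, C ((p.1 : ℂ) * gaugeCoeff n p.1) * s ^ (p.1 - 1) * Y p.2 =
      ∑ p ∈ antidiagonal n, C ((p.1 : ℂ) * gaugeCoeff n p.1) * s ^ p.1 * Y p.2 := by
    rw [mul_sum]
    refine sum_congr rfl fun p _ => ?_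
    rcases p.1 with _ | i
    · simp
    · rw [Nat.add_sub_cancel, pow_succ]; ring
  rw [h1, h3, gaugeSum, Nat.sum_antidiagonal_succ, gaugeSum, mul_sum, mul_sum, add_sub_assoc,
    add_assoc, ← sum_sub_distrib, ← sum_add_distrib]
  congr 1
  · simp
  · refine sum_congr rfl fun p _ => ?_
    rw [gaugeCoeff_succ_succ]
    simp only [map_sub, map_add, map_mul]
    ring

lemma derivative_gaugeSum {K : ℂ⟦X⟧}
    (hY : ∀ j, d⁄dX ℂ (Y j) = Y (j + 1) + C (2 * (j : ℂ)) * K * Y j) (n : ℕ) :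
    d⁄dX ℂ (gaugeSum s Y n) =
      ∑ p ∈ antidiagonal n, C (gaugeCoeff n p.1) * s ^ p.1 * Y (p.2 + 1) +
      d⁄dX ℂ s * ∑ p ∈ antidiagonal n, C ((p.1 : ℂ) * gaugeCoeff n p.1) * s ^ (p.1 - 1) * Y p.2 +
      C (2 * (n : ℂ)) * K * gaugeSum s Y n -
      2 * K * (s * ∑ p ∈ antidiagonal n, C ((p.1 : ℂ) * gaugeCoeff n p.1) * s ^ (p.1 - 1) * Y p.2) := by
  simp only [gaugeSum, map_sum, mul_sum]
  rw [← sum_add_distrib, ← sum_add_distrib, ← sum_sub_distrib]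
  refine sum_congr rfl fun p hp => ?_
  have hn : (n : ℂ) = p.1 + p.2 := by exact_mod_cast (mem_antidiagonal.1 hp).symm
  have hs : C ((p.1 : ℂ)) * (s * s ^ (p.1 - 1)) = C ((p.1 : ℂ)) * s ^ p.1 := by
    rcases p.1 with _ | i
    · simp
    · rw [Nat.add_sub_cancel, pow_succ]; ring
  rw [Derivation.leibniz, Derivation.leibniz, hY, derivative_C, Derivation.leibniz_pow, hn]
  simp only [smul_eq_mul, nsmul_eq_mul, map_mul, map_add, map_ofNat, map_natCast] at hs ⊢
  linear_combination 2 * K * C (gaugeCoeff n p.1) * Y p.2 * hs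

/-- `Y` solves the recursion in a gauge with logarithmic derivative `K` and no curvature term, `p`
the recursion in the gauge `s + K`. Up to the scalar factor `e`, `p n` is `Y n` plus terms divisible
by `s`, so at a point where `s` vanishes only `e` distinguishes them. In the induction the terms
with `s'` from the derivative cancel against the `-s'` in `R`, by `gaugeSum_deriv_aux`. -/
theorem gauge_invariance {p : ℕ → ℂ⟦X⟧} {e K R : ℂ⟦X⟧}
    (hY : ∀ j, d⁄dX ℂ (Y j) = Y (j + 1) + C (2 * (j : ℂ)) * K * Y j)
    (he : d⁄dX ℂ e = -C (1 / 2) * s * e) (hp0 : p 0 = e * Y 0) (hp1 : p 1 = d⁄dX ℂ (p 0))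
    (hR : R = s ^ 2 + 2 * s * K - d⁄dX ℂ s)
    (hp : ∀ n : ℕ, p (n + 2) = d⁄dX ℂ (p (n + 1)) - C (2 * ((n : ℂ) + 1)) * (s + K) * p (n + 1) -
      C (((n : ℂ) + 1) * (2 * n + 1) / 2) * R * p n) (n : ℕ) :
    p n = e * gaugeSum s Y n := by
  induction n using Nat.twoStepInduction with
  | zero => simp [hp0, gaugeSum]
  | one =>
    rw [hp1, hp0, gaugeSum_shift, Derivation.leibniz, hY, he]
    simp [gaugeSum]
    ring
  | more n ih1 ih2 =>
    rw [hp, ih1, ih2, gaugeSum_shift s Y (n + 1), Derivation.leibniz, derivative_gaugeSum s Y hY,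
      he, hR, gaugeSum_deriv_aux]
    have h2 : C (1 / 2 : ℂ) + C (2 * ((n : ℂ) + 1)) = C (2 * ((n + 1 : ℕ) : ℂ) + 1 / 2) := by
      rw [← map_add]; congr 1; push_cast; ring
    have h3 : C (2 * ((n + 1 : ℕ) : ℂ)) = C (2 * ((n : ℂ) + 1)) := by push_cast; rfl
    rw [← h2, h3]
    simp only [smul_eq_mul]
    ring

end GaugeInvariance


/-! ### Power series on the real line -/

open PowerSeries

section Line

variable {F G : ℝ → ℂ}

/-- The Taylor series at the origin of a function on the real line. -/
abbrev lineTaylor (F : ℝ → ℂ) : ℂ⟦X⟧ := taylor (1 : ℝ) (0 : ℝ) F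

lemma cderiv_one_zero (F : ℝ → ℂ) : cderiv (1 : ℝ) (0 : ℝ) F = deriv F := by
  funext x
  simp [cderiv]

lemma coeff_lineTaylor (F : ℝ → ℂ) (n : ℕ) :
    coeff n (lineTaylor F) = iteratedDeriv n F 0 / (n ! : ℂ) := by
  rw [coeff_taylor, show cderiv (1 : ℝ) (0 : ℝ) = deriv from funext cderiv_one_zero,
    iteratedDeriv_eq_iterate]

lemma lineTaylor_deriv (F : ℝ → ℂ) : lineTaylor (deriv F) = d⁄dX ℂ (lineTaylor F) := by
  rw [← taylor_cderiv, cderiv_one_zero]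

lemma lineTaylor_coord : lineTaylor (fun r => (r : ℂ)) = X := by
  apply derivative.ext
  · have h : deriv (fun r : ℝ => (r : ℂ)) = fun _ => 1 := by
      funext r
      exact Complex.ofRealCLM.hasDerivAt.deriv
    rw [← lineTaylor_deriv, h, lineTaylor, taylor_const]
    simp
  · simp

lemma analyticAt_of_hasSum {a : ℕ → ℂ}
    (h : ∀ᶠ r : ℝ in 𝓝 0, HasSum (fun n => a n * (r : ℂ) ^ n) (F r)) :
    HasFPowerSeriesAt F
      (show FormalMultilinearSeries ℝ ℝ ℂ from
        fun n => ContinuousMultilinearMap.mkPiRing ℝ (Fin n) (a n)) 0 := by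
  refine hasFPowerSeriesAt_iff.mpr ?_
  filter_upwards [h] with r hr
  rw [zero_add]
  refine Eq.mp ?_ hr
  congr 1
  funext n
  rw [Complex.real_smul, mul_comm]
  push_cast
  congr 1
  simp [FormalMultilinearSeries.coeff]

lemma taylor_of_hasSum {a : ℕ → ℂ}
    (h : ∀ᶠ r : ℝ in 𝓝 0, HasSum (fun n => a n * (r : ℂ) ^ n) (F r)) :
    lineTaylor F = PowerSeries.mk a := by
  obtain ⟨r, hr⟩ := analyticAt_of_hasSum h
  ext n
  have h1 := hr.factorial_smul (1 : ℝ) n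
  rw [coeff_lineTaylor, iteratedDeriv, ← h1, coeff_mk]
  have : (n ! : ℂ) ≠ 0 := by exact_mod_cast n.factorial_ne_zero
  simp
  field_simp

lemma hasSum_lineTaylor (hF : AnalyticAt ℝ F 0) :
    ∀ᶠ r : ℝ in 𝓝 0, HasSum (fun n => coeff n (lineTaylor F) * (r : ℂ) ^ n) (F r) := by
  obtain ⟨p, hp⟩ := hF
  have h := hasFPowerSeriesAt_iff.mp hp
  have h' : ∀ᶠ r : ℝ in 𝓝 0, HasSum (fun n => p.coeff n * (r : ℂ) ^ n) (F r) := by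
    filter_upwards [h] with r hr
    rw [zero_add] at hr
    refine Eq.mp ?_ hr
    congr 1
    funext n
    rw [Complex.real_smul, mul_comm]
    push_cast
    rfl
  rw [taylor_of_hasSum h']
  simpa using h'

lemma eventuallyEq_of_lineTaylor_eq (hF : AnalyticAt ℝ F 0) (hG : AnalyticAt ℝ G 0)
    (h : lineTaylor F = lineTaylor G) : F =ᶠ[𝓝 0] G := by
  filter_upwards [hasSum_lineTaylor hF, hasSum_lineTaylor hG] with r h1 h2
  rw [h] at h1
  exact h1.unique h2

lemma exists_summable_lineTaylor (hF : AnalyticAt ℝ F 0) :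
    ∃ ρ : ℝ, 0 < ρ ∧ Summable fun n => ‖coeff n (lineTaylor F)‖ * ρ ^ n := by
  obtain ⟨ρ, h, hρ⟩ := ((hasSum_lineTaylor hF).filter_mono nhdsWithin_le_nhds |>.and
    (self_mem_nhdsWithin (s := Set.Ioi (0 : ℝ)))).exists
  refine ⟨ρ, hρ, ?_⟩
  have h2 := h.summable.norm
  simpa [abs_of_pos (show (0 : ℝ) < ρ from hρ)] using h2

lemma eventually_hasSum_of_summable {a : ℕ → ℂ} {ρ : ℝ} (hρ : 0 < ρ)
    (h : Summable fun n => ‖a n‖ * ρ ^ n) :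
    ∀ᶠ r : ℝ in 𝓝 0, HasSum (fun n => a n * (r : ℂ) ^ n) (∑' n, a n * (r : ℂ) ^ n) := by
  filter_upwards [Metric.ball_mem_nhds (0 : ℝ) hρ] with r hr
  rw [mem_ball_zero_iff, Real.norm_eq_abs] at hr
  refine (Summable.of_norm_bounded h fun n => ?_).hasSum
  rw [norm_mul, norm_pow, Complex.norm_real, Real.norm_eq_abs]
  gcongr

lemma exists_lineTaylor_eq {a : ℕ → ℂ} {ρ : ℝ} (hρ : 0 < ρ)
    (h : Summable fun n => ‖a n‖ * ρ ^ n) :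
    ∃ F : ℝ → ℂ, AnalyticAt ℝ F 0 ∧ lineTaylor F = PowerSeries.mk a :=
  ⟨_, ⟨_, analyticAt_of_hasSum (eventually_hasSum_of_summable hρ h)⟩,
    taylor_of_hasSum (eventually_hasSum_of_summable hρ h)⟩

lemma exists_primitive (hF : AnalyticAt ℝ F 0) (c : ℂ) :
    ∃ A : ℝ → ℂ, AnalyticAt ℝ A 0 ∧ A 0 = c ∧ deriv A =ᶠ[𝓝 0] F := by
  obtain ⟨ρ, hρ, hs⟩ := exists_summable_lineTaylor hF
  obtain ⟨A, hA, hAt⟩ := exists_lineTaylor_eq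
    (a := fun n => if n = 0 then c else coeff (n - 1) (lineTaylor F) / n) hρ (by
    rw [← summable_nat_add_iff 1]
    refine Summable.of_nonneg_of_le (fun n => by positivity) (fun n => ?_) (hs.mul_right ρ)
    have hn : ‖coeff n (lineTaylor F) / ((n + 1 : ℕ) : ℂ)‖ ≤ ‖coeff n (lineTaylor F)‖ := by
      rw [norm_div, Complex.norm_natCast]
      apply div_le_self (norm_nonneg _)
      push_cast
      linarith [n.cast_nonneg (α := ℝ)]
    simp only [Nat.add_eq_zero_iff, one_ne_zero, and_false, if_false, Nat.add_sub_cancel]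
    rw [pow_succ, ← mul_assoc]
    gcongr)
  refine ⟨A, hA, ?_, ?_⟩
  · have h := congrArg constantCoeff hAt
    rw [constantCoeff_taylor] at h
    simpa [← coeff_zero_eq_constantCoeff_apply] using h
  · apply eventuallyEq_of_lineTaylor_eq hA.deriv hF
    rw [lineTaylor_deriv, hAt]
    ext n
    rw [coeff_derivative, coeff_mk]
    have : (n : ℂ) + 1 ≠ 0 := by exact_mod_cast n.succ_ne_zero
    simp
    field_simp

lemma exists_eq_mul (hF : AnalyticAt ℝ F 0) (h0 : F 0 = 0) :
    ∃ A : ℝ → ℂ, AnalyticAt ℝ A 0 ∧ F =ᶠ[𝓝 0] fun r => r * A r := by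
  obtain ⟨ρ, hρ, hs⟩ := exists_summable_lineTaylor hF
  obtain ⟨A, hA, hAt⟩ := exists_lineTaylor_eq
    (a := fun n => coeff (n + 1) (lineTaylor F)) hρ (by
    have h := ((summable_nat_add_iff 1).mpr hs).mul_right ρ⁻¹
    refine h.congr fun n => ?_
    rw [pow_succ]
    field_simp)
  have hx : AnalyticAt ℝ (fun r : ℝ => (r : ℂ)) 0 := Complex.ofRealCLM.analyticAt 0
  refine ⟨A, hA, eventuallyEq_of_lineTaylor_eq hF (hx.fun_mul hA) ?_⟩
  rw [lineTaylor, lineTaylor, taylor_mul hx hA, ← lineTaylor, ← lineTaylor, ← lineTaylor,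
    lineTaylor_coord, hAt]
  ext n
  rcases n with _ | n
  · simpa using h0
  · simp [coeff_succ_X_mul]

end Line

/-! ### Real-valued analytic functions: primitives and division by powers of `r` -/

section RealLine

variable {F G : ℝ → ℝ}

lemma analyticAt_re {E : Type*} [NormedAddCommGroup E] [NormedSpace ℝ E] {F : E → ℂ} {x : E}
    (hF : AnalyticAt ℝ F x) : AnalyticAt ℝ (fun x => (F x).re) x :=
  (Complex.reCLM.analyticAt _).comp hF

lemma exists_real_primitive (hF : AnalyticAt ℝ F 0) (c : ℝ) :
    ∃ A : ℝ → ℝ, AnalyticAt ℝ A 0 ∧ A 0 = c ∧ ∀ᶠ r in 𝓝 0, HasDerivAt A (F r) r := by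
  have hF' : AnalyticAt ℝ (fun r => (F r : ℂ)) 0 := (Complex.ofRealCLM.analyticAt _).comp hF
  obtain ⟨A, hA, h0, hd⟩ := exists_primitive hF' c
  refine ⟨fun r => (A r).re, analyticAt_re hA, by simp [h0], ?_⟩
  filter_upwards [hA.eventually_analyticAt, hd] with r h1 h2
  have h3 := h1.differentiableAt.hasDerivAt
  rw [h2] at h3
  exact Complex.reCLM.hasFDerivAt.comp_hasDerivAt r h3

lemma exists_real_eq_mul (hF : AnalyticAt ℝ F 0) (h0 : F 0 = 0) :
    ∃ A : ℝ → ℝ, AnalyticAt ℝ A 0 ∧ F =ᶠ[𝓝 0] fun r => r * A r := by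
  have hF' : AnalyticAt ℝ (fun r => (F r : ℂ)) 0 := (Complex.ofRealCLM.analyticAt _).comp hF
  obtain ⟨A, hA, h1⟩ := exists_eq_mul hF' (by simp [h0])
  refine ⟨fun r => (A r).re, analyticAt_re hA, ?_⟩
  filter_upwards [h1] with r hr
  have := congrArg Complex.re hr
  simpa using this

lemma eventuallyEq_of_deriv {E : Type*} [NormedAddCommGroup E] [NormedSpace ℝ E] [CompleteSpace E]
    {F G : ℝ → E}
    (hF : AnalyticAt ℝ F 0) (hG : AnalyticAt ℝ G 0)
    (hd : deriv F =ᶠ[𝓝 0] deriv G) (h0 : F 0 = G 0) : F =ᶠ[𝓝 0] G := by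
  obtain ⟨ε, hε, h⟩ := Metric.eventually_nhds_iff_ball.mp
    (hF.eventually_analyticAt.and (hG.eventually_analyticAt.and hd))
  have hc := convex_ball (0 : ℝ) ε
  have := Metric.isOpen_ball.eqOn_of_deriv_eq hc.isPreconnected
    (fun x hx => (h x hx).1.differentiableAt.differentiableWithinAt)
    (fun x hx => (h x hx).2.1.differentiableAt.differentiableWithinAt)
    (fun x hx => (h x hx).2.2) (Metric.mem_ball_self hε) h0
  filter_upwards [Metric.ball_mem_nhds (0 : ℝ) hε] with x hx using this hx

/-- An analytic function with `J(0) = J'(0) = 0` is `r² Q'` for an analytic `Q`. -/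
lemma exists_sq_mul_deriv {J : ℝ → ℝ} (hJ : AnalyticAt ℝ J 0) (h0 : J 0 = 0) (h1 : deriv J 0 = 0)
    (c : ℝ) : ∃ Q : ℝ → ℝ, AnalyticAt ℝ Q 0 ∧ Q 0 = c ∧
      ∀ᶠ r in 𝓝 0, r ^ 2 * deriv Q r = J r := by
  obtain ⟨A, hA, hJA⟩ := exists_real_eq_mul hJ h0
  have hA0 : A 0 = 0 := by
    have h2 := (hasDerivAt_id (0 : ℝ)).mul hA.differentiableAt.hasDerivAt
    rw [hJA.deriv_eq, show (fun r => r * A r) = id * A from rfl, h2.deriv] at h1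
    simpa using h1
  obtain ⟨B, hB, hAB⟩ := exists_real_eq_mul hA hA0
  obtain ⟨Q, hQ, hQ0, hQd⟩ := exists_real_primitive hB c
  refine ⟨Q, hQ, hQ0, ?_⟩
  filter_upwards [hQd, hJA, hAB] with r h2 h3 h4
  rw [h2.deriv, h3, h4]
  ring

end RealLine

/-! ### The functions formed from the moments -/

section Moments

variable {m : ℕ → ℂ}

lemma exists_summable_moments (hm : 0 < momentRadius m) :
    ∃ ρ : ℝ, 0 < ρ ∧ Summable fun n => ‖m n / (n ! : ℂ)‖ * ρ ^ n := by
  obtain ⟨ρ, hρ0, hρ⟩ := ENNReal.lt_iff_exists_nnreal_btwn.mp hm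
  refine ⟨ρ, by simpa using hρ0, ?_⟩
  have h := (FormalMultilinearSeries.ofScalars ℂ
    (fun n => m n / (n ! : ℂ))).summable_norm_mul_pow hρ
  refine h.congr fun n => ?_
  rw [FormalMultilinearSeries.ofScalars_norm]

lemma hasSum_momentSeries (hm : 0 < momentRadius m) : ∀ᶠ r : ℝ in 𝓝 0,
    HasSum (fun n => m n / (n ! : ℂ) * (r : ℂ) ^ n) (momentSeries m r) := by
  obtain ⟨ρ, hρ, h⟩ := exists_summable_moments hm
  exact eventually_hasSum_of_summable hρ h

lemma analyticAt_momentSeries (hm : 0 < momentRadius m) : AnalyticAt ℝ (momentSeries m) 0 :=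
  ⟨_, analyticAt_of_hasSum (hasSum_momentSeries hm)⟩

lemma lineTaylor_momentSeries (hm : 0 < momentRadius m) :
    lineTaylor (momentSeries m) = PowerSeries.mk fun n => m n / (n ! : ℂ) :=
  taylor_of_hasSum (hasSum_momentSeries hm)

lemma analyticAt_norm_sq {E : Type*} [NormedAddCommGroup E] [NormedSpace ℝ E] {F : E → ℂ} {x : E}
    (hF : AnalyticAt ℝ F x) : AnalyticAt ℝ (fun x => ‖F x‖ ^ 2) x := by
  have h1 := analyticAt_re hF
  have h2 : AnalyticAt ℝ (fun x => (F x).im) x := (Complex.imCLM.analyticAt _).comp hF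
  refine ((h1.fun_pow 2).fun_add (h2.fun_pow 2)).congr (Filter.Eventually.of_forall fun y => ?_)
  simp only [Complex.sq_norm, Complex.normSq_apply]
  ring

/-- The function `2 s |y(s) + 2 s y'(s)|²`. -/
def sourceDensity (y : ℝ → ℂ) (s : ℝ) : ℝ := 2 * s * ‖y s + 2 * (s : ℂ) * deriv y s‖ ^ 2

lemma analyticAt_sourceDensity {y : ℝ → ℂ} (hy : AnalyticAt ℝ y 0) :
    AnalyticAt ℝ (sourceDensity y) 0 := by
  have hx : AnalyticAt ℝ (fun r : ℝ => (r : ℂ)) 0 := Complex.ofRealCLM.analyticAt 0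
  exact (analyticAt_const.fun_mul analyticAt_id).fun_mul (analyticAt_norm_sq
    (hy.fun_add ((analyticAt_const.fun_mul hx).fun_mul hy.deriv)))

lemma integral_eq_of_analyticAt {J k : ℝ → ℝ} (hk : AnalyticAt ℝ k 0)
    (hJ : ∀ᶠ r in 𝓝 0, HasDerivAt J (k r) r) :
    ∀ᶠ t in 𝓝 0, ∫ s in (0 : ℝ)..t, k s = J t - J 0 := by
  obtain ⟨ε, hε, h⟩ := Metric.eventually_nhds_iff_ball.mp (hk.eventually_analyticAt.and hJ)
  filter_upwards [Metric.ball_mem_nhds (0 : ℝ) hε] with t ht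
  have hsub : Set.uIcc 0 t ⊆ Metric.ball 0 ε :=
    (convex_ball (0 : ℝ) ε).ordConnected.uIcc_subset (Metric.mem_ball_self hε) ht
  refine intervalIntegral.integral_eq_sub_of_hasDerivAt (fun x hx => (h x (hsub hx)).2) ?_
  exact ContinuousOn.intervalIntegrable fun x hx =>
    (h x (hsub hx)).1.continuousAt.continuousWithinAt

/-- The inner integrand vanishes at zero, so its primitive `J` has a double zero and the factor
`t⁻²` is harmless: `𝔤` is the analytic solution of `r² Q' = J` with `Q(0) = c`. Later arguments use
only these differential relations. -/
lemma gothicG_spec (hm : 0 < momentRadius m) (c : ℝ) : ∃ J Q : ℝ → ℝ,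
    AnalyticAt ℝ J 0 ∧ J 0 = 0 ∧
    (∀ᶠ r in 𝓝 0, HasDerivAt J (sourceDensity (momentSeries m) r) r) ∧
    AnalyticAt ℝ Q 0 ∧ Q 0 = c ∧ (∀ᶠ r in 𝓝 0, r ^ 2 * deriv Q r = J r) ∧
    gothicG m c =ᶠ[𝓝 0] Q := by
  have hk := analyticAt_sourceDensity (analyticAt_momentSeries hm)
  obtain ⟨J, hJ, hJ0, hJd⟩ := exists_real_primitive hk 0
  obtain ⟨Q, hQ, hQ0, hQd⟩ := exists_sq_mul_deriv hJ hJ0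
    (by rw [hJd.self_of_nhds.deriv]; simp [sourceDensity]) c
  refine ⟨J, Q, hJ, hJ0, hJd, hQ, hQ0, hQd, ?_⟩
  have hQ' : ∀ᶠ r in 𝓝 0, HasDerivAt Q (deriv Q r) r :=
    hQ.eventually_analyticAt.mono fun r hr => hr.differentiableAt.hasDerivAt
  obtain ⟨ε, hε, h⟩ := Metric.eventually_nhds_iff_ball.mp
    ((integral_eq_of_analyticAt hk hJd).and hQd)
  filter_upwards [Metric.ball_mem_nhds (0 : ℝ) hε, integral_eq_of_analyticAt hQ.deriv hQ']
    with t ht h2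
  have hsub : Set.uIoc 0 t ⊆ Metric.ball 0 ε := Set.uIoc_subset_uIcc.trans <|
    (convex_ball (0 : ℝ) ε).ordConnected.uIcc_subset (Metric.mem_ball_self hε) ht
  have h3 : (∫ t in (0 : ℝ)..t, 1 / t ^ 2 * ∫ s in (0 : ℝ)..t,
      2 * s * ‖momentSeries m s + 2 * (s : ℂ) * deriv (momentSeries m) s‖ ^ 2) =
      ∫ t in (0 : ℝ)..t, deriv Q t := by
    apply intervalIntegral.integral_congr_ae
    -- At `t = 0` the formal value of `1 / t ^ 2` is `0`, which need not match `Q'(0)`; a single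
    -- point does not affect the integral.
    filter_upwards [MeasureTheory.compl_mem_ae_iff.mpr (MeasureTheory.measure_singleton (0 : ℝ))]
      with x hx hxt
    have hx0 : x ≠ 0 := hx
    obtain ⟨h4, h5⟩ := h x (hsub hxt)
    rw [hJ0, sub_zero] at h4
    change 1 / x ^ 2 * (∫ s in (0 : ℝ)..x, sourceDensity (momentSeries m) s) = _
    rw [h4, ← h5]
    field_simp
  rw [gothicG, h3, h2, hQ0]
  ring

end Moments

/-! ### The adapted gauge of a function on the line -/

section Adapted

/-- The gauge in which the potential with leading order part `F` has the moments
`iteratedDeriv n y 0`: `b` is the leading order part of the function `β` in the metric, `K` that of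
the logarithm of the conformal factor, and `ρ₁` is the coordinate with `ρ₁' = e^{2K}`. -/
structure IsAdaptedGauge (F : ℝ → ℂ) (c : ℝ) (b g K ρ₁ : ℝ → ℝ) (y : ℝ → ℂ) : Prop where
  analytic_b : AnalyticAt ℝ b 0
  b_zero : b 0 = 0
  deriv_b : ∀ᶠ r in 𝓝 0, HasDerivAt b (r * ‖F r + 2 * (r : ℂ) * deriv F r‖ ^ 2) r
  analytic_g : AnalyticAt ℝ g 0
  g_zero : g 0 = c
  deriv_g : ∀ᶠ r in 𝓝 0, r ^ 2 * deriv g r = Real.exp (2 * b r) - 1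
  analytic_K : AnalyticAt ℝ K 0
  K_zero : K 0 = 0
  deriv_K_zero : deriv K 0 = c
  exp_eq : ∀ᶠ r in 𝓝 0, Real.exp (b r - K r) = 1 - r * g r
  deriv_K : ∀ᶠ r in 𝓝 0, r * deriv K r = r * deriv b r - 1 + Real.exp (b r + K r)
  analytic_ρ : AnalyticAt ℝ ρ₁ 0
  ρ_zero : ρ₁ 0 = 0
  ρ_eq : ∀ᶠ r in 𝓝 0, ρ₁ r = r * Real.exp (K r - b r)
  deriv_ρ : ∀ᶠ r in 𝓝 0, HasDerivAt ρ₁ (Real.exp (2 * K r)) r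
  analytic_y : AnalyticAt ℝ y 0
  y_eq : ∀ᶠ r in 𝓝 0, y (ρ₁ r) = Complex.exp (((b r - K r) / 2 : ℝ)) * F r

variable {F : ℝ → ℂ} {c : ℝ} {b g K ρ₁ : ℝ → ℝ} {y : ℝ → ℂ}

lemma eventually_hasDerivAt {E : Type*} [NormedAddCommGroup E] [NormedSpace ℝ E] [CompleteSpace E]
    {F : ℝ → E} (hF : AnalyticAt ℝ F 0) : ∀ᶠ r in 𝓝 0, HasDerivAt F (deriv F r) r :=
  hF.eventually_analyticAt.mono fun _ h => h.differentiableAt.hasDerivAt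

/-- Vanishing of the null Ricci component is a second-order equation for `K`. A family of solutions
satisfies the first-order equation `r K' = r b' - 1 + e^{b+K}`, which is linear in `q = e^{b-K}`: `r
q' = q - e^{2b}`. With `q = 1 - r g` it becomes `r² g' = e^{2b} - 1`, solvable because `b(0) = b'(0)
= 0`, and the free constant `g(0)` equals `K'(0)`. Moreover `ρ₁ = r / q` has derivative `(q - r q')
/ q² = e^{2b} / q² = e^{2K}`. -/
lemma exists_isAdaptedGauge (hF : AnalyticAt ℝ F 0) (c : ℝ) :
    ∃ b g K ρ₁ y, IsAdaptedGauge F c b g K ρ₁ y := by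
  have hx : AnalyticAt ℝ (fun r : ℝ => (r : ℂ)) 0 := Complex.ofRealCLM.analyticAt 0
  have hk : AnalyticAt ℝ (fun r : ℝ => r * ‖F r + 2 * (r : ℂ) * deriv F r‖ ^ 2) 0 :=
    analyticAt_id.fun_mul (analyticAt_norm_sq
      (hF.fun_add ((analyticAt_const.fun_mul hx).fun_mul hF.deriv)))
  obtain ⟨b, hb, hb0, hbd⟩ := exists_real_primitive hk 0
  have hbd0 : deriv b 0 = 0 := by rw [hbd.self_of_nhds.deriv]; simp
  have hE : AnalyticAt ℝ (fun r => Real.exp (2 * b r) - 1) 0 :=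
    ((analyticAt_const.fun_mul hb).rexp).fun_sub analyticAt_const
  obtain ⟨g, hg, hg0, hgd⟩ := exists_sq_mul_deriv hE (by simp [hb0])
    (by
      have := (((hb.differentiableAt.hasDerivAt).const_mul 2).exp.sub_const 1).deriv
      rw [this, hbd0]
      simp) c
  have hq : AnalyticAt ℝ (fun r => 1 - r * g r) 0 :=
    analyticAt_const.fun_sub (analyticAt_id.fun_mul hg)
  have hqpos : ∀ᶠ r in 𝓝 0, 0 < 1 - r * g r := by
    have := hq.continuousAt
    exact this.eventually_const_lt (by simp)
  set K : ℝ → ℝ := fun r => b r - Real.log (1 - r * g r) with hK_def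
  have hK : AnalyticAt ℝ K 0 := hb.fun_sub (hq.log (by simp))
  have hqd : ∀ᶠ r in 𝓝 0, HasDerivAt (fun r => 1 - r * g r) (-(g r + r * deriv g r)) r := by
    filter_upwards [eventually_hasDerivAt hg] with r h
    have := ((hasDerivAt_id r).mul h).const_sub 1
    simpa using this
  have hKd : ∀ᶠ r in 𝓝 0,
      HasDerivAt K (deriv b r - (-(g r + r * deriv g r)) / (1 - r * g r)) r := by
    filter_upwards [eventually_hasDerivAt hb, hqd, hqpos] with r h1 h2 h3
    exact h1.sub (h2.log h3.ne')
  have hexp : ∀ᶠ r in 𝓝 0, Real.exp (b r - K r) = 1 - r * g r := by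
    filter_upwards [hqpos] with r h
    simp [hK_def, Real.exp_log h]
  set ρ₁ : ℝ → ℝ := fun r => r / (1 - r * g r) with hρ_def
  have hρ : AnalyticAt ℝ ρ₁ 0 := analyticAt_id.fun_div hq (by simp)
  have hρe : ∀ᶠ r in 𝓝 0, ρ₁ r = r * Real.exp (K r - b r) := by
    filter_upwards [hexp] with r h
    rw [hρ_def, ← neg_sub, Real.exp_neg, h]
    rfl
  have hρd : ∀ᶠ r in 𝓝 0, HasDerivAt ρ₁ (Real.exp (2 * K r)) r := by
    filter_upwards [hqd, hqpos, hgd, hexp] with r h1 h2 h3 h4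
    have h5 := (hasDerivAt_id r).div h1 h2.ne'
    refine h5.congr_deriv ?_
    have h6 : Real.exp (2 * K r) = Real.exp (2 * b r) / Real.exp (b r - K r) ^ 2 := by
      rw [← Real.exp_nat_mul, ← Real.exp_sub]
      congr 1
      push_cast
      ring
    rw [h6, h4]
    congr 1
    simp only [id]
    linear_combination h3
  have hρ0 : ρ₁ 0 = 0 := by simp [hρ_def]
  have hK0 : K 0 = 0 := by simp [hK_def, hb0]
  have hne : deriv ρ₁ 0 ≠ 0 := by
    rw [hρd.self_of_nhds.deriv]
    exact (Real.exp_pos _).ne'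
  -- `y` is prescribed only along `ρ₁`, so it is defined through the local inverse of `ρ₁`.
  set σ := hρ.hasStrictDerivAt.localInverse _ _ _ hne with hσ_def
  have hσ : AnalyticAt ℝ σ (ρ₁ 0) := hρ.analyticAt_localInverse hne
  have hleft : ∀ᶠ r in 𝓝 0, σ (ρ₁ r) = r :=
    HasStrictDerivAt.eventually_left_inverse hρ.hasStrictDerivAt hne
  have hσ0 : σ (ρ₁ 0) = 0 := hleft.self_of_nhds
  have hy1 : AnalyticAt ℝ (fun r => Complex.exp (((b r - K r) / 2 : ℝ)) * F r) (σ (ρ₁ 0)) := by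
    rw [hσ0]
    refine AnalyticAt.fun_mul ?_ hF
    have h1 : AnalyticAt ℝ (fun r => (((b r - K r) / 2 : ℝ) : ℂ)) 0 :=
      (Complex.ofRealCLM.analyticAt _).comp ((hb.fun_sub hK).fun_div analyticAt_const (by simp))
    exact (analyticAt_cexp.restrictScalars (𝕜 := ℝ)).comp h1
  have hy := hy1.comp hσ
  rw [hρ0] at hy
  refine ⟨b, g, K, ρ₁, _, hb, hb0, hbd, hg, hg0, hgd, hK, hK0, ?_, hexp, ?_, hρ, hρ0, hρe, hρd,
    hy, ?_⟩
  · rw [hKd.self_of_nhds.deriv, hbd0, hg0]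
    simp
  · filter_upwards [hKd, hqpos, hgd, hexp] with r h1 h2 h3 h4
    have h6 : Real.exp (b r + K r) = Real.exp (2 * b r) / Real.exp (b r - K r) := by
      rw [← Real.exp_sub]
      congr 1
      ring
    rw [h1.deriv, h6, h4]
    field_simp
    linear_combination h3
  · filter_upwards [hleft] with r h
    simp only [Function.comp, h]

namespace IsAdaptedGauge

variable (h : IsAdaptedGauge F c b g K ρ₁ y)
include h

/-- Differentiating the first-order equation for `K` and eliminating `e^{b+K}` with it gives the
vanishing of the curvature term `R` in the gauge `K`. -/
lemma second_order : ∀ᶠ r in 𝓝 0, r * (deriv (deriv b) r - deriv b r ^ 2) + 2 * deriv b r =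
    r * (deriv (deriv K) r - deriv K r ^ 2) := by
  filter_upwards [h.deriv_K.eventually_nhds, eventually_hasDerivAt h.analytic_b,
    eventually_hasDerivAt h.analytic_K, eventually_hasDerivAt h.analytic_b.deriv,
    eventually_hasDerivAt h.analytic_K.deriv] with r h0 hb hK hb' hK'
  have h1 := (hasDerivAt_id r).mul hK'
  have h2 := (((hasDerivAt_id r).mul hb').sub_const 1).add (hb.add hK).exp
  have h3 := (h1.congr_of_eventuallyEq (f₁ := fun r => r * deriv b r - 1 + Real.exp (b r + K r))
    (h0.mono fun x hx => hx.symm)).unique h2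
  have h4 := h0.self_of_nhds
  simp only [id, Pi.add_apply] at h3
  linear_combination -h3 + (deriv b r + deriv K r) * h4

lemma tendsto_ρ : Filter.Tendsto ρ₁ (𝓝 0) (𝓝 0) := by
  have := h.analytic_ρ.continuousAt.tendsto
  rwa [h.ρ_zero] at this

/-- The expression `F + 2r F'` in the field equation keeps its form under the change from `(r, F)`
to `(ρ₁, y)`; the exponential weight is what makes the source in `𝔤` an exact derivative. -/
lemma leadingMoment_eq (hF : AnalyticAt ℝ F 0) : ∀ᶠ r in 𝓝 0,
    y (ρ₁ r) + 2 * (ρ₁ r : ℂ) * deriv y (ρ₁ r) =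
      Complex.exp ((-(b r + 3 * K r) / 2 : ℝ)) * (F r + 2 * (r : ℂ) * deriv F r) := by
  filter_upwards [eventually_hasDerivAt hF, h.y_eq.eventually_nhds, eventually_hasDerivAt h.analytic_b,
    eventually_hasDerivAt h.analytic_K, h.deriv_ρ, h.deriv_K, h.ρ_eq,
    h.tendsto_ρ.eventually (eventually_hasDerivAt h.analytic_y)]
    with r hF h0 hb hK hρ hK' hρe hy
  have h1 := hy.scomp r hρ
  have h2 := (((hb.sub hK).div_const 2).ofReal_comp.cexp).mul hF
  have h3 := (h1.congr_of_eventuallyEq (h0.mono fun x hx => hx.symm)).unique h2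
  rw [h0.self_of_nhds, hρe]
  -- In terms of `u = e^{b/2}` and `v = e^{K/2}` all exponentials are Laurent monomials, and the
  -- claim is rational algebra.
  obtain ⟨u, hu⟩ : ∃ u, u = Complex.exp (b r / 2) := ⟨_, rfl⟩
  obtain ⟨v, hv⟩ : ∃ v, v = Complex.exp (K r / 2) := ⟨_, rfl⟩
  have hu0 : u ≠ 0 := hu ▸ Complex.exp_ne_zero _
  have hv0 : v ≠ 0 := hv ▸ Complex.exp_ne_zero _
  have e1 : Complex.exp (((b r - K r) / 2 : ℝ)) = u / v := by
    rw [hu, hv, ← Complex.exp_sub]; congr 1; push_cast; ring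
  have e2 : (Real.exp (2 * K r) : ℂ) = v ^ 4 := by
    rw [hv, ← Complex.exp_nat_mul, Complex.ofReal_exp]; congr 1; push_cast; ring
  have e3 : (Real.exp (K r - b r) : ℂ) = v ^ 2 / u ^ 2 := by
    rw [hu, hv, ← Complex.exp_nat_mul, ← Complex.exp_nat_mul, ← Complex.exp_sub,
      Complex.ofReal_exp]
    congr 1; push_cast; ring
  have e4 : (Real.exp (b r + K r) : ℂ) = u ^ 2 * v ^ 2 := by
    rw [hu, hv, ← Complex.exp_nat_mul, ← Complex.exp_nat_mul, ← Complex.exp_add,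
      Complex.ofReal_exp]
    congr 1; push_cast; ring
  have e5 : Complex.exp ((-(b r + 3 * K r) / 2 : ℝ)) = 1 / (u * v ^ 3) := by
    rw [hu, hv, ← Complex.exp_nat_mul, ← Complex.exp_add, one_div, ← Complex.exp_neg]
    congr 1; push_cast; ring
  have h4 := congrArg (fun x : ℝ => (x : ℂ)) hK'
  simp only [Complex.ofReal_add, Complex.ofReal_sub, Complex.ofReal_mul, Complex.ofReal_one, e4]
    at h4
  rw [Complex.real_smul, e2, hρe] at h3
  simp only [Pi.sub_apply, e1] at h3
  rw [e1, Complex.ofReal_mul, e3, e5]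
  have h5 : ∀ B : ℂ, v ^ 4 * B = u / v * ((deriv b r - deriv K r) / 2 : ℝ) * F r +
      u / v * deriv F r → u / v * F r + 2 * (r * (v ^ 2 / u ^ 2)) * B =
      1 / (u * v ^ 3) * (F r + 2 * r * deriv F r) := by
    intro B hB
    have hB' : B = (u / v * ((deriv b r - deriv K r) / 2 : ℝ) * F r +
      u / v * deriv F r) / v ^ 4 := by
      rw [← hB]; field_simp
    rw [hB']
    push_cast
    field_simp
    linear_combination -(F r) * h4
  exact_mod_cast h5 _ h3

lemma eventuallyEq_of_ρ {J f k : ℝ → ℝ} (hJ : AnalyticAt ℝ J 0) (hf : AnalyticAt ℝ f 0)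
    (h0 : J 0 = f 0) (hk : ∀ᶠ r in 𝓝 0, HasDerivAt J (k r) r)
    (hd : ∀ᶠ r in 𝓝 0, k (ρ₁ r) * Real.exp (2 * K r) = deriv f r) :
    ∀ᶠ r in 𝓝 0, J (ρ₁ r) = f r := by
  have hJ' : AnalyticAt ℝ (fun r => J (ρ₁ r)) 0 :=
    AnalyticAt.comp (g := J) (by rwa [h.ρ_zero]) h.analytic_ρ
  refine eventuallyEq_of_deriv hJ' hf ?_ (by simp only [h.ρ_zero, h0])
  filter_upwards [h.tendsto_ρ.eventually hk, h.deriv_ρ, hd] with r h1 h2 h3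
  rw [← h3]
  exact (h1.comp r h2).deriv

lemma exp_eq_ρ_sq : ∀ᶠ r in 𝓝 0,
    ρ₁ r ^ 2 * Real.exp (2 * b r) = r ^ 2 * Real.exp (2 * K r) := by
  filter_upwards [h.ρ_eq] with r hr
  rw [hr, mul_pow, ← Real.exp_nat_mul, mul_assoc, ← Real.exp_add]
  congr 2
  push_cast
  ring

variable {J Q : ℝ → ℝ}

/-- In the variable `r` the density becomes `2 r e^{-2b} |F + 2r F'|² = 2 b' e^{-2b}`, the
derivative of `1 - e^{-2b}`. -/
lemma source_eq (hF : AnalyticAt ℝ F 0) (hJ : AnalyticAt ℝ J 0) (hJ0 : J 0 = 0)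
    (hJd : ∀ᶠ r in 𝓝 0, HasDerivAt J (sourceDensity y r) r) :
    ∀ᶠ r in 𝓝 0, J (ρ₁ r) = 1 - Real.exp (-2 * b r) := by
  refine h.eventuallyEq_of_ρ hJ (f := fun r => 1 - Real.exp (-2 * b r))
    (analyticAt_const.fun_sub (analyticAt_const.fun_mul h.analytic_b).rexp)
    (by simp [h.b_zero, hJ0]) hJd ?_
  filter_upwards [h.leadingMoment_eq hF, h.deriv_b, h.ρ_eq] with r h1 h2 h3
  rw [sourceDensity, h1, ((h2.const_mul (-2)).exp.const_sub 1).deriv, h3, norm_mul,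
    Complex.norm_exp, Complex.ofReal_re, mul_pow, ← Real.exp_nat_mul]
  have e : Real.exp (K r - b r) * Real.exp (((2 : ℕ) : ℝ) * (-(b r + 3 * K r) / 2)) *
      Real.exp (2 * K r) = Real.exp (-2 * b r) := by
    rw [← Real.exp_add, ← Real.exp_add]
    congr 1
    push_cast
    ring
  rw [← e]
  ring

/-- By the chain rule `Q(ρ₁)` has derivative `(1 - e^{-2b}) e^{2K} / ρ₁²`. Since `ρ₁² = r² e^{2K -
2b}`, this is `(e^{2b} - 1) / r² = g'`. -/
lemma primitive_eq (hJ : ∀ᶠ r in 𝓝 0, J (ρ₁ r) = 1 - Real.exp (-2 * b r))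
    (hQ : AnalyticAt ℝ Q 0) (hQ0 : Q 0 = c) (hQd : ∀ᶠ r in 𝓝 0, r ^ 2 * deriv Q r = J r) :
    ∀ᶠ r in 𝓝 0, Q (ρ₁ r) = g r := by
  refine h.eventuallyEq_of_ρ hQ h.analytic_g (by rw [hQ0, h.g_zero])
    (eventually_hasDerivAt hQ) ?_
  -- The derivatives are compared after multiplication by `r²`, which decides nothing at `r = 0`;
  -- continuity supplies that point.
  have hc : ContinuousAt (fun r => deriv Q (ρ₁ r) * Real.exp (2 * K r)) 0 := by
    refine ContinuousAt.mul ?_ (continuousAt_const.mul h.analytic_K.continuousAt).rexp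
    exact ContinuousAt.comp (g := deriv Q) (by rw [h.ρ_zero]; exact hQ.deriv.continuousAt)
      h.analytic_ρ.continuousAt
  refine (hc.eventuallyEq_nhds_iff_eventuallyEq_nhdsNE h.analytic_g.deriv.continuousAt).mp ?_
  filter_upwards [hJ.filter_mono nhdsWithin_le_nhds, h.deriv_g.filter_mono nhdsWithin_le_nhds,
    h.exp_eq_ρ_sq.filter_mono nhdsWithin_le_nhds,
    (h.tendsto_ρ.eventually hQd).filter_mono nhdsWithin_le_nhds, self_mem_nhdsWithin]
    with r h1 h2 h3 h4 h5
  have hr : r ≠ 0 := h5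
  apply mul_left_cancel₀ (pow_ne_zero 2 hr)
  have e : Real.exp (-2 * b r) * Real.exp (2 * b r) = 1 := by
    rw [← Real.exp_add]
    simp
  linear_combination -deriv Q (ρ₁ r) * h3 + Real.exp (2 * b r) * (h4 + h1) - e - h2

/-- The functions formed from the moments, in terms of the adapted gauge. -/
lemma functions_of_moments {m : ℕ → ℂ} (hm : 0 < momentRadius m) (hF : AnalyticAt ℝ F 0)
    (hy : y =ᶠ[𝓝 0] momentSeries m) :
    (∀ᶠ r in 𝓝 0, rOfRho m c (ρ₁ r) = r) ∧
    ∀ᶠ r in 𝓝 0, F r =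
      (√(1 + ρ₁ r * gothicG m c (ρ₁ r)) : ℂ) * momentSeries m (ρ₁ r) := by
  obtain ⟨J, Q, hJ, hJ0, hJd, hQ, hQ0, hQd, hG⟩ := gothicG_spec hm c
  have hJd' : ∀ᶠ r in 𝓝 0, HasDerivAt J (sourceDensity y r) r := by
    filter_upwards [hJd, hy, hy.deriv] with r h1 h2 h3
    rwa [sourceDensity, h2, h3]
  have hg : ∀ᶠ r in 𝓝 0, gothicG m c (ρ₁ r) = g r := by
    filter_upwards [h.primitive_eq (h.source_eq hF hJ hJ0 hJd') hQ hQ0 hQd,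
      h.tendsto_ρ.eventually hG] with r h1 h2
    rw [h2, h1]
  -- With `ρ₁ = r / (1 - r g)` and `𝔤(ρ₁) = g`, both sides are `1 / (1 - r g)`.
  have hexp : ∀ᶠ r in 𝓝 0, 1 + ρ₁ r * gothicG m c (ρ₁ r) = Real.exp (K r - b r) := by
    filter_upwards [hg, h.exp_eq, h.ρ_eq] with r h1 h2 h3
    have e : Real.exp (b r - K r) * Real.exp (K r - b r) = 1 := by
      rw [← Real.exp_add]
      simp
    rw [h1, h3]
    linear_combination Real.exp (K r - b r) * h2 - e
  constructor
  · filter_upwards [hexp, h.ρ_eq] with r h1 h2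
    rw [rOfRho, h1, h2, mul_div_assoc, div_self (Real.exp_pos _).ne', mul_one]
  · filter_upwards [hexp, h.y_eq, h.tendsto_ρ.eventually hy] with r h1 h2 h3
    rw [← h3, h2, h1, ← Real.exp_half, Complex.ofReal_exp, ← mul_assoc, ← Complex.exp_add,
      ← Complex.ofReal_add]
    have e : (K r - b r) / 2 + (b r - K r) / 2 = 0 := by ring
    rw [e]
    simp

end IsAdaptedGauge

end Adapted

/-! ### Taylor series in the adapted gauge -/

section AdaptedSeries

lemma deriv_ofReal {b : ℝ → ℝ} {r : ℝ} (hb : DifferentiableAt ℝ b r) :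
    deriv (fun r => (b r : ℂ)) r = ((deriv b r : ℝ) : ℂ) :=
  hb.hasDerivAt.ofReal_comp.deriv

/-- The Taylor series of a real function on the line, with complex coefficients. -/
abbrev realTaylor (b : ℝ → ℝ) : ℂ⟦X⟧ := lineTaylor fun r => (b r : ℂ)

lemma realTaylor_deriv {b : ℝ → ℝ} (hb : AnalyticAt ℝ b 0) :
    realTaylor (deriv b) = d⁄dX ℂ (realTaylor b) := by
  rw [← lineTaylor_deriv]
  exact taylor_congr (hb.eventually_analyticAt.mono fun r hr =>
    (deriv_ofReal hr.differentiableAt).symm)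

lemma iteratedDeriv_conj {F : ℝ → ℂ} (hF : AnalyticAt ℝ F 0) (n : ℕ) :
    iteratedDeriv n (fun r => conj (F r)) =ᶠ[𝓝 0] fun r => conj (iteratedDeriv n F r) := by
  induction n with
  | zero => simp
  | succ n ih =>
    filter_upwards [ih.eventually_nhds, (hF.iterated_deriv n).eventually_analyticAt] with r h1 h2
    rw [iteratedDeriv_succ, Filter.EventuallyEq.deriv_eq h1, iteratedDeriv_succ]
    rw [← iteratedDeriv_eq_iterate] at h2
    exact ((Complex.conjCLE : ℂ →L[ℝ] ℂ).hasFDerivAt.comp_hasDerivAt r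
      h2.differentiableAt.hasDerivAt).deriv

lemma coeff_lineTaylor_conj {F : ℝ → ℂ} (hF : AnalyticAt ℝ F 0) (n : ℕ) :
    coeff n (lineTaylor fun r => conj (F r)) = conj (coeff n (lineTaylor F)) := by
  rw [coeff_lineTaylor, coeff_lineTaylor, (iteratedDeriv_conj hF n).self_of_nhds, map_div₀,
    Complex.conj_natCast]

variable {F : ℝ → ℂ} {c : ℝ} {b g K ρ₁ : ℝ → ℝ} {y : ℝ → ℂ}

namespace IsAdaptedGauge

variable (h : IsAdaptedGauge F c b g K ρ₁ y)
include h

lemma series_second_order :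
    X * (d⁄dX ℂ (d⁄dX ℂ (realTaylor b)) - d⁄dX ℂ (realTaylor b) ^ 2) +
      2 * d⁄dX ℂ (realTaylor b) =
    X * (d⁄dX ℂ (d⁄dX ℂ (realTaylor K)) - d⁄dX ℂ (realTaylor K) ^ 2) := by
  have hb := h.analytic_b
  have hK := h.analytic_K
  have hx : AnalyticAt ℝ (fun r : ℝ => (r : ℂ)) 0 := Complex.ofRealCLM.analyticAt 0
  have hb1 := analyticAt_ofReal hb.deriv
  have hb2 := analyticAt_ofReal hb.deriv.deriv
  have hK1 := analyticAt_ofReal hK.deriv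
  have hK2 := analyticAt_ofReal hK.deriv.deriv
  have h1 : (fun r : ℝ => (r : ℂ) * (((deriv (deriv b) r : ℝ) : ℂ) - ((deriv b r : ℝ) : ℂ) ^ 2) +
      2 * ((deriv b r : ℝ) : ℂ)) =ᶠ[𝓝 0]
      fun r : ℝ => (r : ℂ) * (((deriv (deriv K) r : ℝ) : ℂ) - ((deriv K r : ℝ) : ℂ) ^ 2) := by
    filter_upwards [h.second_order] with r hr
    exact_mod_cast hr
  have h2 := taylor_congr (v₁ := (1 : ℝ)) (v₂ := (0 : ℝ)) h1
  rw [taylor_add (hx.fun_mul (hb2.fun_sub (hb1.fun_pow 2))) (analyticAt_const.fun_mul hb1),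
    taylor_mul hx (hb2.fun_sub (hb1.fun_pow 2)), taylor_mul analyticAt_const hb1,
    taylor_mul hx (hK2.fun_sub (hK1.fun_pow 2)), taylor_sub hb2 (hb1.fun_pow 2),
    taylor_sub hK2 (hK1.fun_pow 2), taylor_pow hb1, taylor_pow hK1, taylor_const] at h2
  change lineTaylor _ * (realTaylor (deriv (deriv b)) - realTaylor (deriv b) ^ 2) +
    _ * realTaylor (deriv b) = lineTaylor _ * (realTaylor (deriv (deriv K)) -
    realTaylor (deriv K) ^ 2) at h2
  rw [lineTaylor_coord, realTaylor_deriv hb.deriv, realTaylor_deriv hb, realTaylor_deriv hK.deriv,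
    realTaylor_deriv hK,
    map_ofNat] at h2
  exact h2

lemma series_deriv_b (hF : AnalyticAt ℝ F 0) : d⁄dX ℂ (realTaylor b) =
    X * (lineTaylor F + 2 * X * d⁄dX ℂ (lineTaylor F)) *
      (lineTaylor (fun r => conj (F r)) + 2 * X * d⁄dX ℂ (lineTaylor fun r => conj (F r))) := by
  have hx : AnalyticAt ℝ (fun r : ℝ => (r : ℂ)) 0 := Complex.ofRealCLM.analyticAt 0
  have hF' := analyticAt_conj hF
  have h1 : (fun r : ℝ => ((deriv b r : ℝ) : ℂ)) =ᶠ[𝓝 0] fun r : ℝ => (r : ℂ) *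
      (F r + 2 * (r : ℂ) * deriv F r) *
      (conj (F r) + 2 * (r : ℂ) * deriv (fun r => conj (F r)) r) := by
    have hd := iteratedDeriv_conj hF 1
    simp only [iteratedDeriv_one] at hd
    filter_upwards [h.deriv_b, hd] with r h2 h3
    rw [h2.deriv, h3, mul_assoc (r : ℂ)]
    have := Complex.mul_conj (F r + 2 * (r : ℂ) * deriv F r)
    rw [Complex.normSq_eq_norm_sq] at this
    push_cast at this ⊢
    rw [← this]
    simp [Complex.conj_ofNat]
  rw [← realTaylor_deriv h.analytic_b, realTaylor, lineTaylor, taylor_congr h1]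
  have h2 : ∀ {G : ℝ → ℂ}, AnalyticAt ℝ G 0 →
      AnalyticAt ℝ (fun r : ℝ => G r + 2 * (r : ℂ) * deriv G r) 0 ∧
      taylor (1 : ℝ) (0 : ℝ) (fun r : ℝ => G r + 2 * (r : ℂ) * deriv G r) =
        lineTaylor G + 2 * X * d⁄dX ℂ (lineTaylor G) := by
    intro G hG
    have h3 : AnalyticAt ℝ (fun r : ℝ => 2 * (r : ℂ)) 0 := analyticAt_const.fun_mul hx
    refine ⟨hG.fun_add (h3.fun_mul hG.deriv), ?_⟩
    rw [taylor_add hG (h3.fun_mul hG.deriv), taylor_mul h3 hG.deriv,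
      taylor_mul analyticAt_const hx, taylor_const, ← lineTaylor, ← lineTaylor, ← lineTaylor,
      lineTaylor_coord, lineTaylor_deriv, map_ofNat]
  rw [taylor_mul (hx.fun_mul (h2 hF).1) (h2 hF').1, taylor_mul hx (h2 hF).1, (h2 hF).2, (h2 hF').2,
    ← lineTaylor, lineTaylor_coord]

end IsAdaptedGauge

/-- The potentials of the moment recursion in the adapted gauge. -/
def adaptedPotential (y : ℝ → ℂ) (K ρ₁ : ℝ → ℝ) (n : ℕ) (r : ℝ) : ℂ :=
  iteratedDeriv n y (ρ₁ r) * Complex.exp (2 * n * K r)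

namespace IsAdaptedGauge

variable (h : IsAdaptedGauge F c b g K ρ₁ y)
include h

lemma analyticAt_iteratedDeriv (n : ℕ) : AnalyticAt ℝ (iteratedDeriv n y) 0 := by
  rw [iteratedDeriv_eq_iterate]
  exact h.analytic_y.iterated_deriv n

lemma analyticAt_adaptedPotential (n : ℕ) : AnalyticAt ℝ (adaptedPotential y K ρ₁ n) 0 := by
  refine AnalyticAt.fun_mul ?_ ((analyticAt_cexp.restrictScalars (𝕜 := ℝ)).comp
    (analyticAt_const.fun_mul (analyticAt_ofReal h.analytic_K)))
  exact AnalyticAt.comp (g := iteratedDeriv n y)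
    (by rw [h.ρ_zero]; exact h.analyticAt_iteratedDeriv n) h.analytic_ρ

/-- The moment recursion with its curvature term gone; `ρ₁' = e^{2K}` accounts for the extra factor
in the next potential. -/
lemma series_deriv_potential (n : ℕ) :
    d⁄dX ℂ (lineTaylor (adaptedPotential y K ρ₁ n)) =
      lineTaylor (adaptedPotential y K ρ₁ (n + 1)) +
        C (2 * (n : ℂ)) * d⁄dX ℂ (realTaylor K) * lineTaylor (adaptedPotential y K ρ₁ n) := by
  have hn := h.analyticAt_adaptedPotential n
  have hK := analyticAt_ofReal h.analytic_K.deriv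
  have h1 : deriv (adaptedPotential y K ρ₁ n) =ᶠ[𝓝 0] fun r : ℝ =>
      adaptedPotential y K ρ₁ (n + 1) r +
        2 * (n : ℂ) * ((deriv K r : ℝ) : ℂ) * adaptedPotential y K ρ₁ n r := by
    filter_upwards [h.tendsto_ρ.eventually (eventually_hasDerivAt (h.analyticAt_iteratedDeriv n)),
      h.deriv_ρ, eventually_hasDerivAt h.analytic_K] with r h2 h3 h4
    have h5 := (h2.scomp r h3).mul ((h4.ofReal_comp.const_mul (2 * (n : ℂ))).cexp)
    refine h5.deriv.trans ?_
    rw [adaptedPotential, adaptedPotential, iteratedDeriv_succ]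
    have e : Complex.exp (2 * ((n + 1 : ℕ) : ℂ) * K r) =
        Complex.exp (2 * K r) * Complex.exp (2 * n * K r) := by
      rw [← Complex.exp_add]
      congr 1
      push_cast
      ring
    rw [e, Complex.real_smul, Complex.ofReal_exp]
    simp only [Function.comp]
    push_cast
    ring
  rw [← lineTaylor_deriv, lineTaylor, taylor_congr h1,
    taylor_add (h.analyticAt_adaptedPotential (n + 1))
      ((analyticAt_const.fun_mul hK).fun_mul hn),
    taylor_mul (analyticAt_const.fun_mul hK) hn, taylor_mul analyticAt_const hK, taylor_const,
    ← realTaylor_deriv h.analytic_K]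

lemma constantCoeff_potential (n : ℕ) :
    constantCoeff (lineTaylor (adaptedPotential y K ρ₁ n)) = iteratedDeriv n y 0 := by
  simp [adaptedPotential, h.ρ_zero, h.K_zero]

lemma series_potential_zero (hF : AnalyticAt ℝ F 0) :
    lineTaylor (adaptedPotential y K ρ₁ 0) =
      lineTaylor (fun r => Complex.exp (((b r - K r) / 2 : ℝ))) * lineTaylor F := by
  have h1 : AnalyticAt ℝ (fun r => (((b r - K r) / 2 : ℝ) : ℂ)) 0 :=
    analyticAt_ofReal ((h.analytic_b.fun_sub h.analytic_K).fun_div analyticAt_const (by simp))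
  rw [lineTaylor, lineTaylor, lineTaylor, ← taylor_mul _ hF]
  · refine taylor_congr ?_
    filter_upwards [h.y_eq] with r hr
    simpa [adaptedPotential] using hr
  · exact (analyticAt_cexp.restrictScalars (𝕜 := ℝ)).comp h1

lemma eventuallyEq_momentSeries {m : ℕ → ℂ} (hm : 0 < momentRadius m)
    (hy : ∀ n, iteratedDeriv n y 0 = m n) : y =ᶠ[𝓝 0] momentSeries m := by
  apply eventuallyEq_of_lineTaylor_eq h.analytic_y (analyticAt_momentSeries hm)
  ext n
  rw [lineTaylor_momentSeries hm, coeff_lineTaylor, hy, coeff_mk]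

end IsAdaptedGauge

end AdaptedSeries

/-! ### Taylor series along the null direction -/

section NullTaylor

section General

variable {E E' : Type*} [NormedAddCommGroup E] [NormedSpace ℝ E] [NormedAddCommGroup E']
  [NormedSpace ℝ E'] {F : E → ℂ}

lemma taylor_comp_linear (l : E' →L[ℝ] E) (u₁ u₂ : E') (hF : AnalyticAt ℝ F 0) :
    taylor u₁ u₂ (fun z => F (l z)) = taylor (l u₁) (l u₂) F := by
  ext n
  induction n generalizing F with
  | zero => simp
  | succ n ih =>
    have h : cderiv u₁ u₂ (fun z => F (l z)) =ᶠ[𝓝 0] fun z => cderiv (l u₁) (l u₂) F (l z) := by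
      have hl : Filter.Tendsto l (𝓝 0) (𝓝 0) := by
        simpa using l.continuous.tendsto 0
      filter_upwards [hl.eventually hF.eventually_analyticAt] with z hz
      exact cderiv_comp_linear l u₁ u₂ z hz.differentiableAt
    rw [coeff_succ_taylor, coeff_succ_taylor, taylor_congr h, ih (analyticAt_cderiv hF)]

lemma coeff_taylor_conj (v₁ v₂ : E) (hF : AnalyticAt ℝ F 0) (n : ℕ) :
    coeff n (taylor v₁ (-v₂) fun x => conj (F x)) = conj (coeff n (taylor v₁ v₂ F)) := by
  induction n generalizing F with
  | zero => simp
  | succ n ih =>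
    have h : cderiv v₁ (-v₂) (fun x => conj (F x)) =ᶠ[𝓝 0] fun x => conj (cderiv v₁ v₂ F x) := by
      filter_upwards [hF.eventually_analyticAt] with x hx
      have h1 : HasFDerivAt (fun x => conj (F x)) _ x :=
        (Complex.conjCLE : ℂ →L[ℝ] ℂ).hasFDerivAt.comp x hx.differentiableAt.hasFDerivAt
      simp [cderiv, h1.fderiv]
    rw [coeff_succ_taylor, coeff_succ_taylor, taylor_congr h, ih (analyticAt_cderiv hF)]
    simp

end General

/-- The point of the half plane `ỹ = 0` with `(z̃ + i x̃) / 2 = w`. -/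
def planePt : ℂ →L[ℝ] Pt :=
  ContinuousLinearMap.pi ![(2 : ℝ) • Complex.imCLM, 0, (2 : ℝ) • Complex.reCLM]

lemma planePt_apply (w : ℂ) : planePt w = ![2 * w.im, 0, 2 * w.re] := by
  ext i
  obtain rfl | rfl | rfl := fin_three_cases i <;> simp [planePt]

/-- The Taylor series at the origin along the null direction `∂_z̃ - i ∂_x̃`. -/
abbrev nullTaylor (F : Pt → ℂ) : ℂ⟦X⟧ := taylor (Pi.single 2 1 : Pt) (-Pi.single 0 1) F

variable {F G : Pt → ℂ}

/-- `planePt` sends the direction `1/2 + i · (-i/2)` of `∂/∂w` to the null direction, with the two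
factors of `i` kept formally distinct. -/
lemma nullTaylor_eq (hF : AnalyticAt ℝ F 0) :
    taylor (1 / 2 : ℂ) (-(Complex.I / 2)) (fun w => F ![2 * w.im, 0, 2 * w.re]) =
      nullTaylor F := by
  simp only [← planePt_apply]
  rw [taylor_comp_linear _ _ _ hF]
  congr 1
  · ext i
    obtain rfl | rfl | rfl := fin_three_cases i <;> simp [planePt_apply]
  · ext i
    obtain rfl | rfl | rfl := fin_three_cases i <;> simp [planePt_apply]

lemma nullTaylor_nullDeriv (F : Pt → ℂ) :
    nullTaylor (nullDeriv F) = d⁄dX ℂ (nullTaylor F) := taylor_cderiv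

/-- Analytic functions that agree on the half plane `ỹ = 0` off the axis have the same Taylor
series along the null direction. -/
lemma nullTaylor_congr (hF : AnalyticAt ℝ F 0) (hG : AnalyticAt ℝ G 0)
    (h : ∀ᶠ p in 𝓝 (0 : Pt), p 1 = 0 → p 0 ≠ 0 → F p = G p) : nullTaylor F = nullTaylor G := by
  rw [← nullTaylor_eq hF, ← nullTaylor_eq hG]
  simp only [← planePt_apply]
  have hl : Filter.Tendsto planePt (𝓝 0) (𝓝 0) := by
    simpa using planePt.continuous.tendsto 0
  apply taylor_congr
  filter_upwards [(hl.eventually h).eventually_nhds, hl.eventually hF.eventually_analyticAt,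
    hl.eventually hG.eventually_analyticAt] with w h1 h2 h3
  by_cases hw : w.im = 0
  -- A point of the axis is approached within the plane by points off the axis, and both functions
  -- are continuous there.
  · have hpath : Filter.Tendsto (fun t : ℝ => w + t * Complex.I) (𝓝[≠] 0) (𝓝 w) := by
      have hc : Continuous fun t : ℝ => w + t * Complex.I := by fun_prop
      simpa using (hc.tendsto 0).mono_left nhdsWithin_le_nhds
    have hF' := (h2.continuousAt.comp planePt.continuous.continuousAt).tendsto.comp hpath
    have hG' := (h3.continuousAt.comp planePt.continuous.continuousAt).tendsto.comp hpath
    refine tendsto_nhds_unique_of_eventuallyEq hF' hG' ?_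
    filter_upwards [hpath.eventually h1, self_mem_nhdsWithin] with t ht ht0
    have ht0 : t ≠ 0 := ht0
    exact ht (by simp [planePt_apply]) (by simp [planePt_apply, hw, ht0])
  · exact h1.self_of_nhds (by simp [planePt_apply]) (by simp [planePt_apply, hw])

lemma nullTaylor_coord (i : Fin 3) : nullTaylor (fun x => (x i : ℂ)) = C (nullVec i) * X := by
  apply derivative.ext
  · have h : nullDeriv (fun x => (x i : ℂ)) = fun _ => nullVec i :=
      funext fun p => nullDeriv_coord i p
    rw [← nullTaylor_nullDeriv, h, nullTaylor, taylor_const, Derivation.leibniz]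
    simp
  · simp

/-- The complex null line lies on the cone `x̃² + ỹ² + z̃² = 0`. Because of this the factor `(1 -
|φ|²)²` in the field equation becomes `1`. -/
lemma nullTaylor_normSq : nullTaylor (fun x => (normSq x : ℂ)) = 0 := by
  have h (i : Fin 3) := (analyticAt_coordC i 0).fun_pow 2
  have e : (fun x : Pt => (normSq x : ℂ)) =
      fun x => (x 0 : ℂ) ^ 2 + (x 1 : ℂ) ^ 2 + (x 2 : ℂ) ^ 2 := by
    funext x; simp only [normSq]; push_cast; ring
  rw [e, nullTaylor, taylor_add ((h 0).fun_add (h 1)) (h 2), taylor_add (h 0) (h 1)]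
  simp only [taylor_pow (analyticAt_coordC _ 0)]
  rw [← nullTaylor, ← nullTaylor, ← nullTaylor, nullTaylor_coord, nullTaylor_coord,
    nullTaylor_coord]
  simp only [nullVec, Matrix.cons_val]
  simp [mul_pow, ← map_pow]

/-- For an axisymmetric function, conjugation conjugates the Taylor coefficients. -/
lemma coeff_nullTaylor_conj (hF : AnalyticAt ℝ F 0) (hs : IsAxisymmetric F) (n : ℕ) :
    coeff n (nullTaylor fun x => conj (F x)) = conj (coeff n (nullTaylor F)) := by
  rw [nullTaylor, coeff_taylor_conj _ _ hF]
  -- Conjugation replaces `η` by its complex conjugate, and the reflection `x̃ ↦ -x̃`, under which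
  -- `F` is invariant, interchanges the two directions.
  let l : Pt →L[ℝ] Pt := ContinuousLinearMap.pi
    ![-ContinuousLinearMap.proj 0, ContinuousLinearMap.proj 1, ContinuousLinearMap.proj 2]
  have hl (x : Pt) : l x = ![-x 0, x 1, x 2] := by
    ext i
    obtain rfl | rfl | rfl := fin_three_cases i <;> simp [l]
  have h : (fun x => F (l x)) =ᶠ[𝓝 0] F := by
    filter_upwards [hs] with x hx
    exact hx _ (by simp [hl]) (by simp [hl])
  rw [nullTaylor, ← taylor_congr h, taylor_comp_linear _ _ _ hF]
  congr 4
  · ext i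
    obtain rfl | rfl | rfl := fin_three_cases i <;> simp [hl]
  · ext i
    obtain rfl | rfl | rfl := fin_three_cases i <;> simp [hl]

end NullTaylor

/-! ### The field equation and the moment recursion along the null direction -/

section NullSeries

lemma eventually_eventually_of_ne {P : Pt → Prop} (h : ∀ᶠ x in 𝓝[≠] (0 : Pt), P x) :
    ∀ᶠ p in 𝓝 (0 : Pt), p ≠ 0 → ∀ᶠ x in 𝓝 p, P x := by
  filter_upwards [(eventually_nhdsWithin_iff.mp h).eventually_nhds] with p hp h0
  filter_upwards [hp, eventually_ne_nhds h0] with x hx hx0 using hx hx0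

lemma ne_zero_of_coord_ne {p : Pt} {i : Fin 3} (h : p i ≠ 0) : p ≠ 0 := fun e => h (by simp [e])

lemma analyticAt_nullDeriv {F : Pt → ℂ} {x : Pt} (hF : AnalyticAt ℝ F x) :
    AnalyticAt ℝ (nullDeriv F) x := analyticAt_cderiv hF

/-- The field equation for the function `β` in the metric, along the null direction. -/
lemma nullTaylor_beta (S : StationaryAxisymmetricVacuum) :
    d⁄dX ℂ (nullTaylor fun x => (S.β x : ℂ)) =
      X * (nullTaylor S.f + 2 * X * d⁄dX ℂ (nullTaylor S.f)) *
        (nullTaylor (fun x => conj (S.f x)) +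
          2 * X * d⁄dX ℂ (nullTaylor fun x => conj (S.f x))) := by
  have hf := S.f_analytic
  have hfc := analyticAt_conj hf
  have hβ := analyticAt_nullDeriv (analyticAt_ofReal S.β_analytic)
  have hx (i : Fin 3) := analyticAt_coordC i 0
  have hN : AnalyticAt ℝ (fun x => (normSq x : ℂ)) 0 := analyticAt_ofReal (analyticAt_normSq 0)
  have hw : AnalyticAt ℝ (fun x : Pt => (x 2 : ℂ) + Complex.I * x 0) 0 :=
    (hx 2).fun_add (analyticAt_const.fun_mul (hx 0))
  have hwt : nullTaylor (fun x : Pt => (x 2 : ℂ) + Complex.I * x 0) = 2 * X := by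
    rw [nullTaylor, taylor_add (hx 2) (analyticAt_const.fun_mul (hx 0)),
      taylor_mul analyticAt_const (hx 0), taylor_const, ← nullTaylor, ← nullTaylor,
      nullTaylor_coord, nullTaylor_coord, ← mul_assoc, ← map_mul]
    simp [nullVec, two_mul]
  have hfac : ∀ {G : Pt → ℂ}, AnalyticAt ℝ G 0 →
      AnalyticAt ℝ (fun x => G x + ((x 2 : ℂ) + Complex.I * x 0) * nullDeriv G x) 0 ∧
      nullTaylor (fun x => G x + ((x 2 : ℂ) + Complex.I * x 0) * nullDeriv G x) =
        nullTaylor G + 2 * X * d⁄dX ℂ (nullTaylor G) := by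
    intro G hG
    have h1 := hw.fun_mul (analyticAt_nullDeriv hG)
    refine ⟨hG.fun_add h1, ?_⟩
    rw [nullTaylor, taylor_add hG h1, taylor_mul hw (analyticAt_nullDeriv hG), ← nullTaylor,
      ← nullTaylor, hwt, ← nullTaylor, nullTaylor_nullDeriv]
  have hone : AnalyticAt ℝ (fun x => 1 - (normSq x : ℂ) * (S.f x * conj (S.f x))) 0 :=
    analyticAt_const.fun_sub (hN.fun_mul (hf.fun_mul hfc))
  have honet : nullTaylor (fun x => 1 - (normSq x : ℂ) * (S.f x * conj (S.f x))) = 1 := by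
    have hNt := nullTaylor_normSq
    rw [nullTaylor] at hNt
    rw [nullTaylor, taylor_sub analyticAt_const (hN.fun_mul (hf.fun_mul hfc)),
      taylor_mul hN (hf.fun_mul hfc), hNt, taylor_const]
    simp
  have hIx : AnalyticAt ℝ (fun x : Pt => Complex.I * (x 0 : ℂ)) 0 :=
    analyticAt_const.fun_mul (hx 0)
  have hIxt : nullTaylor (fun x : Pt => Complex.I * (x 0 : ℂ)) = X := by
    rw [nullTaylor, taylor_mul analyticAt_const (hx 0), taylor_const, ← nullTaylor,
      nullTaylor_coord, ← mul_assoc, ← map_mul]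
    simp [nullVec]
  have key := nullTaylor_congr ((hone.fun_pow 2).fun_mul hβ)
    ((hIx.fun_mul (hfac hf).1).fun_mul (hfac hfc).1) (by
      filter_upwards [hf.eventually_analyticAt, S.β_analytic.eventually_analyticAt,
        eventually_eventually_of_ne S.potential_eq, eventually_eventually_of_ne S.lam_pos,
        eventually_eventually_of_ne S.ricci_eq] with p h1 h2 h3 h4 h5 hp hp0
      have hne := ne_zero_of_coord_ne hp0
      exact nullDeriv_beta_eq h2 h1 hp hp0 (h3 hne) (h4 hne) (h5 hne).self_of_nhds)
  rw [nullTaylor, nullTaylor, taylor_mul (hone.fun_pow 2) hβ, taylor_pow hone,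
    taylor_mul (hIx.fun_mul (hfac hf).1) (hfac hfc).1, taylor_mul hIx (hfac hf).1,
    ← nullTaylor, ← nullTaylor, ← nullTaylor, ← nullTaylor, ← nullTaylor, honet, hIxt,
    (hfac hf).2, (hfac hfc).2, nullTaylor_nullDeriv] at key
  simpa using key

/-- No conical singularity: along the `ỹ`-axis the component `ĥ_{00}` is `e^{-2β}`, while its value
at `Λ` is `1`, so continuity of the metric forces `β(Λ) = 0`. -/
lemma StationaryAxisymmetricVacuum.β_zero (S : StationaryAxisymmetricVacuum) : S.β 0 = 0 := by
  have hpath : Filter.Tendsto (fun t : ℝ => t • (Pi.single 1 1 : Pt)) (𝓝[≠] 0) (𝓝 0) := by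
    have hc : Continuous fun t : ℝ => t • (Pi.single 1 1 : Pt) := by fun_prop
    simpa using (hc.tendsto 0).mono_left nhdsWithin_le_nhds
  have h1 := (S.metric_smooth 0 0).continuousAt.tendsto.comp hpath
  have h2 := ((continuousAt_const.mul S.β_analytic.continuousAt).rexp (f := fun x => -2 * S.β x)
    ).tendsto.comp hpath
  have h3 := tendsto_nhds_unique_of_eventuallyEq h1 h2 (by
    filter_upwards [self_mem_nhdsWithin] with t ht
    have ht0 : t ≠ 0 := ht
    simp [hatMetric, azimuthForm]
    field_simp
    ring)
  have h4 : Real.exp (-2 * S.β 0) = 1 := by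
    rw [← h3]
    simp [hatMetric]
  simpa using h4

/-- Axisymmetry makes `∂_x̃ κ` vanish at `Λ`, leaving only the derivative along the axis. -/
lemma IsConformalGauge.nullDeriv_zero {κ : Pt → ℝ} {c : ℝ} (hκ : IsConformalGauge κ c) :
    nullDeriv (fun x => (κ x : ℂ)) 0 = c := by
  have hd := hκ.analytic.differentiableAt
  let l : Pt →L[ℝ] Pt := ContinuousLinearMap.pi
    ![-ContinuousLinearMap.proj 0, ContinuousLinearMap.proj 1, ContinuousLinearMap.proj 2]
  have hl (x : Pt) : l x = ![-x 0, x 1, x 2] := by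
    ext i
    obtain rfl | rfl | rfl := fin_three_cases i <;> simp [l]
  have h : (fun x => κ (l x)) =ᶠ[𝓝 0] κ := by
    filter_upwards [hκ.axisymmetric] with x hx
    exact hx _ (by simp [hl]) (by simp [hl])
  have h0 : pd 0 κ 0 = -pd 0 κ 0 := by
    have hl0 : l 0 = 0 := map_zero l
    have h1 : HasFDerivAt (fun x => κ (l x)) _ 0 :=
      HasFDerivAt.comp (0 : Pt) (g := κ) (by rw [hl0]; exact hd.hasFDerivAt) l.hasFDerivAt
    have hls : l (Pi.single 0 1) = -Pi.single 0 1 := by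
      ext i
      obtain rfl | rfl | rfl := fin_three_cases i <;> simp [hl]
    have h2 : fderiv ℝ κ 0 (Pi.single 0 1) = fderiv ℝ κ 0 (l (Pi.single 0 1)) := by
      conv_lhs => rw [← h.fderiv_eq, h1.fderiv]
      rfl
    rw [hls, map_neg] at h2
    exact h2
  have h1 : pd 0 κ 0 = 0 := by linarith
  rw [nullDeriv_ofReal hd, hκ.deriv_axis, h1]
  simp

end NullSeries

/-! ### The moment recursion along the null direction -/

section MomentRecursion

variable {β κ : Pt → ℝ}

lemma sum_nullVec_tildeMetric {p : Pt} (hp : p 1 = 0) :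
    ∑ i, ∑ j, nullVec i * nullVec j * (tildeMetric β κ p i j : ℂ) = 0 := by
  rw [tildeMetric_eq]
  exact sum_nullVec_conformalMetric κ (azimuthCoeff β) hp

lemma contract_covDeriv_tildeMetric {n : ℕ} {T : Pt → Tensor n} {p : Pt} (hβ : AnalyticAt ℝ β p)
    (hκ : AnalyticAt ℝ κ p) (hT : AnalyticAt ℝ T p) (hp : p 1 = 0) (h0 : p 0 ≠ 0) :
    contract nullVec (covDeriv (tildeMetric β κ) T p) =
      nullDeriv (fun y => contract nullVec (T y)) p -
        n * (2 * nullDeriv (fun x => (κ x : ℂ)) p) * contract nullVec (T p) := by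
  refine contract_covDeriv (fun a => ?_) fun k => ?_
  · exact (differentiableAt_pi.mp hT.differentiableAt) a
  · rw [tildeMetric_eq]
    refine sum_nullVec_christoffel hκ (analyticAt_azimuthCoeff hβ h0) ?_ hp k
    rw [(eventually_azimuthFactor_azimuthCoeff β h0).self_of_nhds]
    exact (Real.exp_pos _).ne'

/-- Multiplied by `x̃` so that the right-hand side is analytic at `Λ`, as required by
`nullTaylor_congr`; the formula itself is available only off the axis. -/
lemma sum_nullVec_ricci_tildeMetric {p : Pt} (hβ : AnalyticAt ℝ β p) (hκ : AnalyticAt ℝ κ p)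
    (hp : p 1 = 0) (h0 : p 0 ≠ 0) :
    p 0 * (∑ i, ∑ j, nullVec i * nullVec j * (ricci (tildeMetric β κ) i j p : ℂ)) =
      p 0 * (nullDeriv (nullDeriv fun x => (β x : ℂ)) p - nullDeriv (fun x => (β x : ℂ)) p ^ 2
        - nullDeriv (nullDeriv fun x => (κ x : ℂ)) p + nullDeriv (fun x => (κ x : ℂ)) p ^ 2)
      - 2 * Complex.I * nullDeriv (fun x => (β x : ℂ)) p := by
  have h0' : (p 0 : ℂ) ≠ 0 := by exact_mod_cast h0
  rw [tildeMetric_eq, sum_nullVec_ricci hκ (analyticAt_azimuthCoeff hβ h0) hβ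
    (eventually_azimuthFactor_azimuthCoeff β h0) hp h0]
  field_simp
  ring

lemma analyticAt_contract {n : ℕ} {T : Pt → Tensor n} {p : Pt} (hT : AnalyticAt ℝ T p) :
    AnalyticAt ℝ (fun x => contract nullVec (T x)) p := by
  unfold contract
  exact Finset.analyticAt_fun_sum _ fun a _ =>
    analyticAt_const.fun_mul (analyticAt_pi_iff.mp hT a)

variable (hβ : AnalyticAt ℝ β 0) (hκ : AnalyticAt ℝ κ 0)
include hβ hκ

lemma nullTaylor_contract_one {P : (n : ℕ) → Pt → Tensor n} (hP : ∀ n, AnalyticAt ℝ (P n) 0)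
    (h : ∀ᶠ x in 𝓝 (0 : Pt),
      IsSTFPart (tildeMetric β κ x) (covDeriv (tildeMetric β κ) (P 0) x) (P 1 x)) :
    nullTaylor (fun x => contract nullVec (P 1 x)) =
      d⁄dX ℂ (nullTaylor fun x => contract nullVec (P 0 x)) := by
  rw [← nullTaylor_nullDeriv]
  refine nullTaylor_congr (analyticAt_contract (hP 1))
    (analyticAt_nullDeriv (analyticAt_contract (hP 0))) ?_
  filter_upwards [h, hβ.eventually_analyticAt, hκ.eventually_analyticAt,
    (hP 0).eventually_analyticAt] with p h1 h2 h3 h4 hp hp0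
  rw [contract_of_isSTFPart (sum_nullVec_tildeMetric hp) h1,
    contract_covDeriv_tildeMetric h2 h3 h4 hp hp0]
  simp

lemma nullTaylor_contract_succ {n : ℕ} {P : (n : ℕ) → Pt → Tensor n}
    (hP : ∀ n, AnalyticAt ℝ (P n) 0) (a : ℂ)
    (h : ∀ᶠ x in 𝓝 (0 : Pt), IsSTFPart (tildeMetric β κ x)
      (covDeriv (tildeMetric β κ) (P (n + 1)) x -
        a • mulTwo (fun i j => ricci (tildeMetric β κ) i j x) (P n x)) (P (n + 2) x))
    {b R : ℂ⟦X⟧} (hb : nullTaylor (fun x => (β x : ℂ)) = b)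
    (hR : X * (d⁄dX ℂ (d⁄dX ℂ b) - d⁄dX ℂ b ^ 2) + 2 * d⁄dX ℂ b =
      X * (R + d⁄dX ℂ (d⁄dX ℂ (nullTaylor fun x => (κ x : ℂ))) -
        d⁄dX ℂ (nullTaylor fun x => (κ x : ℂ)) ^ 2)) :
    nullTaylor (fun x => contract nullVec (P (n + 2) x)) =
      d⁄dX ℂ (nullTaylor fun x => contract nullVec (P (n + 1) x)) -
      C (2 * ((n : ℂ) + 1)) * d⁄dX ℂ (nullTaylor fun x => (κ x : ℂ)) *
        nullTaylor (fun x => contract nullVec (P (n + 1) x)) -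
      C a * R * nullTaylor (fun x => contract nullVec (P n x)) := by
  have hg (n : ℕ) := analyticAt_contract (hP n)
  have hx := analyticAt_coordC 0 0
  have hβ1 := analyticAt_nullDeriv (analyticAt_ofReal hβ)
  have hβ2 := analyticAt_nullDeriv hβ1
  have hκ1 := analyticAt_nullDeriv (analyticAt_ofReal hκ)
  have hκ2 := analyticAt_nullDeriv hκ1
  have hA := (analyticAt_nullDeriv (hg (n + 1))).fun_sub
    ((AnalyticAt.fun_mul (analyticAt_const (v := 2 * ((n : ℂ) + 1))) hκ1).fun_mul (hg (n + 1)))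
  have hB1 := ((hβ2.fun_sub (hβ1.fun_pow 2)).fun_sub hκ2).fun_add (hκ1.fun_pow 2)
  have hB := (hx.fun_mul hB1).fun_sub
    (AnalyticAt.fun_mul (analyticAt_const (v := 2 * Complex.I)) hβ1)
  have hBg := AnalyticAt.fun_mul (analyticAt_const (v := a)) (hB.fun_mul (hg n))
  have key := nullTaylor_congr (hx.fun_mul (hg (n + 2))) ((hx.fun_mul hA).fun_sub hBg) (by
    filter_upwards [h, hβ.eventually_analyticAt, hκ.eventually_analyticAt,
      (hP (n + 1)).eventually_analyticAt] with p h1 h2 h3 h4 hp hp0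
    rw [contract_of_isSTFPart (sum_nullVec_tildeMetric hp) h1, contract_sub, contract_smul,
      contract_mulTwo, contract_covDeriv_tildeMetric h2 h3 h4 hp hp0]
    have h5 := sum_nullVec_ricci_tildeMetric h2 h3 hp hp0
    push_cast
    linear_combination -a * contract nullVec (P n p) * h5)
  have hxt := nullTaylor_coord 0
  have hd1 : taylor _ _ (nullDeriv fun x => (β x : ℂ)) = _ := nullTaylor_nullDeriv _
  have hd2 : taylor _ _ (nullDeriv fun x => (κ x : ℂ)) = _ := nullTaylor_nullDeriv _
  have hd3 : taylor _ _ (nullDeriv (nullDeriv fun x => (β x : ℂ))) = _ := nullTaylor_nullDeriv _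
  have hd4 : taylor _ _ (nullDeriv (nullDeriv fun x => (κ x : ℂ))) = _ := nullTaylor_nullDeriv _
  have hd5 : taylor _ _ (nullDeriv fun x => contract nullVec (P (n + 1) x)) = _ :=
    nullTaylor_nullDeriv _
  simp only [nullTaylor] at key hxt hd1 hd2 hd3 hd4 hd5 hb hR ⊢
  rw [taylor_mul hx (hg _), taylor_sub (hx.fun_mul hA) hBg, taylor_mul hx hA,
    taylor_sub (analyticAt_nullDeriv (hg (n + 1))) ((analyticAt_const.fun_mul hκ1).fun_mul
    (hg (n + 1))), taylor_mul (analyticAt_const.fun_mul hκ1) (hg _),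
    taylor_mul analyticAt_const hκ1, taylor_const, taylor_mul analyticAt_const (hB.fun_mul (hg n)),
    taylor_mul hB (hg n), taylor_sub (hx.fun_mul hB1) (analyticAt_const.fun_mul hβ1),
    taylor_mul hx hB1, taylor_add ((hβ2.fun_sub (hβ1.fun_pow 2)).fun_sub hκ2) (hκ1.fun_pow 2),
    taylor_sub (hβ2.fun_sub (hβ1.fun_pow 2)) hκ2, taylor_sub hβ2 (hβ1.fun_pow 2),
    taylor_pow hβ1, taylor_pow hκ1, taylor_mul analyticAt_const hβ1, taylor_const, taylor_const,
    hd3, hd4, hd5, hd1, hd2, hxt, hb] at key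
  -- The coordinate `x̃` restricts to `-i r`, so the whole relation has the common factor `-i r`,
  -- and `-2i β'` becomes the summand `2 b'` of `hR`.
  have hν : (C (2 * Complex.I) : ℂ⟦X⟧) = -2 * C (nullVec 0) := by
    rw [← map_ofNat C 2, ← map_neg, ← map_mul]
    simp [nullVec]
  have hν0 : (C (nullVec 0) : ℂ⟦X⟧) * X ≠ 0 := by
    refine mul_ne_zero ?_ X_ne_zero
    rw [Ne, map_eq_zero_iff C C_injective]
    simp [nullVec]
  rw [hν] at key
  apply mul_left_cancel₀ hν0
  linear_combination key - C a * C (nullVec 0) *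
    taylor _ _ (fun x => contract nullVec (P n x)) * hR

end MomentRecursion

/-! ### The leading order part and the moments -/

section LeadingPart

/-- The leading order part of an analytic function is its Taylor series along the null direction. -/
lemma exists_leadingPart {f : Pt → ℂ} (hf : AnalyticAt ℝ f 0) :
    ∃ F : ℝ → ℂ, AnalyticAt ℝ F 0 ∧ lineTaylor F = nullTaylor f ∧
      ∀ G : ℝ → ℂ, IsLeadingOrderPart f G ↔ G =ᶠ[𝓝 0] F := by
  have hfw : AnalyticAt ℝ (fun w : ℂ => f ![2 * w.im, 0, 2 * w.re]) 0 := by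
    simp only [← planePt_apply]
    exact AnalyticAt.comp (g := f) (by simpa using hf) (planePt.analyticAt 0)
  have hcoeff : ∀ {a : ℕ → ℕ → ℂ} {r₀ : ℝ}, 0 < r₀ →
      HasDoubleSeries a r₀ (fun w : ℂ => f ![2 * w.im, 0, 2 * w.re]) →
      ∀ n, coeff n (nullTaylor f) = a n 0 := by
    intro a r₀ hr₀ h n
    rw [← nullTaylor_eq hf]
    exact h.coeff_taylor hr₀ n
  obtain ⟨a, r₀, hr₀, ha⟩ := exists_hasDoubleSeries hfw
  have hs : Summable fun n => ‖a n 0‖ * (r₀ / 2) ^ n := by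
    have h1 := (ha.summable_left (w := ((r₀ / 2 : ℝ) : ℂ)) (by
      rw [Complex.norm_real, Real.norm_of_nonneg (by positivity)]; linarith)).norm
    refine h1.congr fun n => ?_
    rw [norm_mul, norm_pow, Complex.norm_real, Real.norm_of_nonneg (by positivity)]
  obtain ⟨F, hF, hFt⟩ := exists_lineTaylor_eq (half_pos hr₀) hs
  have hFt' : lineTaylor F = nullTaylor f := by
    rw [hFt]
    ext n
    rw [coeff_mk, hcoeff hr₀ ha]
  refine ⟨F, hF, hFt', fun G => ⟨?_, fun hG => ?_⟩⟩
  · rintro ⟨a', r', hr', h1, h2⟩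
    have h3 : ∀ᶠ r : ℝ in 𝓝 0, HasSum (fun n => a' n 0 * (r : ℂ) ^ n) (G r) := by
      filter_upwards [Metric.ball_mem_nhds (0 : ℝ) hr'] with r hr
      exact h2 r (by simpa using hr)
    refine eventuallyEq_of_lineTaylor_eq ⟨_, analyticAt_of_hasSum h3⟩ hF ?_
    rw [taylor_of_hasSum h3, hFt']
    ext n
    rw [coeff_mk, hcoeff hr' h1]
  · obtain ⟨ε, hε, h⟩ := Metric.eventually_nhds_iff_ball.mp (hG.and (hasSum_lineTaylor hF))
    refine ⟨a, min r₀ ε, lt_min hr₀ hε, fun w hw => ha w (hw.trans_le (min_le_left _ _)),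
      fun r hr => ?_⟩
    obtain ⟨h1, h2⟩ := h r (by simpa using hr.trans_le (min_le_right _ _))
    rw [h1]
    simpa [hFt] using h2

end LeadingPart

/-! ### Identification of the moments with the derivatives of `y` at zero -/

section Moments

variable {S : StationaryAxisymmetricVacuum} {κ : Pt → ℝ} {c : ℝ} {m : ℕ → ℂ} {F : ℝ → ℂ}
  {b g K ρ₁ : ℝ → ℝ} {y : ℝ → ℂ}

lemma taylor_half_sub {E : Type*} [NormedAddCommGroup E] [NormedSpace ℝ E] (v₁ v₂ : E)
    {u v : E → ℝ} (hu : AnalyticAt ℝ u 0) (hv : AnalyticAt ℝ v 0) :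
    taylor v₁ v₂ (fun x => (((u x - v x) / 2 : ℝ) : ℂ)) =
      C (1 / 2) * (taylor v₁ v₂ (fun x => (u x : ℂ)) - taylor v₁ v₂ fun x => (v x : ℂ)) := by
  have hu' := analyticAt_ofReal hu
  have hv' := analyticAt_ofReal hv
  rw [← taylor_sub hu' hv', ← taylor_const (v₁ := v₁) (v₂ := v₂),
    ← taylor_mul analyticAt_const (hu'.fun_sub hv')]
  congr 1
  funext x
  push_cast
  ring

lemma tildePotential_eq {p : Pt} (h0 : p 0 ≠ 0)
    (hpot : ernstPotential S.lam S.om p = (√(normSq p) : ℂ) * S.f p) :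
    tildePotential S κ p = Complex.exp (((S.β p - κ p) / 2 : ℝ)) * S.f p := by
  have hN := normSq_pos h0
  have hs : √(normSq p) ≠ 0 := (Real.sqrt_pos.mpr hN).ne'
  have h1 : √(Real.exp (κ p) * hatOmega S.β p) =
      √(normSq p) * Real.exp (-((S.β p - κ p) / 2)) := by
    have : Real.exp (κ p) * hatOmega S.β p =
        normSq p * Real.exp (-((S.β p - κ p) / 2)) ^ 2 := by
      rw [hatOmega, ← Real.exp_nat_mul, mul_left_comm, ← Real.exp_add]
      congr 2
      push_cast
      ring
    rw [this, Real.sqrt_mul hN.le, Real.sqrt_sq (Real.exp_pos _).le]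
  have hs' : ((√(normSq p) : ℝ) : ℂ) ≠ 0 := by exact_mod_cast hs
  rw [tildePotential, hpot, h1, Complex.ofReal_mul, mul_div_mul_left _ _ hs', Real.exp_neg,
    Complex.ofReal_inv, div_inv_eq_mul, Complex.ofReal_exp, mul_comm]

/-- The function `β` and the function `b` of the adapted gauge have the same Taylor series. -/
lemma IsAdaptedGauge.nullTaylor_beta (h : IsAdaptedGauge F c b g K ρ₁ y) (hF : AnalyticAt ℝ F 0)
    (hFt : lineTaylor F = nullTaylor S.f) :
    nullTaylor (fun x => (S.β x : ℂ)) = realTaylor b := by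
  have hconj : lineTaylor (fun r => conj (F r)) = nullTaylor fun x => conj (S.f x) := by
    ext n
    rw [coeff_lineTaylor_conj hF, coeff_nullTaylor_conj S.f_analytic S.f_axisymmetric, hFt]
  apply derivative.ext
  · rw [AxisymMultipole.nullTaylor_beta, h.series_deriv_b hF, hconj, hFt]
  · simp [S.β_zero, h.b_zero]

lemma IsAdaptedGauge.iteratedDeriv_eq (h : IsAdaptedGauge F c b g K ρ₁ y)
    (hF : AnalyticAt ℝ F 0) (hFt : lineTaylor F = nullTaylor S.f) (hκ : IsConformalGauge κ c)
    (hm : S.HasMoments κ m) (n : ℕ) : iteratedDeriv n y 0 = m n := by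
  obtain ⟨P, hP, hP0, hP1, hPn, hPm⟩ := hm
  have hβ := S.β_analytic
  have hb := h.nullTaylor_beta hF hFt
  set k := nullTaylor fun x => (κ x : ℂ) with hk
  -- The given gauge `κ` is compared with the adapted one. Since the curvature term vanishes for
  -- `K`, that for `κ` is `K'' - K'² - k'' + k'²`, which is `R` in terms of `s`.
  set s := d⁄dX ℂ k - d⁄dX ℂ (realTaylor K) with hs
  set R := s ^ 2 + 2 * s * d⁄dX ℂ (realTaylor K) - d⁄dX ℂ s with hR
  have hβκ : AnalyticAt ℝ (fun x => (((S.β x - κ x) / 2 : ℝ) : ℂ)) 0 :=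
    analyticAt_ofReal ((hβ.fun_sub hκ.analytic).fun_div analyticAt_const (by simp))
  have hbK : AnalyticAt ℝ (fun r => (((b r - K r) / 2 : ℝ) : ℂ)) 0 :=
    analyticAt_ofReal ((h.analytic_b.fun_sub h.analytic_K).fun_div analyticAt_const (by simp))
  have hexp : ∀ {E : Type} [NormedAddCommGroup E] [NormedSpace ℝ E] {u : E → ℂ},
      AnalyticAt ℝ u 0 → AnalyticAt ℝ (fun x => Complex.exp (u x)) 0 := fun hu =>
    (analyticAt_cexp.restrictScalars (𝕜 := ℝ)).comp hu
  set e₁ := nullTaylor fun x => Complex.exp (((S.β x - κ x) / 2 : ℝ)) with he₁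
  set e₂ := lineTaylor fun r => Complex.exp (((b r - K r) / 2 : ℝ)) with he₂
  set e₃ := lineTaylor fun r => Complex.exp (-((b r - K r) / 2 : ℝ)) with he₃
  -- The two zeroth potentials are `e₁ F` and `e₂ F`, so their ratio is `e₁ e₃`.
  have h23 : e₃ * e₂ = 1 := by
    rw [he₃, he₂, lineTaylor, lineTaylor, ← taylor_mul (hexp hbK.fun_neg) (hexp hbK)]
    simp [← Complex.exp_add, taylor_const]
  have hd1 : d⁄dX ℂ e₁ = e₁ * (C (1 / 2) * (d⁄dX ℂ (realTaylor b) - d⁄dX ℂ k)) := by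
    rw [he₁, nullTaylor, taylor_exp_derivative hβκ, taylor_half_sub _ _ hβ hκ.analytic,
      Derivation.leibniz, derivative_C, ← nullTaylor, ← nullTaylor, hb]
    simp only [smul_eq_mul, mul_zero, add_zero, map_sub]
    rfl
  have hd3 : d⁄dX ℂ e₃ = e₃ * (-C (1 / 2) *
      (d⁄dX ℂ (realTaylor b) - d⁄dX ℂ (realTaylor K))) := by
    rw [he₃, lineTaylor, taylor_exp_derivative hbK.fun_neg, taylor_neg hbK,
      taylor_half_sub _ _ h.analytic_b h.analytic_K, map_neg, Derivation.leibniz, derivative_C]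
    simp
  have hp0 : nullTaylor (fun x => contract nullVec (P 0 x)) = e₁ * lineTaylor F := by
    rw [hFt, he₁, nullTaylor, nullTaylor, nullTaylor, ← taylor_mul (hexp hβκ) S.f_analytic]
    refine nullTaylor_congr (analyticAt_contract (hP 0)) ((hexp hβκ).fun_mul S.f_analytic) ?_
    filter_upwards [eventually_nhdsWithin_iff.mp hP0, eventually_nhdsWithin_iff.mp S.potential_eq]
      with p h1 h2 hp hp0
    have hne := ne_zero_of_coord_ne hp0
    rw [← tildePotential_eq hp0 (h2 hne), h1 hne]
    simp [contract]
  have hinv := gauge_invariance s (fun n => lineTaylor (adaptedPotential y K ρ₁ n))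
    (p := fun n => nullTaylor fun x => contract nullVec (P n x)) (e := e₁ * e₃)
    (K := d⁄dX ℂ (realTaylor K)) (R := R) h.series_deriv_potential
    (by
      rw [Derivation.leibniz, hd1, hd3, hs]
      simp only [smul_eq_mul]
      ring)
    (by
      rw [hp0, h.series_potential_zero hF, ← he₂]
      linear_combination -(e₁ * lineTaylor F) * h23)
    (nullTaylor_contract_one hβ hκ.analytic hP hP1) hR
    (fun n => by
      have h1 := nullTaylor_contract_succ hβ hκ.analytic hP _ (hPn n) hb (R := R) (by
        rw [h.series_second_order, hR, hs, ← hk, map_sub]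
        ring)
      change nullTaylor (fun x => contract nullVec (P (n + 2) x)) = _
      rw [h1, hs]
      ring) n
  -- Here the normalization of the gauges enters: both have derivative `c` at `Λ`, so in the
  -- transformed field only the summand without a power of `s` survives at the origin.
  have hs0 : constantCoeff s = 0 := by
    have h1 : constantCoeff (d⁄dX ℂ k) = c := by
      rw [hk, ← nullTaylor_nullDeriv, constantCoeff_taylor, hκ.nullDeriv_zero]
    have h2 : constantCoeff (d⁄dX ℂ (realTaylor K)) = c := by
      rw [← realTaylor_deriv h.analytic_K, constantCoeff_taylor, h.deriv_K_zero]
    rw [hs, map_sub, h1, h2, sub_self]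
  have hc := congrArg constantCoeff hinv
  obtain ⟨Q, hQ, hQ'⟩ := hPm n
  have hPc : contract nullVec (P n 0) = m n := by
    rw [hQ', contract_smul, contract_of_isSTFPart _ hQ, contract_zTensor, mul_one]
    exact sum_nullVec_tildeMetric (by simp)
  have hsum : constantCoeff (gaugeSum s (fun n => lineTaylor (adaptedPotential y K ρ₁ n)) n) =
      iteratedDeriv n y 0 := by
    rw [gaugeSum, map_sum, Finset.sum_eq_single (0, n)]
    · simp [h.constantCoeff_potential]
    · rintro ⟨i, j⟩ hij hne
      have hi : i ≠ 0 := by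
        rintro rfl
        simp at hij
        exact hne (by rw [hij])
      simp [hs0, hi]
    · intro hn
      simp at hn
  rw [map_mul, hsum, map_mul, he₁, he₃] at hc
  simp only [constantCoeff_taylor, hPc] at hc
  simpa [S.β_zero, hκ.zero, h.b_zero, h.K_zero] using hc.symm

end Moments

/-! ### The main theorem -/

section Main

variable {m : ℕ → ℂ} {c : ℝ}

lemma analyticAt_gothicG (hm : 0 < momentRadius m) (c : ℝ) : AnalyticAt ℝ (gothicG m c) 0 := by
  obtain ⟨J, Q, -, -, -, hQ, -, -, h⟩ := gothicG_spec hm c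
  exact hQ.congr h.symm

lemma analyticAt_one_add_mul_gothicG (hm : 0 < momentRadius m) (c : ℝ) :
    AnalyticAt ℝ (fun t => 1 + t * gothicG m c t) 0 :=
  analyticAt_const.fun_add (analyticAt_id.fun_mul (analyticAt_gothicG hm c))

lemma analyticAt_rOfRho (hm : 0 < momentRadius m) (c : ℝ) : AnalyticAt ℝ (rOfRho m c) 0 :=
  analyticAt_id.fun_div (analyticAt_one_add_mul_gothicG hm c) (by simp)

lemma rOfRho_zero : rOfRho m c 0 = 0 := by simp [rOfRho]

lemma deriv_rOfRho_zero (hm : 0 < momentRadius m) (c : ℝ) : deriv (rOfRho m c) 0 = 1 := by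
  have h := (hasDerivAt_id (0 : ℝ)).div
    (analyticAt_one_add_mul_gothicG hm c).differentiableAt.hasDerivAt (by simp)
  exact h.deriv.trans (by simp)

lemma exists_inverse_rOfRho (hm : 0 < momentRadius m) (c : ℝ) :
    ∃ ρ : ℝ → ℝ, AnalyticAt ℝ ρ 0 ∧ ρ 0 = 0 ∧ (∀ᶠ r in 𝓝 0, rOfRho m c (ρ r) = r) ∧
      ∀ᶠ t in 𝓝 0, ρ (rOfRho m c t) = t := by
  have hr := analyticAt_rOfRho hm c
  have hne : deriv (rOfRho m c) 0 ≠ 0 := by rw [deriv_rOfRho_zero hm c]; exact one_ne_zero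
  have hleft : ∀ᶠ t in 𝓝 0, hr.hasStrictDerivAt.localInverse _ _ _ hne (rOfRho m c t) = t :=
    HasStrictDerivAt.eventually_left_inverse hr.hasStrictDerivAt hne
  have hright := HasStrictDerivAt.eventually_right_inverse hr.hasStrictDerivAt hne
  have hσ := hr.analyticAt_localInverse hne
  have h0 := hleft.self_of_nhds
  rw [rOfRho_zero] at hright hσ h0
  exact ⟨_, hσ, h0, hright, hleft⟩

lemma analyticAt_sqrt {u : ℝ → ℝ} {x : ℝ} (hu : AnalyticAt ℝ u x) (h0 : 0 < u x) :
    AnalyticAt ℝ (fun t => √(u t)) x := by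
  refine ((hu.log h0).fun_div analyticAt_const two_ne_zero).rexp.congr ?_
  filter_upwards [hu.continuousAt.eventually_const_lt h0] with t ht
  rw [Function.comp_apply, Real.exp_half, Real.exp_log ht]

end Main

end AxisymMultipole

end

theorem mainTheorem2 (m : ℕ → ℂ) (hm : 0 < AxisymMultipole.momentRadius m) (c : ℝ) :
    AnalyticAt ℝ (AxisymMultipole.gothicG m c) 0 ∧
    ∃ (ρ : ℝ → ℝ) (fL : ℝ → ℂ),
      AnalyticAt ℝ ρ 0 ∧ ρ 0 = 0 ∧
      (∀ᶠ r in 𝓝 (0 : ℝ), AxisymMultipole.rOfRho m c (ρ r) = r) ∧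
      (∀ᶠ t in 𝓝 (0 : ℝ), ρ (AxisymMultipole.rOfRho m c t) = t) ∧
      (∀ r : ℝ, fL r = (√(1 + ρ r * AxisymMultipole.gothicG m c (ρ r)) : ℂ) *
        AxisymMultipole.momentSeries m (ρ r)) ∧
      AnalyticAt ℝ fL 0 ∧
      ∀ (S : AxisymMultipole.StationaryAxisymmetricVacuum) (κ : AxisymMultipole.Pt → ℝ),
        AxisymMultipole.IsConformalGauge κ c → S.HasMoments κ m →
        ∀ G : ℝ → ℂ, AxisymMultipole.IsLeadingOrderPart S.f G ↔ G =ᶠ[𝓝 0] fL := by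
  obtain ⟨ρ, hρ, hρ0, hright, hleft⟩ := AxisymMultipole.exists_inverse_rOfRho hm c
  refine ⟨AxisymMultipole.analyticAt_gothicG hm c, ρ, _, hρ, hρ0, hright, hleft, fun _ => rfl,
    ?_, fun S κ hκ hS G => ?_⟩
  · have h1 : AnalyticAt ℝ (fun r => √(1 + ρ r * AxisymMultipole.gothicG m c (ρ r))) 0 :=
      AxisymMultipole.analyticAt_sqrt (AnalyticAt.comp
        (g := fun t => 1 + t * AxisymMultipole.gothicG m c t)
        (by rw [hρ0]; exact AxisymMultipole.analyticAt_one_add_mul_gothicG hm c) hρ) (by simp [hρ0])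
    exact (AxisymMultipole.analyticAt_ofReal h1).fun_mul (AnalyticAt.comp
      (g := AxisymMultipole.momentSeries m)
      (by rw [hρ0]; exact AxisymMultipole.analyticAt_momentSeries hm) hρ)
  · obtain ⟨F, hF, hFt, hiff⟩ := AxisymMultipole.exists_leadingPart S.f_analytic
    obtain ⟨b, g, K, ρ₁, y, h⟩ := AxisymMultipole.exists_isAdaptedGauge hF c
    obtain ⟨h1, h2⟩ := h.functions_of_moments hm hF
      (h.eventuallyEq_momentSeries hm (h.iteratedDeriv_eq hF hFt hκ hS))
    -- Both `ρ₁` and `ρ` invert `r(ρ)` near zero: applying `ρ` to `r(ρ₁ r) = r` gives `ρ₁ r = ρ r`.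
    have hFL : F =ᶠ[𝓝 0] fun r => (√(1 + ρ r * AxisymMultipole.gothicG m c (ρ r)) : ℂ) *
        AxisymMultipole.momentSeries m (ρ r) := by
      filter_upwards [h1, h2, h.tendsto_ρ.eventually hleft] with r h3 h4 h5
      rw [h3] at h5
      rw [h4, h5]
    rw [hiff]
    exact ⟨fun hG => hG.trans hFL, fun hG => hG.trans hFL.symm⟩
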